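/- **Setting.** Let $L_1, L_2$ be countable torsion free abelian groups, let $\widehat{L_2}$ be the (compact) Pontryagin dual of the discrete group $L_2$, and let $\iota : L_1 \hookrightarrow \widehat{L_2}$ be an injective group homomorphism with dense range. For a subgroup $P$ of $L_1$ (resp. of $L_2$), let $P^\perp$ be the subgroup of $L_2$ (resp. of $L_1$) orthogonal to $P$ for the bicharacter $(g,h) \mapsto \iota(g)(h)$. A direct sum decomposition $L_1 = P_1 \oplus Q_1$ is called *admissible* if the closures of $\iota(P_1)$ and $\iota(Q_1)$ give a direct sum decomposition of $\widehat{L_2}$. Put $H_i = L_i^3$, let $\Omega(g,h) = \prod_{j=1}^3 \iota(g_j)(h_j)$ for $g \in H_1$, $h \in H_2$, and let $H_1$ act by translation on $\widehat{H_2} = \widehat{L_2}^3$ (with its Haar probability measure) through the embedding $g \mapsto \Omega(g,\cdot)$. Let $A_0 = L^\infty(\widehat{H_2}) \rtimes H_1$ with its canonical trace $\tau$ and canonical unitaries $u_g$, $g \in H_1$. For $h \in H_2$, let $u_h \in L^\infty(\widehat{H_2})$ be the function $x \mapsto \overline{x(h)}$, so that $u_g u_h = \Omega(g,h) u_h u_g$.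 For a subgroup $S$ of $H_i$, let $L(S)$ be the von Neumann algebra generated by $\{u_s : s \in S\}$, and regard $S$ as a group of unitaries via $s \mapsto u_s$. Let $\mathrm{SL}(3,\mathbb{Z})$ act on $A_0$ by the trace preserving automorphisms $\beta_a$ given by $\beta_a(f) = f(a^{-1}\,\cdot\,)$ for $f \in L^\infty(\widehat{H_2})$ and $\beta_a(u_g) = u_{a g}$ for $g \in H_1$, where $a$ acts on $H_1 = L_1^3$ and on $\widehat{H_2} = \widehat{L_2}^3$ by matrix multiplication. A *group measure space (gms) decomposition* of $A_0$ is a pair $(B,\Lambda)$ of a maximal abelian von Neumann subalgebra $B \subset A_0$ and a subgroup $\Lambda$ of the unitary group of $A_0$ that normalizes $B$, such that $A_0 = (B \cup \Lambda)''$ and $E_B(v) = 0$ for all $v \in \Lambda \setminus \{1\}$, where $E_B$ is the $\tau$-preserving conditional expectation onto $B$. It is *$\mathrm{SL}(3,\mathbb{Z})$-invariant* if $\beta_a(B) = B$ and $\beta_a(\Lambda) = \Lambda$ for all $a$. Two gms decompositions $(B,\Lambda)$ and $(B',\Lambda')$ are *identical* if $B = B'$ and $\mathbb{T}\Lambda =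 \mathbb{T}\Lambda'$. **Proposition 6.1.** 1. Let $L_1 = P_1 \oplus Q_1$ be an admissible direct sum decomposition and put $P_2 = P_1^\perp$, $Q_2 = Q_1^\perp$. Then $L_2 = P_2 \oplus Q_2$, $P_1 = P_2^\perp$, $Q_1 = Q_2^\perp$, and $$\bigl(L(P_1^3) \vee L(P_2^3),\; Q_1^3 Q_2^3\bigr)$$ is an $\mathrm{SL}(3,\mathbb{Z})$-invariant gms decomposition of $A_0$. 2. Conversely, every $\mathrm{SL}(3,\mathbb{Z})$-invariant gms decomposition $(B_0,\Lambda_0)$ of $A_0$ is equal to $\bigl(L(P_1^3) \vee L(P_2^3), Q_1^3 Q_2^3\bigr)$ for some admissible direct sum decomposition $L_1 = P_1 \oplus Q_1$, with $P_2 = P_1^\perp$ and $Q_2 = Q_1^\perp$. This decomposition is unique; moreover, it is the only admissible one whose associated gms decomposition is identical to $(B_0,\Lambda_0)$. -/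

import Mathlib

open MeasureTheory
open scoped ENNReal

noncomputable section

namespace GMS

/-! ### Von Neumann algebras generated by sets of operators, group measure space decompositions -/

section VonNeumann

variable {H : Type*} [NormedAddCommGroup H] [InnerProductSpace ℂ H] [CompleteSpace H]

/-- The von Neumann algebra generated by a set `S` of bounded operators: the bicommutant of
`S ∪ S*`. (`StarSubalgebra.centralizer ℂ S` is the commutant of `S ∪ S*`.) -/
def generatedBy (S : Set (H →L[ℂ] H)) : VonNeumannAlgebra H where
  toStarSubalgebra :=
    StarSubalgebra.centralizer ℂ (StarSubalgebra.centralizer ℂ S : Set (H →L[ℂ] H))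
  centralizer_centralizer' := by
    change Set.centralizer (Set.centralizer (Set.centralizer _)) = Set.centralizer _
    rw [Set.centralizer_centralizer_centralizer]

/-- The join `M ∨ N` of two von Neumann algebras. -/
def join (M N : VonNeumannAlgebra H) : VonNeumannAlgebra H :=
  generatedBy ((M : Set (H →L[ℂ] H)) ∪ N)

/-- `y` is the image of `x` under the conditional expectation onto `B` that preserves the
trace `τ`: the element of `B` determined by `τ(b y) = τ(b x)` for all `b ∈ B`. -/
def IsCondExp (τ : (H →L[ℂ] H) → ℂ) (B : VonNeumannAlgebra H) (x y : H →L[ℂ] H) : Prop :=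
  y ∈ B ∧ ∀ b ∈ B, τ (b * y) = τ (b * x)

/-- `(B, Λ)` is a group measure space decomposition of the tracial von Neumann algebra `(M, τ)`:
`B ⊆ M` is a maximal abelian von Neumann subalgebra, `Λ` is a group of unitaries of `M`
normalizing `B`, `M` is generated by `B` and `Λ`, and `E_B(v) = 0` for `1 ≠ v ∈ Λ`. -/
structure IsGMSDecomposition (M : VonNeumannAlgebra H) (τ : (H →L[ℂ] H) → ℂ)
    (B : VonNeumannAlgebra H) (Λ : Subgroup (unitary (H →L[ℂ] H))) : Prop where
  le : B ≤ M
  abelian : ∀ x ∈ B, ∀ y ∈ B, x * y = y * x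
  maximal : ∀ x ∈ M, (∀ b ∈ B, b * x = x * b) → x ∈ B
  mem : ∀ v ∈ Λ, (v : H →L[ℂ] H) ∈ M
  normalizes : ∀ v ∈ Λ, ∀ b ∈ B, (v : H →L[ℂ] H) * b * star (v : H →L[ℂ] H) ∈ B
  generates : generatedBy ((B : Set (H →L[ℂ] H)) ∪ Subtype.val '' (Λ : Set (unitary (H →L[ℂ] H))))
    = M
  condExp_eq_zero : ∀ v ∈ Λ, v ≠ 1 → IsCondExp τ B (v : H →L[ℂ] H) 0

/-- The set `𝕋 Λ` of all multiples of elements of `Λ` by complex numbers of modulus one. -/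
def circleMultiples (Λ : Subgroup (unitary (H →L[ℂ] H))) : Set (H →L[ℂ] H) :=
  {x | ∃ c : Circle, ∃ v ∈ Λ, x = (c : ℂ) • (v : H →L[ℂ] H)}

/-- Two group measure space decompositions are identical if `B = B'` and `𝕋 Λ = 𝕋 Λ'`. -/
def Identical (B : VonNeumannAlgebra H) (Λ : Subgroup (unitary (H →L[ℂ] H)))
    (B' : VonNeumannAlgebra H) (Λ' : Subgroup (unitary (H →L[ℂ] H))) : Prop :=
  B = B' ∧ circleMultiples Λ = circleMultiples Λ'

/-- The pair `(B, Λ)` is globally invariant under all automorphisms in the family `β`. -/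
def IsInvariantPair {ι : Type*} (β : ι → (H →L[ℂ] H) ≃⋆ₐ[ℂ] (H →L[ℂ] H))
    (B : VonNeumannAlgebra H) (Λ : Subgroup (unitary (H →L[ℂ] H))) : Prop :=
  ∀ a, β a '' (B : Set (H →L[ℂ] H)) = B ∧
    β a '' (Subtype.val '' (Λ : Set (unitary (H →L[ℂ] H)))) =
      Subtype.val '' (Λ : Set (unitary (H →L[ℂ] H)))

end VonNeumann

/-! ### Multiplication operators and unitaries of measure preserving transformations on `L²` -/

section LTwo

variable {X : Type*} [MeasurableSpace X] {μ : Measure X}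

/-- Multiplication by an essentially bounded function `f`, as an operator on `L²(X, μ)`. -/
def mulOp (f : X → ℂ) (hf : MemLp f ∞ μ) : Lp ℂ 2 μ →L[ℂ] Lp ℂ 2 μ :=
  (ContinuousLinearMap.mul ℂ ℂ).holderL μ ∞ 2 2 (hf.toLp f)

theorem coeFn_mulOp (f : X → ℂ) (hf : MemLp f ∞ μ) (ξ : Lp ℂ 2 μ) :
    mulOp f hf ξ =ᵐ[μ] fun x => f x * ξ x := by
  have h := (ContinuousLinearMap.mul ℂ ℂ).coeFn_holder (r := 2) (hf.toLp f) ξ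
  filter_upwards [h, hf.coeFn_toLp] with x h1 h2
  change ((ContinuousLinearMap.mul ℂ ℂ).holder 2 (hf.toLp f) ξ : X → ℂ) x = _
  rw [h1, h2]
  rfl

theorem memLp_circle {w : X → Circle} (hw : Measurable fun x => (w x : ℂ)) :
    MemLp (fun x => (w x : ℂ)) ∞ μ :=
  memLp_top_of_bound hw.aestronglyMeasurable 1 (Filter.Eventually.of_forall fun x => by
    rw [Circle.norm_coe])

theorem measurable_circle_inv {w : X → Circle} (hw : Measurable fun x => (w x : ℂ)) :
    Measurable fun x => (((w x)⁻¹ : Circle) : ℂ) := by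
  simp only [Circle.coe_inv]
  exact hw.inv

theorem mulOp_mulOp_circle {w w' : X → Circle} (hw : Measurable fun x => (w x : ℂ))
    (hw' : Measurable fun x => (w' x : ℂ)) (h : ∀ x, w x * w' x = 1) (ξ : Lp ℂ 2 μ) :
    mulOp _ (memLp_circle hw) (mulOp _ (memLp_circle hw') ξ) = ξ := by
  refine Lp.ext ?_
  filter_upwards [coeFn_mulOp _ (memLp_circle (μ := μ) hw') ξ,
    coeFn_mulOp _ (memLp_circle (μ := μ) hw) (mulOp _ (memLp_circle hw') ξ)] with x h1 h2
  rw [h2, h1, ← mul_assoc, ← Circle.coe_mul, h x, Circle.coe_one, one_mul]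

/-- Multiplication by a measurable circle valued function, as a unitary operator on `L²(X, μ)`. -/
def circleMul (w : X → Circle) (hw : Measurable fun x => (w x : ℂ)) :
    unitary (Lp ℂ 2 μ →L[ℂ] Lp ℂ 2 μ) :=
  Unitary.linearIsometryEquiv.symm
    { toLinearEquiv := LinearEquiv.ofLinearMap
        (mulOp _ (memLp_circle (μ := μ) hw)).toLinearMap
        (mulOp _ (memLp_circle (μ := μ) (measurable_circle_inv hw))).toLinearMap
        (by
          ext1 ξ
          exact mulOp_mulOp_circle hw (measurable_circle_inv hw) (fun x => mul_inv_cancel _) ξ)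
        (by
          ext1 ξ
          exact mulOp_mulOp_circle (measurable_circle_inv hw) hw (fun x => inv_mul_cancel _) ξ)
      norm_map' := fun ξ => by
        change ‖mulOp _ (memLp_circle (μ := μ) hw) ξ‖ = ‖ξ‖
        have h : ∀ᵐ x ∂μ, ‖mulOp _ (memLp_circle (μ := μ) hw) ξ x‖ = ‖ξ x‖ := by
          filter_upwards [coeFn_mulOp _ (memLp_circle (μ := μ) hw) ξ] with x hx
          rw [hx, norm_mul, Circle.norm_coe, one_mul]
        exact le_antisymm (Lp.norm_le_norm_of_ae_le (h.mono fun x hx => hx.le))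
          (Lp.norm_le_norm_of_ae_le (h.mono fun x hx => hx.ge)) }

theorem coe_circleMul_apply (w : X → Circle) (hw : Measurable fun x => (w x : ℂ))
    (ξ : Lp ℂ 2 μ) :
    (circleMul (μ := μ) w hw).1 ξ = mulOp _ (memLp_circle hw) ξ := rfl

/-- The unitary operator `ξ ↦ ξ ∘ e⁻¹` on `L²(X, μ)` given by an invertible measure preserving
transformation `e`. -/
def koopman (e : X ≃ᵐ X) (he : MeasurePreserving e μ μ) :
    unitary (Lp ℂ 2 μ →L[ℂ] Lp ℂ 2 μ) :=
  Unitary.linearIsometryEquiv.symm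
    { toLinearEquiv := LinearEquiv.ofLinearMap
        (Lp.compMeasurePreservingₗ ℂ e.symm (he.symm e))
        (Lp.compMeasurePreservingₗ ℂ e he)
        (by
          ext1 ξ
          change Lp.compMeasurePreserving e.symm (he.symm e) (Lp.compMeasurePreserving e he ξ) = ξ
          rw [← Lp.compMeasurePreserving_comp_apply]
          simp)
        (by
          ext1 ξ
          change Lp.compMeasurePreserving e he (Lp.compMeasurePreserving e.symm (he.symm e) ξ) = ξ
          rw [← Lp.compMeasurePreserving_comp_apply]
          simp)
      norm_map' := fun ξ => Lp.norm_compMeasurePreserving ξ (he.symm e) }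

theorem coe_koopman_apply (e : X ≃ᵐ X) (he : MeasurePreserving e μ μ) (ξ : Lp ℂ 2 μ) :
    (koopman e he).1 ξ =
      Lp.compMeasurePreserving e.symm (he.symm e) ξ := rfl

end LTwo

/-! ### The crossed product `L^∞(K) ⋊ G` for a homomorphism `ι : G → K` into a compact group,
acting by translation -/

section CrossedProduct

variable {K G : Type*} [CommGroup K] [TopologicalSpace K] [IsTopologicalGroup K] [CompactSpace K]
  [MeasurableSpace K] [BorelSpace K]
  [CommGroup G] [Countable G] [MeasurableSpace G] [DiscreteMeasurableSpace G]

variable (K) in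
/-- The Haar probability measure of a compact group. -/
def haarProb : Measure K := Measure.haarMeasure (⊤ : TopologicalSpace.PositiveCompacts K)

instance : (haarProb K).IsHaarMeasure := by unfold haarProb; infer_instance

instance : IsProbabilityMeasure (haarProb K) :=
  ⟨Measure.haarMeasure_self (K₀ := (⊤ : TopologicalSpace.PositiveCompacts K))⟩

variable (K G) in
/-- The product of the Haar probability measure of `K` and the counting measure of `G`. -/
def prodMeasure : Measure (K × G) := (haarProb K).prod Measure.count

variable (K G) in
/-- The Hilbert space `L²(K × G) = L²(K) ⊗ ℓ²(G)` on which `L^∞(K) ⋊ G` is represented. -/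
abbrev L2 : Type _ := Lp ℂ 2 (prodMeasure K G)

theorem memLp_fst {f : K → ℂ} (hf : MemLp f ∞ (haarProb K)) :
    MemLp (fun p : K × G => f p.1) ∞ (prodMeasure K G) := by
  have hq : Measure.QuasiMeasurePreserving (Prod.fst : K × G → K) (prodMeasure K G)
    (haarProb K) := Measure.quasiMeasurePreserving_fst
  refine memLp_top_of_bound (hf.1.comp_quasiMeasurePreserving hq)
    (eLpNorm f ∞ (haarProb K)).toReal
    (hq.ae (p := fun x => ‖f x‖ ≤ (eLpNorm f ∞ (haarProb K)).toReal) ?_)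
  have h := ae_le_eLpNormEssSup (f := f) (μ := haarProb K)
  filter_upwards [h] with x hx
  rw [← toReal_enorm]
  exact ENNReal.toReal_mono hf.2.ne (by simpa using hx)

/-- Translation `(x, s) ↦ (ι(g) x, g s)` on `K × G`. -/
def translation (ι : G →* K) (g : G) : K × G ≃ᵐ K × G :=
  (MeasurableEquiv.mulLeft (ι g)).prodCongr (MeasurableEquiv.mulLeft g)

theorem measurePreserving_translation (ι : G →* K) (g : G) :
    MeasurePreserving (translation ι g) (prodMeasure K G) (prodMeasure K G) :=
  (measurePreserving_mul_left (haarProb K) (ι g)).prod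
    (measurePreserving_mul_left (Measure.count : Measure G) g)

/-- The canonical unitaries `u_g`, `g ∈ G`, of the crossed product: `u_g` is the tensor product
of the translations by `ι(g)` on `L²(K)` and by `g` on `ℓ²(G)`. -/
def groupUnitary (ι : G →* K) : G →* unitary (L2 K G →L[ℂ] L2 K G) :=
  MonoidHom.mk' (fun g => koopman (translation ι g) (measurePreserving_translation ι g)) (by
    intro g h
    apply Subtype.ext
    ext1 ξ
    change Lp.compMeasurePreserving _ _ ξ =
      Lp.compMeasurePreserving _ _ (Lp.compMeasurePreserving _ _ ξ)
    rw [← Lp.compMeasurePreserving_comp_apply]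
    congr 2
    funext p
    apply (translation ι (g * h)).injective
    have key : ∀ q, translation ι (g * h) q = translation ι g (translation ι h q) := fun q => by
      refine Prod.ext ?_ ?_
      · change ι (g * h) * q.1 = ι g * (ι h * q.1)
        rw [map_mul, mul_assoc]
      · change g * h * q.2 = g * (h * q.2)
        rw [mul_assoc]
    rw [MeasurableEquiv.apply_symm_apply, Function.comp_apply, key,
      MeasurableEquiv.apply_symm_apply, MeasurableEquiv.apply_symm_apply])

variable (K G) in
/-- `L^∞(K)`, acting on `L²(K × G)` by multiplication operators. -/
def linftyOps : Set (L2 K G →L[ℂ] L2 K G) :=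
  {T | ∃ (f : K → ℂ) (hf : MemLp f ∞ (haarProb K)),
    T = mulOp (fun p : K × G => f p.1) (memLp_fst hf)}

/-- The crossed product von Neumann algebra `L^∞(K) ⋊ G`, generated by `L^∞(K)` and the canonical
unitaries `u_g`, `g ∈ G`. -/
def crossedProduct (ι : G →* K) : VonNeumannAlgebra (L2 K G) :=
  generatedBy (linftyOps K G ∪ Set.range fun g => (groupUnitary ι g : L2 K G →L[ℂ] L2 K G))

theorem prodMeasure_base_ne_top :
    prodMeasure K G (Set.univ ×ˢ {1}) ≠ ∞ := by
  simp [prodMeasure]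

variable (K G) in
/-- The unit vector `1 ⊗ δ_e` of `L²(K × G)`. -/
def baseVector : L2 K G :=
  indicatorConstLp 2 (MeasurableSet.univ.prod (measurableSet_singleton (1 : G)))
    prodMeasure_base_ne_top 1

variable (K G) in
/-- The canonical trace on `L^∞(K) ⋊ G`: it maps `∑ f_g u_g` to `∫ f_e`, and is implemented by
the vector `1 ⊗ δ_e`. -/
def trace (T : L2 K G →L[ℂ] L2 K G) : ℂ :=
  inner ℂ (baseVector K G) (T (baseVector K G))

end CrossedProduct

/-! ### The case `G = L₁³`, `K` the Pontryagin dual of `L₂³`, and the action of `SL(3, ℤ)` -/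

instance {A : Type*} [Monoid A] [TopologicalSpace A] : MeasurableSpace (PontryaginDual A) :=
  borel _

instance {A : Type*} [Monoid A] [TopologicalSpace A] : BorelSpace (PontryaginDual A) := ⟨rfl⟩

/-- Evaluation of a character at a point. -/
def evalAt {A : Type*} [Monoid A] [TopologicalSpace A] (h : A) : PontryaginDual A →* Circle where
  toFun x := x h
  map_one' := rfl
  map_mul' _ _ := rfl

theorem measurable_eval {A : Type*} [Monoid A] [TopologicalSpace A] (h : A) :
    Measurable fun x : PontryaginDual A => ((x h : Circle) : ℂ) := by
  have h1 : Continuous fun x : PontryaginDual A => x h :=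
    (continuous_eval_const (F := C(A, Circle)) h).comp
      (ContinuousMonoidHom.isInducing_toContinuousMap A Circle).continuous
  exact (continuous_subtype_val.comp h1).measurable

section Cube

/-- The action of integer `3 × 3` matrices on `L³` for a (multiplicative) abelian group `L`:
`(a · x)_i = ∏_j x_j ^ a_{ij}`. -/
def matAct {L : Type*} [CommGroup L] (a : Matrix (Fin 3) (Fin 3) ℤ) :
    (Fin 3 → L) →* (Fin 3 → L) where
  toFun x := fun i => ∏ j, x j ^ a i j
  map_one' := by ext i; simp
  map_mul' x y := by ext i; simp [mul_zpow, Finset.prod_mul_distrib]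

theorem matAct_mul {L : Type*} [CommGroup L] (a b : Matrix (Fin 3) (Fin 3) ℤ) (x : Fin 3 → L) :
    matAct (a * b) x = matAct a (matAct b x) := by
  ext i
  simp only [matAct, MonoidHom.coe_mk, OneHom.coe_mk, Matrix.mul_apply]
  simp only [← Finset.prod_zpow, ← zpow_mul]
  rw [Finset.prod_comm]
  refine Finset.prod_congr rfl fun j _ => ?_
  simp only [mul_comm (b _ _)]
  induction (Finset.univ : Finset (Fin 3)) using Finset.induction_on with
  | empty => simp
  | insert k t hk ih => rw [Finset.sum_insert hk, Finset.prod_insert hk, zpow_add, ih]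

theorem matAct_one {L : Type*} [CommGroup L] (x : Fin 3 → L) : matAct 1 x = x := by
  ext i
  simp [matAct, Matrix.one_apply, Finset.prod_ite_eq]

/-- The subgroup `P³` of `L³`. -/
def cube {L : Type*} [CommGroup L] (P : Subgroup L) : Subgroup (Fin 3 → L) :=
  Subgroup.pi Set.univ fun _ => P

variable {L₁ L₂ : Type*} [CommGroup L₁] [CommGroup L₂] [TopologicalSpace L₂]
  [DiscreteTopology L₂]

/-- The orthogonal complement in `L₂` of a subgroup of `L₁` with respect to the bicharacter
`Ω(g, h) = ι(g)(h)`. -/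
def perpRight (ι : L₁ →* PontryaginDual L₂) (P : Subgroup L₁) : Subgroup L₂ where
  carrier := {h | ∀ g ∈ P, ι g h = 1}
  one_mem' g _ := map_one (ι g)
  mul_mem' {x y} hx hy g hg := by rw [map_mul, hx g hg, hy g hg, one_mul]
  inv_mem' {x} hx g hg := by rw [map_inv, hx g hg, inv_one]

/-- The orthogonal complement in `L₁` of a subgroup of `L₂` with respect to `Ω`. -/
def perpLeft (ι : L₁ →* PontryaginDual L₂) (P : Subgroup L₂) : Subgroup L₁ where
  carrier := {g | ∀ h ∈ P, ι g h = 1}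
  one_mem' h _ := map_one ((evalAt h).comp ι)
  mul_mem' {x y} hx hy h hh := by
    refine (map_mul ((evalAt h).comp ι) x y).trans ?_
    change ι x h * ι y h = 1
    rw [hx h hh, hy h hh, one_mul]
  inv_mem' {x} hx h hh := by
    refine (map_inv ((evalAt h).comp ι) x).trans ?_
    change (ι x h)⁻¹ = 1
    rw [hx h hh, inv_one]

/-- A direct sum decomposition `L₁ = P ⊕ Q` is admissible if the closures of `P` and `Q` in the
compact group `L₂^` give a direct sum decomposition of `L₂^`. -/
def Admissible (ι : L₁ →* PontryaginDual L₂) (P Q : Subgroup L₁) : Prop :=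
  IsCompl P Q ∧ IsCompl (P.map ι).topologicalClosure (Q.map ι).topologicalClosure

/-- The direct sum `L₁³ → (L₂³)^` of three copies of `ι : L₁ → L₂^`:
`(g₁, g₂, g₃) ↦ ((h₁, h₂, h₃) ↦ ι(g₁)(h₁) ι(g₂)(h₂) ι(g₃)(h₃))`. -/
def cubeHom (ι : L₁ →* PontryaginDual L₂) : (Fin 3 → L₁) →* PontryaginDual (Fin 3 → L₂) where
  toFun g :=
    { toFun := fun h => ∏ i, ι (g i) (h i)
      map_one' := by simp
      map_mul' := fun x y => by simp [Finset.prod_mul_distrib]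
      continuous_toFun := continuous_of_discreteTopology }
  map_one' := by
    refine PontryaginDual.ext fun h => ?_
    change ∏ i, ((evalAt (h i)).comp ι) 1 = 1
    simp
  map_mul' x y := by
    refine PontryaginDual.ext fun h => ?_
    change ∏ i, ((evalAt (h i)).comp ι) (x i * y i) =
      (∏ i, ((evalAt (h i)).comp ι) (x i)) * ∏ i, ((evalAt (h i)).comp ι) (y i)
    simp [Finset.prod_mul_distrib]

/-- The action of `a ∈ SL(3, ℤ)` on `(L₂³)^ = (L₂^)³`: matrix multiplication by `a`, that is,
`(a · x)(h) = x(aᵀ h)`. -/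
def dualAct (a : Matrix (Fin 3) (Fin 3) ℤ) :
    PontryaginDual (Fin 3 → L₂) →ₜ* PontryaginDual (Fin 3 → L₂) :=
  PontryaginDual.map
    { toMonoidHom := matAct a.transpose, continuous_toFun := continuous_of_discreteTopology }

theorem dualAct_apply (a : Matrix (Fin 3) (Fin 3) ℤ) (x : PontryaginDual (Fin 3 → L₂))
    (h : Fin 3 → L₂) : dualAct a x h = x (matAct a.transpose h) := rfl

/-- The natural action of `SL(3, ℤ)` is compatible with the direct sum embedding. -/
theorem cubeHom_matAct (ι : L₁ →* PontryaginDual L₂) (a : Matrix (Fin 3) (Fin 3) ℤ)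
    (g : Fin 3 → L₁) : cubeHom ι (matAct a g) = dualAct a (cubeHom ι g) := by
  refine PontryaginDual.ext fun h => ?_
  change ∏ i, ((evalAt (h i)).comp ι) (∏ j, g j ^ a i j) = ∏ j, ι (g j) (∏ i, h i ^ a i j)
  simp only [map_prod, map_zpow]
  exact Finset.prod_comm

theorem dualAct_mul (a b : Matrix (Fin 3) (Fin 3) ℤ) (x : PontryaginDual (Fin 3 → L₂)) :
    dualAct (a * b) x = dualAct a (dualAct b x) := by
  refine PontryaginDual.ext fun h => ?_
  simp only [dualAct_apply, Matrix.transpose_mul, matAct_mul]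

theorem dualAct_one (x : PontryaginDual (Fin 3 → L₂)) : dualAct 1 x = x := by
  refine PontryaginDual.ext fun h => ?_
  simp only [dualAct_apply, Matrix.transpose_one, matAct_one]

variable [Countable L₁] [MeasurableSpace L₁] [DiscreteMeasurableSpace L₁]

/-- The diagonal action `(x, s) ↦ (a · x, a · s)` of `SL(3, ℤ)` on `(L₂³)^ × L₁³`. -/
def slAct (a : Matrix.SpecialLinearGroup (Fin 3) ℤ) :
    PontryaginDual (Fin 3 → L₂) × (Fin 3 → L₁) ≃ᵐ PontryaginDual (Fin 3 → L₂) × (Fin 3 → L₁) where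
  toFun p := (dualAct a.1 p.1, matAct a.1 p.2)
  invFun p := (dualAct a⁻¹.1 p.1, matAct a⁻¹.1 p.2)
  left_inv p := by
    simp only [← dualAct_mul, ← matAct_mul]
    simp only [← Matrix.SpecialLinearGroup.coe_mul, inv_mul_cancel,
      Matrix.SpecialLinearGroup.coe_one, dualAct_one, matAct_one]
  right_inv p := by
    simp only [← dualAct_mul, ← matAct_mul]
    simp only [← Matrix.SpecialLinearGroup.coe_mul, mul_inv_cancel,
      Matrix.SpecialLinearGroup.coe_one, dualAct_one, matAct_one]
  measurable_toFun :=
    ((dualAct a.1).continuous_toFun.measurable.comp measurable_fst).prodMk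
      ((Measurable.of_discrete (f := matAct a.1)).comp measurable_snd)
  measurable_invFun :=
    ((dualAct a⁻¹.1).continuous_toFun.measurable.comp measurable_fst).prodMk
      ((Measurable.of_discrete (f := matAct a⁻¹.1)).comp measurable_snd)

theorem measurePreserving_slAct (a : Matrix.SpecialLinearGroup (Fin 3) ℤ) :
    MeasurePreserving (slAct (L₁ := L₁) (L₂ := L₂) a)
      (prodMeasure (PontryaginDual (Fin 3 → L₂)) (Fin 3 → L₁))
      (prodMeasure (PontryaginDual (Fin 3 → L₂)) (Fin 3 → L₁)) := by
  have h1 : MeasurePreserving (dualAct (L₂ := L₂) a.1) (haarProb _) (haarProb _) :=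
    MonoidHom.measurePreserving (f := (dualAct (L₂ := L₂) a.1).toMonoidHom)
      (dualAct a.1).continuous_toFun
      (fun x => ⟨dualAct a⁻¹.1 x, by
        change dualAct a.1 (dualAct a⁻¹.1 x) = x
        rw [← dualAct_mul, ← Matrix.SpecialLinearGroup.coe_mul, mul_inv_cancel,
          Matrix.SpecialLinearGroup.coe_one, dualAct_one]⟩)
      rfl
  have h2 : MeasurePreserving (matAct (L := L₁) a.1) Measure.count Measure.count := by
    let e : (Fin 3 → L₁) ≃ (Fin 3 → L₁) :=
      { toFun := matAct a.1
        invFun := matAct a⁻¹.1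
        left_inv := fun x => by
          rw [← matAct_mul, ← Matrix.SpecialLinearGroup.coe_mul, inv_mul_cancel,
            Matrix.SpecialLinearGroup.coe_one, matAct_one]
        right_inv := fun x => by
          rw [← matAct_mul, ← Matrix.SpecialLinearGroup.coe_mul, mul_inv_cancel,
            Matrix.SpecialLinearGroup.coe_one, matAct_one] }
    refine ⟨Measurable.of_discrete, Measure.ext fun s hs => ?_⟩
    rw [Measure.map_apply Measurable.of_discrete hs,
      Measure.count_apply (MeasurableSet.of_discrete), Measure.count_apply hs]
    congr 1
    exact Set.encard_preimage_of_bijective e.bijective s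
  exact h1.prod h2

/-- The unitary operator on `L²((L₂³)^ × L₁³)` given by the diagonal action of `a ∈ SL(3, ℤ)`. -/
def slUnitary (a : Matrix.SpecialLinearGroup (Fin 3) ℤ) :
    unitary (L2 (PontryaginDual (Fin 3 → L₂)) (Fin 3 → L₁) →L[ℂ]
      L2 (PontryaginDual (Fin 3 → L₂)) (Fin 3 → L₁)) :=
  koopman (slAct a) (measurePreserving_slAct a)

variable (L₁ L₂) in
/-- The automorphisms `β_a`, `a ∈ SL(3, ℤ)`, given on `L^∞((L₂³)^) ⋊ L₁³` by
`β_a(f) = f(a⁻¹ · )` for `f ∈ L^∞((L₂³)^)` and `β_a(u_g) = u_{a · g}` for `g ∈ L₁³`,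
written as conjugation by the unitary `slUnitary a`. -/
def beta (a : Matrix.SpecialLinearGroup (Fin 3) ℤ) :
    (L2 (PontryaginDual (Fin 3 → L₂)) (Fin 3 → L₁) →L[ℂ]
      L2 (PontryaginDual (Fin 3 → L₂)) (Fin 3 → L₁)) ≃⋆ₐ[ℂ]
    (L2 (PontryaginDual (Fin 3 → L₂)) (Fin 3 → L₁) →L[ℂ]
      L2 (PontryaginDual (Fin 3 → L₂)) (Fin 3 → L₁)) :=
  Unitary.conjStarAlgAut ℂ _ (slUnitary a)

variable (L₁) in
/-- The canonical unitaries `u_h ∈ L^∞((L₂³)^)`, `h ∈ L₂³`: multiplication by the character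
`x ↦ x(h)⁻¹`. With this convention `u_g u_h = Ω(g, h) u_h u_g` for `g ∈ L₁³`, `h ∈ L₂³`. -/
def charUnitary : (Fin 3 → L₂) →*
    unitary (L2 (PontryaginDual (Fin 3 → L₂)) (Fin 3 → L₁) →L[ℂ]
      L2 (PontryaginDual (Fin 3 → L₂)) (Fin 3 → L₁)) :=
  MonoidHom.mk'
    (fun h => circleMul (fun p => (p.1 h)⁻¹)
      (measurable_circle_inv ((measurable_eval h).comp measurable_fst)))
    (by
      intro g h
      apply Subtype.ext
      ext1 ξ
      change mulOp _ _ ξ = mulOp _ _ (mulOp _ _ ξ)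
      refine Lp.ext ?_
      refine (coeFn_mulOp _ _ ξ).trans ?_
      refine Filter.EventuallyEq.symm ((coeFn_mulOp _ _ _).trans ?_)
      refine (coeFn_mulOp _ (memLp_circle (measurable_circle_inv
        ((measurable_eval h).comp measurable_fst))) ξ).mono fun p hp => ?_
      simp only [hp]
      rw [← mul_assoc, ← Circle.coe_mul, map_mul, mul_inv])

/-- The crossed product `A₀ = L^∞((L₂³)^) ⋊ L₁³`. -/
def algA (ι : L₁ →* PontryaginDual L₂) :
    VonNeumannAlgebra (L2 (PontryaginDual (Fin 3 → L₂)) (Fin 3 → L₁)) :=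
  crossedProduct (cubeHom ι)

variable (L₁ L₂) in
/-- The canonical trace of `L^∞((L₂³)^) ⋊ L₁³`. -/
def traceA : (L2 (PontryaginDual (Fin 3 → L₂)) (Fin 3 → L₁) →L[ℂ]
    L2 (PontryaginDual (Fin 3 → L₂)) (Fin 3 → L₁)) → ℂ :=
  trace (PontryaginDual (Fin 3 → L₂)) (Fin 3 → L₁)

/-- The von Neumann algebra `L(S)` generated by the unitaries `u_s`, `s ∈ S`, where `S` is a
subgroup of a group `H` and `u` is a homomorphism from `H` to a unitary group. -/
def groupAlg {H E : Type*} [Group H] [NormedAddCommGroup E] [InnerProductSpace ℂ E]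
    [CompleteSpace E] (u : H →* unitary (E →L[ℂ] E)) (S : Subgroup H) : VonNeumannAlgebra E :=
  generatedBy ((fun s => (u s : E →L[ℂ] E)) '' S)

/-- `L(P₁³) ∨ L(P₂³)` for subgroups `P₁` of `L₁` and `P₂` of `L₂`. -/
def stdB (ι : L₁ →* PontryaginDual L₂) (P₁ : Subgroup L₁) (P₂ : Subgroup L₂) :
    VonNeumannAlgebra (L2 (PontryaginDual (Fin 3 → L₂)) (Fin 3 → L₁)) :=
  join (groupAlg (groupUnitary (cubeHom ι)) (cube P₁)) (groupAlg (charUnitary L₁) (cube P₂))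

/-- `Q₁³ Q₂³` for subgroups `Q₁` of `L₁` and `Q₂` of `L₂`: the group generated by the commuting
groups of unitaries `u_g`, `g ∈ Q₁³`, and `u_h`, `h ∈ Q₂³`. (They commute if `Q₂ ⊆ Q₁^⊥`.) -/
def stdLambda (ι : L₁ →* PontryaginDual L₂) (Q₁ : Subgroup L₁) (Q₂ : Subgroup L₂) :
    Subgroup (unitary (L2 (PontryaginDual (Fin 3 → L₂)) (Fin 3 → L₁) →L[ℂ]
      L2 (PontryaginDual (Fin 3 → L₂)) (Fin 3 → L₁))) :=
  (cube Q₁).map (groupUnitary (cubeHom ι)) ⊔ (cube Q₂).map (charUnitary L₁)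

end Cube

end GMS

end

/-!
# Invariant group measure space decompositions

The proof works with the von Neumann algebra `A₀` as a twisted group von Neumann algebra of the
abelian group `L₁³ × L₂³`, with canonical unitaries `u_h u_g`, in its standard representation on
`L²((L₂³)^ × L₁³)`. The vectors `u_h u_g vac`, where `vac` is the trace vector, form an orthonormal
basis (`GMS.system`), so that elements of `A₀` have Fourier coefficients.

*From admissible decompositions to invariant ones.* If `L₁ = P₁ ⊕ Q₁` is admissible, then `(L₂)^`
is the direct sum of two compact subgroups. Composing the evaluation at `h ∈ L₂` with the
projection on one summand gives a continuous character of `(L₂)^`, which by Pontryagin duality is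
an evaluation, and this decomposes `h` (`Admissible.isCompl_perpRight`). The group `P₁³ × P₂³` is
then its own commutant for the commutation bicharacter, so that the canonical unitaries that it
indexes generate a maximal abelian subalgebra. Those indexed by the complement `Q₁³ × Q₂³`
complete it to a group measure space decomposition (`isGMS_alg`, `isGMS_std`).

*From invariant decompositions to admissible ones.* In a group measure space decomposition
`(B, Λ)`, the subspaces `v B vac`, `v ∈ Λ`, are pairwise orthogonal and span the Hilbert space
(`IsGMS.inner_eq_zero`, `IsGMS.mem_hull`). An elementary matrix acts on `L₁³ × L₂³` so that every
index is fixed or, the groups being torsion free, has an infinite orbit. A weak limit of powers of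
the action is then the expectation on the fixed points; it preserves `B`, and an element of `Λ` with
a nonzero component in the fixed point algebra is fixed. Using four elementary matrices, whose
common fixed points are one copy of `L₁`, one finds that `(B, Λ)` restricts to a decomposition of
the group von Neumann algebra of that copy (`IsFixedSubgroup.basis_mem_hull`).

The elementary matrix that sends `u_g` in the first coordinate to `u_g` in the first coordinate times
`u_g` in the second one acts on the first copy as the comultiplication. An element of `Λ` in the
first copy is mapped to an element of `Λ` that must be a product of elements in the two copies, and
comparing Fourier coefficients shows that it is a canonical unitary
(`Corner.exists_eq_U`). Similarly, all canonical unitaries in the expansion of an element of `B`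
belong to `B` (`Corner.U_mem_of_inner_ne_zero`). Hence every `g ∈ L₁` factors as `g = p q` with
`u_p ∈ B` and `u_q ∈ Λ` (`Corner.exists_decomposition`). The same holds for `L₂`. Since `B` is
abelian and since scalars in `Λ` are trivial, the resulting decompositions of `L₁` and `L₂` are
orthogonal to each other, hence admissible; `(B, Λ)` contains the associated decomposition and
coincides with it by maximality (`exists_admissible`).
-/

noncomputable section

namespace GMS

/-! ### Generated von Neumann algebras -/

section Generated

variable {H : Type*} [NormedAddCommGroup H] [InnerProductSpace ℂ H] [CompleteSpace H]

theorem mem_generatedBy {X : Set (H →L[ℂ] H)} {x : H →L[ℂ] H} :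
    x ∈ generatedBy X ↔
      ∀ T : H →L[ℂ] H, (∀ y ∈ X, y * T = T * y ∧ star y * T = T * star y) → T * x = x * T := by
  change x ∈ StarSubalgebra.centralizer ℂ (StarSubalgebra.centralizer ℂ X : Set (H →L[ℂ] H)) ↔ _
  rw [StarSubalgebra.mem_centralizer_iff]
  refine ⟨fun h T hT => (h T ((StarSubalgebra.mem_centralizer_iff ℂ).2 hT)).1, fun h T hT => ?_⟩
  exact ⟨h T ((StarSubalgebra.mem_centralizer_iff ℂ).1 hT),
    h (star T) ((StarSubalgebra.mem_centralizer_iff ℂ).1 (star_mem hT))⟩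

theorem subset_generatedBy (X : Set (H →L[ℂ] H)) : X ⊆ generatedBy X := fun _ hx =>
  mem_generatedBy.2 fun _ hT => (hT _ hx).1.symm

theorem mem_of_commutes_commutant {N : VonNeumannAlgebra H} {x : H →L[ℂ] H}
    (h : ∀ T : H →L[ℂ] H, (∀ y ∈ N, y * T = T * y) → T * x = x * T) : x ∈ N := by
  have h2 := N.centralizer_centralizer
  change x ∈ (N : Set (H →L[ℂ] H))
  rw [← h2, Set.mem_centralizer_iff]
  exact fun T hT => h T (Set.mem_centralizer_iff.1 hT)

theorem generatedBy_le {X : Set (H →L[ℂ] H)} {N : VonNeumannAlgebra H} (h : X ⊆ N) :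
    generatedBy X ≤ N := fun _ hx => mem_of_commutes_commutant fun T hT =>
  mem_generatedBy.1 hx T fun y hy => ⟨hT y (h hy), hT _ (star_mem (h hy))⟩

theorem generatedBy_mono {X Y : Set (H →L[ℂ] H)} (h : X ⊆ Y) : generatedBy X ≤ generatedBy Y :=
  generatedBy_le (h.trans (subset_generatedBy Y))

theorem join_generatedBy (X Y : Set (H →L[ℂ] H)) :
    join (generatedBy X) (generatedBy Y) = generatedBy (X ∪ Y) := by
  refine le_antisymm (generatedBy_le (Set.union_subset ?_ ?_)) (generatedBy_le ?_)
  · exact generatedBy_mono Set.subset_union_left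
  · exact generatedBy_mono Set.subset_union_right
  · exact (Set.union_subset_union (subset_generatedBy X) (subset_generatedBy Y)).trans
      (subset_generatedBy _)

theorem commute_star_of_unitary {u T : H →L[ℂ] H} (hu : u ∈ unitary (H →L[ℂ] H))
    (h : u * T = T * u) : star u * T = T * star u := by
  have h1 := (Unitary.mem_iff.1 hu).1
  have h2 := (Unitary.mem_iff.1 hu).2
  calc star u * T = star u * (T * u) * star u := by rw [mul_assoc, mul_assoc, h2, mul_one]
    _ = T * star u := by rw [← h, ← mul_assoc, h1, one_mul]

theorem mem_generatedBy_of_unitary {X : Set (H →L[ℂ] H)} (hX : X ⊆ unitary (H →L[ℂ] H))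
    {x : H →L[ℂ] H} :
    x ∈ generatedBy X ↔ ∀ T : H →L[ℂ] H, (∀ y ∈ X, y * T = T * y) → T * x = x * T := by
  rw [mem_generatedBy]
  exact ⟨fun h T hT => h T fun y hy => ⟨hT y hy, commute_star_of_unitary (hX hy) (hT y hy)⟩,
    fun h T hT => h T fun y hy => (hT y hy).1⟩

/-- Conjugation by a unitary that maps the generators into a von Neumann algebra `N` maps the
generated von Neumann algebra into `N`. -/
theorem conj_mem_of_generators {X : Set (H →L[ℂ] H)} {N : VonNeumannAlgebra H}
    {u : H →L[ℂ] H} (hu : u ∈ unitary (H →L[ℂ] H)) (h : ∀ y ∈ X, u * y * star u ∈ N)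
    {x : H →L[ℂ] H} (hx : x ∈ generatedBy X) : u * x * star u ∈ N := by
  have h1 := (Unitary.mem_iff.1 hu).1
  have h2 := (Unitary.mem_iff.1 hu).2
  refine mem_of_commutes_commutant fun T hT => ?_
  have key : ∀ y : H →L[ℂ] H, T * (u * y * star u) = u * y * star u * T ↔
      star u * T * u * y = y * (star u * T * u) := by
    intro y
    constructor
    · intro h
      calc star u * T * u * y = star u * (T * (u * y * star u)) * u := by
            simp only [mul_assoc, h1, mul_one]
        _ = star u * u * y * (star u * T * u) := by rw [h]; simp only [mul_assoc]
        _ = _ := by rw [h1, one_mul]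
    · intro h
      calc T * (u * y * star u) = u * star u * T * u * y * star u := by
            rw [h2, one_mul]; simp only [mul_assoc]
        _ = u * (star u * T * u * y) * star u := by simp only [mul_assoc]
        _ = u * y * star u * T * (u * star u) := by rw [h]; simp only [mul_assoc]
        _ = _ := by rw [h2, mul_one]
  refine (key x).2 (mem_generatedBy.1 hx _ fun y hy => ⟨?_, ?_⟩)
  · exact ((key y).1 (hT _ (h y hy)).symm).symm
  · have h3 := hT _ (star_mem (h y hy))
    simp only [star_mul, star_star] at h3
    rw [← mul_assoc] at h3
    exact ((key (star y)).1 h3.symm).symm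

/-- A bounded operator that leaves a closed subspace `K` invariant, as does its adjoint, commutes
with the projection onto `K`. -/
theorem starProjection_commute {K : Submodule ℂ H} [K.HasOrthogonalProjection] {T : H →L[ℂ] H}
    (h : ∀ x ∈ K, T x ∈ K) (h' : ∀ x ∈ K, star T x ∈ K) :
    T * K.starProjection = K.starProjection * T := by
  ext1 x
  refine (Submodule.eq_starProjection_of_mem_orthogonal (u := T x)
    (h _ (K.starProjection_apply_mem x)) ?_).symm
  rw [Submodule.mem_orthogonal]
  intro y hy
  rw [← map_sub, ← ContinuousLinearMap.adjoint_inner_left, ← ContinuousLinearMap.star_eq_adjoint]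
  exact Submodule.inner_right_of_mem_orthogonal (h' y hy) (K.sub_starProjection_mem_orthogonal x)

theorem inner_star_left (T : H →L[ℂ] H) (x y : H) :
    inner ℂ (star T x) y = inner ℂ x (T y) := by
  rw [ContinuousLinearMap.star_eq_adjoint, ContinuousLinearMap.adjoint_inner_left]

theorem inner_star_right (T : H →L[ℂ] H) (x y : H) :
    inner ℂ x (star T y) = inner ℂ (T x) y := by
  rw [ContinuousLinearMap.star_eq_adjoint, ContinuousLinearMap.adjoint_inner_right]

theorem unitary_star_apply (u : unitary (H →L[ℂ] H)) (x : H) :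
    star (u : H →L[ℂ] H) ((u : H →L[ℂ] H) x) = x := by
  have := (Unitary.mem_iff.1 u.2).1
  exact DFunLike.congr_fun this x

theorem unitary_apply_star (u : unitary (H →L[ℂ] H)) (x : H) :
    (u : H →L[ℂ] H) (star (u : H →L[ℂ] H) x) = x := by
  have := (Unitary.mem_iff.1 u.2).2
  exact DFunLike.congr_fun this x

theorem unitary_inner_map (u : unitary (H →L[ℂ] H)) (x y : H) :
    inner ℂ ((u : H →L[ℂ] H) x) ((u : H →L[ℂ] H) y) = inner ℂ x y := by
  rw [← inner_star_left, unitary_star_apply]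

theorem unitary_norm_map (u : unitary (H →L[ℂ] H)) (x : H) : ‖(u : H →L[ℂ] H) x‖ = ‖x‖ := by
  rw [@norm_eq_sqrt_re_inner ℂ, unitary_inner_map, ← @norm_eq_sqrt_re_inner ℂ]

/-- A bounded sequence of operators has a limit in the weak operator topology along every
ultrafilter. -/
theorem exists_weak_limit (𝒰 : Ultrafilter ℕ) (T : ℕ → H →L[ℂ] H) (C : ℝ)
    (hT : ∀ n, ‖T n‖ ≤ C) :
    ∃ S : H →L[ℂ] H, ∀ x y, Filter.Tendsto (fun n => inner ℂ x (T n y)) 𝒰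
      (nhds (inner ℂ x (S y))) := by
  have hb : ∀ x y n, ‖(inner ℂ (T n x) y : ℂ)‖ ≤ C * ‖x‖ * ‖y‖ := fun x y n =>
    (norm_inner_le_norm _ _).trans (mul_le_mul_of_nonneg_right
      (((T n).le_opNorm x).trans (mul_le_mul_of_nonneg_right (hT n) (norm_nonneg _)))
      (norm_nonneg _))
  have hlim : ∀ x y, ∃ z : ℂ, ‖z‖ ≤ C * ‖x‖ * ‖y‖ ∧
      Filter.Tendsto (fun n => (inner ℂ (T n x) y : ℂ)) 𝒰 (nhds z) := by
    intro x y
    obtain ⟨z, hz, hle⟩ := (isCompact_closedBall (0 : ℂ) (C * ‖x‖ * ‖y‖)).ultrafilter_le_nhds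
      (𝒰.map fun n => (inner ℂ (T n x) y : ℂ)) (by
        rw [Filter.le_principal_iff]
        refine Filter.mem_map.2 (Filter.Eventually.of_forall fun n => ?_)
        simpa using hb x y n)
    exact ⟨z, by simpa using hz, hle⟩
  choose z hz hlim using hlim
  have huniq : ∀ {f : ℕ → ℂ} {a b : ℂ}, Filter.Tendsto f 𝒰 (nhds a) →
      Filter.Tendsto f 𝒰 (nhds b) → a = b := fun h1 h2 => tendsto_nhds_unique h1 h2
  let F : H →ₗ⋆[ℂ] H →ₗ[ℂ] ℂ := LinearMap.mk₂'ₛₗ (starRingEnd ℂ) (RingHom.id ℂ) z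
    (fun x x' y => huniq (hlim _ _) (by
      simpa only [map_add, inner_add_left] using (hlim x y).add (hlim x' y)))
    (fun c x y => huniq (hlim _ _) (by
      simpa only [map_smul, inner_smul_left, smul_eq_mul] using (hlim x y).const_mul _))
    (fun x y y' => huniq (hlim _ _) (by
      simpa only [inner_add_right] using (hlim x y).add (hlim x y')))
    (fun c x y => huniq (hlim _ _) (by
      simpa only [inner_smul_right, smul_eq_mul, RingHom.id_apply] using (hlim x y).const_mul c))
  refine ⟨InnerProductSpace.continuousLinearMapOfBilin (F.mkContinuous₂ C hz), fun x y => ?_⟩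
  have h1 : inner ℂ (InnerProductSpace.continuousLinearMapOfBilin (F.mkContinuous₂ C hz) y) x
      = z y x := InnerProductSpace.continuousLinearMapOfBilin_apply _ _ _
  rw [← inner_conj_symm, h1]
  simpa only [inner_conj_symm, Function.comp_def] using
    (Complex.continuous_conj.tendsto _).comp (hlim y x)

omit [CompleteSpace H] in
/-- A vector whose inner products with the members of an orthogonal sequence of constant norm
are all equal is orthogonal to the sequence. -/
theorem inner_eq_zero_of_orthogonal_sequence {z : ℕ → H} {y : H} {r : ℝ} {c : ℂ}
    (horth : ∀ m n, m ≠ n → inner ℂ (z m) (z n) = 0) (hnorm : ∀ n, ‖z n‖ = r)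
    (hc : ∀ n, inner ℂ (z n) y = c) : c = 0 := by
  by_cases hr : r = 0
  · have : z 0 = 0 := by rw [← norm_eq_zero, hnorm, hr]
    rw [← hc 0, this, inner_zero_left]
  have ho : Orthonormal ℂ fun n => ((r : ℂ)⁻¹) • z n := by
    refine ⟨fun n => ?_, fun m n hmn => ?_⟩
    · rw [norm_smul, hnorm, norm_inv, Complex.norm_real, Real.norm_eq_abs, abs_of_nonneg,
        inv_mul_cancel₀ hr]
      rw [← hnorm 0]; exact norm_nonneg _
    · simp only [inner_smul_left, inner_smul_right, horth m n hmn, mul_zero]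
  have hs := ho.inner_products_summable y
  simp only [inner_smul_left, hc] at hs
  have := (summable_const_iff _).1 hs
  simpa [hr] using this

omit [CompleteSpace H] in
theorem tendsto_inner_zero_of_orthonormal {ι : Type*} {v : ι → H} (hv : Orthonormal ℂ v) (y : H)
    {f : ℕ → ι} (hf : Function.Injective f) :
    Filter.Tendsto (fun n => inner ℂ (v (f n)) y) Filter.atTop (nhds 0) := by
  have hs := ((hv.comp f hf).inner_products_summable y).tendsto_atTop_zero
  rw [tendsto_zero_iff_norm_tendsto_zero]
  have := hs.sqrt
  simpa only [Real.sqrt_zero, Real.sqrt_sq (norm_nonneg _), Function.comp] using this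

end Generated

/-! ### Twisted group von Neumann algebras -/

section Twisted

variable {I H : Type*} [CommGroup I] [NormedAddCommGroup H] [InnerProductSpace ℂ H]
  [CompleteSpace H]

variable (I H) in
/-- A projective representation `left` of an abelian group `I` together with a unit vector
`basis 1` whose orbit under `left` is an orthonormal basis, and unitaries `right i` commuting
with `left` that move `basis 1` in the same way. The operators `left i` then generate a twisted
group von Neumann algebra in its standard representation. -/
structure TwistedSystem where
  /-- The orbit of the vacuum vector `basis 1`. -/
  basis : HilbertBasis I ℂ H
  /-- The canonical unitaries. -/
  left : I → unitary (H →L[ℂ] H)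
  /-- Unitaries in the commutant. -/
  right : I → unitary (H →L[ℂ] H)
  left_base : ∀ i, (left i : H →L[ℂ] H) (basis 1) = basis i
  right_base : ∀ i, (right i : H →L[ℂ] H) (basis 1) = basis i
  comm : ∀ i j, (left i : H →L[ℂ] H) * right j = right j * left i
  left_mul : ∀ i j, ∃ c : Circle, (left i : H →L[ℂ] H) * left j = (c : ℂ) • (left (i * j)).1

namespace TwistedSystem

variable (𝒮 : TwistedSystem I H)

/-- The canonical unitary `left i` as an operator. -/
abbrev U (i : I) : H →L[ℂ] H := 𝒮.left i

/-- The unitary `right i` as an operator. -/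
abbrev V (i : I) : H →L[ℂ] H := 𝒮.right i

/-- The vacuum vector. -/
abbrev vac : H := 𝒮.basis 1

/-- The von Neumann algebra generated by the canonical unitaries indexed by `A`. -/
def alg (A : Set I) : VonNeumannAlgebra H := generatedBy (𝒮.U '' A)

/-- The operators in the commutant of the right unitaries. -/
def IsLeft (x : H →L[ℂ] H) : Prop := ∀ i, x * 𝒮.V i = 𝒮.V i * x

theorem inner_basis [DecidableEq I] (i j : I) :
    inner ℂ (𝒮.basis i) (𝒮.basis j) = if i = j then 1 else 0 :=
  orthonormal_iff_ite.1 𝒮.basis.orthonormal i j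

theorem basis_injective : Function.Injective 𝒮.basis := 𝒮.basis.orthonormal.linearIndependent.injective

theorem basis_ne_zero (i : I) : 𝒮.basis i ≠ 0 := 𝒮.basis.orthonormal.ne_zero i

theorem ext_inner {x y : H} (h : ∀ i, inner ℂ (𝒮.basis i) x = inner ℂ (𝒮.basis i) y) : x = y := by
  apply 𝒮.basis.repr.injective
  ext i
  simpa only [𝒮.basis.repr_apply_apply] using h i

theorem exists_inner_ne_zero {x : H} (hx : x ≠ 0) : ∃ i, inner ℂ (𝒮.basis i) x ≠ 0 := by
  by_contra! h
  exact hx (𝒮.ext_inner fun i => by rw [h i, inner_zero_right])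

theorem hasSum_basis (x : H) : HasSum (fun i => inner ℂ (𝒮.basis i) x • 𝒮.basis i) x := by
  simpa only [𝒮.basis.repr_apply_apply] using 𝒮.basis.hasSum_repr x

theorem op_ext {x y : H →L[ℂ] H} (h : ∀ i, x (𝒮.basis i) = y (𝒮.basis i)) : x = y := by
  have hd : Dense (Submodule.span ℂ (Set.range 𝒮.basis) : Set H) := by
    rw [Submodule.dense_iff_topologicalClosure_eq_top]; exact 𝒮.basis.dense_span
  refine ContinuousLinearMap.ext_on hd ?_
  rintro _ ⟨i, rfl⟩
  exact h i

theorem U_one : 𝒮.U 1 = 1 := by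
  obtain ⟨c, hc⟩ := 𝒮.left_mul 1 1
  have h1 : 𝒮.U 1 = (c : ℂ) • 1 := by
    have h := congrArg (fun T => star (𝒮.U 1) * T) hc
    simp only [mul_one] at h
    rw [← mul_assoc, (Unitary.mem_iff.1 (𝒮.left 1).2).1, one_mul, mul_smul_comm,
      (Unitary.mem_iff.1 (𝒮.left 1).2).1] at h
    exact h
  have h2 : (c : ℂ) • 𝒮.basis 1 = (1 : ℂ) • 𝒮.basis 1 := by
    have : 𝒮.U 1 (𝒮.basis 1) = 𝒮.basis 1 := 𝒮.left_base 1
    rw [h1] at this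
    simpa using this
  have h3 : (c : ℂ) = 1 := smul_left_injective ℂ (𝒮.basis_ne_zero 1) h2
  rw [h1, h3, one_smul]

theorem U_basis (p i : I) : ∃ c : Circle, 𝒮.U p (𝒮.basis i) = (c : ℂ) • 𝒮.basis (p * i) := by
  obtain ⟨c, hc⟩ := 𝒮.left_mul p i
  refine ⟨c, ?_⟩
  rw [← 𝒮.left_base i, ← 𝒮.left_base (p * i)]
  exact DFunLike.congr_fun hc _

theorem V_basis (p i : I) : 𝒮.V p (𝒮.basis i) = 𝒮.U i (𝒮.basis p) := by
  rw [← 𝒮.left_base i, ← 𝒮.right_base p]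
  exact (DFunLike.congr_fun (𝒮.comm i p) _).symm

theorem star_U_basis (p i : I) :
    ∃ c : Circle, star (𝒮.U p) (𝒮.basis i) = (c : ℂ) • 𝒮.basis (p⁻¹ * i) := by
  obtain ⟨c, hc⟩ := 𝒮.U_basis p (p⁻¹ * i)
  rw [mul_inv_cancel_left] at hc
  refine ⟨c⁻¹, ?_⟩
  have h := congrArg (fun y : H => star (𝒮.U p) y) hc
  simp only [unitary_star_apply, map_smul] at h
  rw [h, smul_smul, ← Circle.coe_mul, inv_mul_cancel, Circle.coe_one, one_smul]

theorem star_V_vac (p : I) : star (𝒮.V p) 𝒮.vac = star (𝒮.U p) 𝒮.vac := by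
  have h1 : 𝒮.V p (star (𝒮.U p) 𝒮.vac) = 𝒮.vac := by
    have h2 := commute_star_of_unitary (𝒮.left p).2 (𝒮.comm p p)
    refine (DFunLike.congr_fun h2 𝒮.vac).symm.trans ?_
    change star (𝒮.U p) (𝒮.V p 𝒮.vac) = _
    rw [𝒮.right_base, ← 𝒮.left_base, unitary_star_apply]
  conv_lhs => rw [← h1]
  exact unitary_star_apply _ _

/-- Canonical unitaries commute up to a scalar. -/
theorem U_mul_comm (p i : I) : ∃ c : Circle, 𝒮.U p * 𝒮.U i = (c : ℂ) • (𝒮.U i * 𝒮.U p) := by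
  obtain ⟨c, hc⟩ := 𝒮.left_mul p i
  obtain ⟨d, hd⟩ := 𝒮.left_mul i p
  refine ⟨c * d⁻¹, ?_⟩
  rw [hc, hd, smul_smul, mul_comm i p, ← Circle.coe_mul, inv_mul_cancel_right]

variable {𝒮}

theorem IsLeft.apply_basis {x : H →L[ℂ] H} (hx : 𝒮.IsLeft x) (i : I) :
    x (𝒮.basis i) = 𝒮.V i (x 𝒮.vac) := by
  rw [← 𝒮.right_base i]
  exact DFunLike.congr_fun (hx i) _

theorem IsLeft.ext {x y : H →L[ℂ] H} (hx : 𝒮.IsLeft x) (hy : 𝒮.IsLeft y)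
    (h : x 𝒮.vac = y 𝒮.vac) : x = y :=
  𝒮.op_ext fun i => by rw [hx.apply_basis, hy.apply_basis, h]

theorem IsLeft.mul {x y : H →L[ℂ] H} (hx : 𝒮.IsLeft x) (hy : 𝒮.IsLeft y) : 𝒮.IsLeft (x * y) :=
  fun i => by rw [mul_assoc, hy i, ← mul_assoc, hx i, mul_assoc]

theorem IsLeft.sub {x y : H →L[ℂ] H} (hx : 𝒮.IsLeft x) (hy : 𝒮.IsLeft y) : 𝒮.IsLeft (x - y) :=
  fun i => by rw [sub_mul, hx i, hy i, mul_sub]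

theorem IsLeft.smul {x : H →L[ℂ] H} (hx : 𝒮.IsLeft x) (c : ℂ) : 𝒮.IsLeft (c • x) :=
  fun i => by rw [smul_mul_assoc, hx i, mul_smul_comm]

theorem IsLeft.adjoint {x : H →L[ℂ] H} (hx : 𝒮.IsLeft x) : 𝒮.IsLeft (star x) := fun i => by
  have h := congrArg (fun T : H →L[ℂ] H => star T) (commute_star_of_unitary (𝒮.right i).2 (hx i).symm)
  simpa only [star_mul, star_star] using h

variable (𝒮) in
theorem isLeft_U (i : I) : 𝒮.IsLeft (𝒮.U i) := 𝒮.comm i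

theorem unitary_image_U (A : Set I) : 𝒮.U '' A ⊆ unitary (H →L[ℂ] H) := by
  rintro _ ⟨i, -, rfl⟩
  exact (𝒮.left i).2

theorem U_mem_alg {A : Set I} {i : I} (hi : i ∈ A) : 𝒮.U i ∈ 𝒮.alg A :=
  subset_generatedBy _ ⟨i, hi, rfl⟩

theorem isLeft_of_mem_alg {A : Set I} {x : H →L[ℂ] H} (hx : x ∈ 𝒮.alg A) : 𝒮.IsLeft x := by
  intro i
  refine ((mem_generatedBy_of_unitary (unitary_image_U A)).1 hx (𝒮.V i) ?_).symm
  rintro _ ⟨j, -, rfl⟩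
  exact 𝒮.comm j i

theorem IsLeft.hasSum_apply_basis {x : H →L[ℂ] H} (hx : 𝒮.IsLeft x) (i : I) :
    HasSum (fun p => inner ℂ (𝒮.basis p) (x 𝒮.vac) • 𝒮.U p (𝒮.basis i)) (x (𝒮.basis i)) := by
  have h := (𝒮.hasSum_basis (x 𝒮.vac)).mapL (𝒮.V i)
  rw [← hx.apply_basis] at h
  simpa only [map_smul, 𝒮.V_basis i] using h

theorem IsLeft.inner_star {x : H →L[ℂ] H} (hx : 𝒮.IsLeft x) (p : I) :
    inner ℂ (star (𝒮.U p) 𝒮.vac) (star x 𝒮.vac) =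
      starRingEnd ℂ (inner ℂ (𝒮.basis p) (x 𝒮.vac)) := by
  rw [inner_star_right, ← 𝒮.star_V_vac]
  have h := commute_star_of_unitary (𝒮.right p).2 (hx p).symm
  have h2 : x (star (𝒮.V p) 𝒮.vac) = star (𝒮.V p) (x 𝒮.vac) :=
    (DFunLike.congr_fun h 𝒮.vac).symm
  rw [h2, inner_star_left, 𝒮.right_base, inner_conj_symm]

theorem IsLeft.hasSum_star_apply_basis {x : H →L[ℂ] H} (hx : 𝒮.IsLeft x) (i : I) :
    HasSum (fun p => starRingEnd ℂ (inner ℂ (𝒮.basis p) (x 𝒮.vac)) •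
      star (𝒮.U p) (𝒮.basis i)) (star x (𝒮.basis i)) := by
  have h1 := (Equiv.inv I).hasSum_iff.2 (𝒮.hasSum_basis (star x 𝒮.vac))
  have h2 : ∀ p, inner ℂ (𝒮.basis p⁻¹) (star x 𝒮.vac) • 𝒮.basis p⁻¹ =
      starRingEnd ℂ (inner ℂ (𝒮.basis p) (x 𝒮.vac)) • star (𝒮.U p) 𝒮.vac := by
    intro p
    obtain ⟨c, hc⟩ := 𝒮.star_U_basis p 1
    rw [mul_one] at hc
    rw [← hx.inner_star p, hc, inner_smul_left, smul_smul, mul_right_comm, Complex.conj_mul',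
      Circle.norm_coe, Complex.ofReal_one, one_pow, one_mul]
  have h3 := h1.mapL (𝒮.V i)
  rw [← hx.adjoint.apply_basis] at h3
  refine h3.congr_fun ?_
  intro p
  change _ = 𝒮.V i (inner ℂ (𝒮.basis p⁻¹) (star x 𝒮.vac) • 𝒮.basis p⁻¹)
  rw [h2, map_smul, ← 𝒮.right_base i]
  congr 1
  exact DFunLike.congr_fun (commute_star_of_unitary (𝒮.left p).2 (𝒮.comm p i)) _

/-- Traciality of the vacuum state, expressed by norms. -/
theorem IsLeft.norm_star {x : H →L[ℂ] H} (hx : 𝒮.IsLeft x) :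
    ‖star x 𝒮.vac‖ = ‖x 𝒮.vac‖ := by
  have key : ∀ y : H, HasSum (fun i => ‖(inner ℂ (𝒮.basis i) y : ℂ)‖ ^ 2) (‖y‖ ^ 2) := by
    intro y
    have h := 𝒮.basis.hasSum_inner_mul_inner y y
    rw [inner_self_eq_norm_sq_to_K] at h
    have h2 := h.mapL Complex.reCLM
    norm_cast at h2
    refine h2.congr_fun ?_
    intro i
    rw [← inner_conj_symm y, Complex.conj_mul']
    norm_cast
  have h1 := (Equiv.inv I).hasSum_iff.2 (key (star x 𝒮.vac))
  have h2 : ∀ p, ‖(inner ℂ (𝒮.basis p⁻¹) (star x 𝒮.vac) : ℂ)‖ =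
      ‖(inner ℂ (𝒮.basis p) (x 𝒮.vac) : ℂ)‖ := by
    intro p
    obtain ⟨c, hc⟩ := 𝒮.star_U_basis p 1
    rw [mul_one] at hc
    have := congrArg norm (hx.inner_star p)
    rw [hc, inner_smul_left, norm_mul, RCLike.norm_conj, RCLike.norm_conj, Circle.norm_coe,
      one_mul] at this
    exact this
  have h3 : HasSum (fun i => ‖(inner ℂ (𝒮.basis i) (x 𝒮.vac) : ℂ)‖ ^ 2)
      (‖star x 𝒮.vac‖ ^ 2) := by
    refine h1.congr_fun ?_
    intro p
    change _ = ‖(inner ℂ (𝒮.basis p⁻¹) (star x 𝒮.vac) : ℂ)‖ ^ 2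
    rw [h2]
  exact (sq_eq_sq₀ (norm_nonneg _) (norm_nonneg _)).1 (h3.unique (key _))

/-- An operator in the commutant of the right unitaries lies in the von Neumann algebra generated
by those `left p` for which it has a nonzero coefficient: it is the sum of `c_p • U p`, in a
sense weak enough to be checked on basis vectors, and so is its adjoint. -/
theorem IsLeft.mem_alg {x : H →L[ℂ] H} (hx : 𝒮.IsLeft x) {A : Set I}
    (hA : ∀ i ∉ A, inner ℂ (𝒮.basis i) (x 𝒮.vac) = 0) : x ∈ 𝒮.alg A := by
  refine (mem_generatedBy_of_unitary (unitary_image_U A)).2 fun T hT => ?_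
  refine 𝒮.op_ext fun r => 𝒮.ext_inner fun s => ?_
  have h1 : HasSum (fun p => inner ℂ (𝒮.basis p) (x 𝒮.vac) *
      inner ℂ (𝒮.basis s) (T (𝒮.U p (𝒮.basis r)))) (inner ℂ (𝒮.basis s) (T (x (𝒮.basis r)))) := by
    have := (hx.hasSum_apply_basis r).mapL ((innerSL ℂ (𝒮.basis s)).comp T)
    simpa  using this
  have h2 : HasSum (fun p => inner ℂ (𝒮.basis p) (x 𝒮.vac) *
      inner ℂ (star (𝒮.U p) (𝒮.basis s)) (T (𝒮.basis r)))
      (inner ℂ (star x (𝒮.basis s)) (T (𝒮.basis r))) := by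
    have h3 := (hx.hasSum_star_apply_basis s).mapL (innerSL ℂ (T (𝒮.basis r)))
    have h4 := h3.mapL (Complex.conjCLE.toContinuousLinearMap)
    simpa [inner_smul_right] using h4
  refine h1.unique ?_
  rw [inner_star_left] at h2
  refine h2.congr_fun ?_
  intro p
  by_cases hp : p ∈ A
  · congr 1
    rw [inner_star_left]
    have := DFunLike.congr_fun (hT _ ⟨p, hp, rfl⟩) (𝒮.basis r)
    exact congrArg _ this.symm
  · rw [hA p hp, zero_mul, zero_mul]

theorem mem_alg_univ {x : H →L[ℂ] H} : x ∈ 𝒮.alg Set.univ ↔ 𝒮.IsLeft x :=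
  ⟨isLeft_of_mem_alg, fun h => h.mem_alg fun _ hi => (hi trivial).elim⟩

/-- The coefficients of an operator that commutes with `left p` are supported on indices `i` for
which `left i` commutes with `left p`. -/
theorem IsLeft.commute_of_inner_ne_zero {x : H →L[ℂ] H} (hx : 𝒮.IsLeft x) {p i : I}
    (hp : x * 𝒮.U p = 𝒮.U p * x) (hi : inner ℂ (𝒮.basis i) (x 𝒮.vac) ≠ 0) :
    𝒮.U p * 𝒮.U i = 𝒮.U i * 𝒮.U p := by
  obtain ⟨c, hc⟩ := 𝒮.U_mul_comm p i
  have h1 : 𝒮.U p (𝒮.basis i) = (c : ℂ) • 𝒮.V p (𝒮.basis i) := by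
    rw [𝒮.V_basis, ← 𝒮.left_base i, ← 𝒮.left_base p]
    exact DFunLike.congr_fun hc _
  have h2 : 𝒮.U p (x 𝒮.vac) = 𝒮.V p (x 𝒮.vac) := by
    rw [← hx.apply_basis, ← 𝒮.left_base p]
    exact (DFunLike.congr_fun hp _).symm
  have h3 : inner ℂ (𝒮.basis i) (x 𝒮.vac) =
      starRingEnd ℂ (c : ℂ) * inner ℂ (𝒮.basis i) (x 𝒮.vac) := by
    conv_lhs => rw [← unitary_inner_map (𝒮.left p)]
    rw [h1, h2, inner_smul_left, unitary_inner_map]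
  have h4 : starRingEnd ℂ (c : ℂ) = 1 := by
    have := mul_right_cancel₀ hi ((one_mul _).trans h3)
    exact this.symm
  have h5 : (c : ℂ) = 1 := by simpa using congrArg (starRingEnd ℂ) h4
  rw [hc, h5, one_smul]

variable (𝒮) in
/-- The closed subspace of vectors whose coefficients vanish outside `A`. -/
def supp (A : Set I) : Submodule ℂ H where
  carrier := {y | ∀ i ∉ A, inner ℂ (𝒮.basis i) y = 0}
  zero_mem' _ _ := inner_zero_right _
  add_mem' hx hy i hi := by rw [inner_add_right, hx i hi, hy i hi, add_zero]
  smul_mem' c x hx i hi := by rw [inner_smul_right, hx i hi, mul_zero]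

theorem mem_supp {A : Set I} {y : H} : y ∈ 𝒮.supp A ↔ ∀ i ∉ A, inner ℂ (𝒮.basis i) y = 0 := Iff.rfl

theorem isClosed_supp (A : Set I) : IsClosed (𝒮.supp A : Set H) := by
  have : (𝒮.supp A : Set H) = ⋂ i ∈ Aᶜ, {y | inner ℂ (𝒮.basis i) y = 0} := by
    ext y; simp [mem_supp]
  rw [this]
  refine isClosed_biInter fun i _ => isClosed_eq ?_ continuous_const
  exact (innerSL ℂ (𝒮.basis i)).continuous

instance (A : Set I) : CompleteSpace (𝒮.supp A) := (isClosed_supp A).completeSpace_coe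

theorem basis_mem_supp {A : Set I} {i : I} (hi : i ∈ A) : 𝒮.basis i ∈ 𝒮.supp A := fun j hj => by
  classical
  rw [𝒮.inner_basis, if_neg]
  rintro rfl
  exact hj hi

/-- To prove that a closed subspace contains `supp A` it suffices to check basis vectors. -/
theorem supp_le {A : Set I} {K : Submodule ℂ H} (hK : IsClosed (K : Set H))
    (h : ∀ i ∈ A, 𝒮.basis i ∈ K) : 𝒮.supp A ≤ K := by
  intro y hy
  refine hK.mem_of_tendsto (𝒮.hasSum_basis y) (Filter.Eventually.of_forall fun s => ?_)
  refine K.sum_mem fun i _ => ?_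
  by_cases hi : i ∈ A
  · exact K.smul_mem _ (h i hi)
  · rw [hy i hi, zero_smul]; exact K.zero_mem

theorem inner_proj_supp [DecidableEq I] (A : Set I) [DecidablePred (· ∈ A)] (y : H) (i : I) :
    inner ℂ (𝒮.basis i) ((𝒮.supp A).starProjection y) =
      if i ∈ A then inner ℂ (𝒮.basis i) y else 0 := by
  split_ifs with hi
  · rw [← sub_eq_zero, ← inner_sub_right, ← neg_eq_zero, ← inner_neg_right, neg_sub]
    exact Submodule.inner_right_of_mem_orthogonal (basis_mem_supp hi)
      ((𝒮.supp A).sub_starProjection_mem_orthogonal y)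
  · exact (𝒮.supp A).starProjection_apply_mem y i hi

theorem map_supp_of_basis {A : Set I} {T : H →L[ℂ] H} {K : Submodule ℂ H}
    (hK : IsClosed (K : Set H)) (h : ∀ i ∈ A, T (𝒮.basis i) ∈ K) {y : H} (hy : y ∈ 𝒮.supp A) :
    T y ∈ K := by
  have h1 : 𝒮.supp A ≤ K.comap T.toLinearMap :=
    supp_le (hK.preimage T.continuous) h
  exact h1 hy

theorem proj_supp_commute_of_mem_alg {A : Subgroup I} {x : H →L[ℂ] H} (hx : x ∈ 𝒮.alg A) :
    x * (𝒮.supp A).starProjection = (𝒮.supp A).starProjection * x := by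
  refine ((mem_generatedBy_of_unitary (unitary_image_U _)).1 hx _ ?_).symm
  rintro _ ⟨p, hp, rfl⟩
  refine starProjection_commute (fun y hy => ?_) (fun y hy => ?_)
  · refine map_supp_of_basis (isClosed_supp _) (fun i hi => ?_) hy
    obtain ⟨c, hc⟩ := 𝒮.U_basis p i
    rw [hc]
    exact Submodule.smul_mem _ _ (basis_mem_supp (A.mul_mem hp hi))
  · refine map_supp_of_basis (isClosed_supp _) (fun i hi => ?_) hy
    obtain ⟨c, hc⟩ := 𝒮.star_U_basis p i
    rw [hc]
    exact Submodule.smul_mem _ _ (basis_mem_supp (A.mul_mem (A.inv_mem hp) hi))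

theorem map_supp_of_mem_alg {A : Subgroup I} {x : H →L[ℂ] H} (hx : x ∈ 𝒮.alg A) {y : H}
    (hy : y ∈ 𝒮.supp A) : x y ∈ 𝒮.supp A := by
  have h := DFunLike.congr_fun (proj_supp_commute_of_mem_alg hx) y
  change x ((𝒮.supp A).starProjection y) = (𝒮.supp A).starProjection (x y) at h
  rw [Submodule.starProjection_eq_self_iff.2 hy] at h
  rw [h]
  exact Submodule.starProjection_apply_mem _ _

theorem mem_alg_iff {A : Subgroup I} {x : H →L[ℂ] H} :
    x ∈ 𝒮.alg A ↔ 𝒮.IsLeft x ∧ x 𝒮.vac ∈ 𝒮.supp A :=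
  ⟨fun h => ⟨isLeft_of_mem_alg h, map_supp_of_mem_alg h (basis_mem_supp A.one_mem)⟩,
    fun h => h.1.mem_alg h.2⟩

end TwistedSystem

end Twisted

/-! ### Group measure space decompositions of twisted group von Neumann algebras -/

section Decomposition

variable {I H : Type*} [CommGroup I] [NormedAddCommGroup H] [InnerProductSpace ℂ H]
  [CompleteSpace H]

namespace TwistedSystem

variable (𝒮 : TwistedSystem I H)

/-- The closed linear span of the vectors `x vac` for `x ∈ X`. -/
def hull (X : Set (H →L[ℂ] H)) : Submodule ℂ H :=
  (Submodule.span ℂ ((fun x => x 𝒮.vac) '' X)).topologicalClosure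

instance (X : Set (H →L[ℂ] H)) : CompleteSpace (𝒮.hull X) :=
  (Submodule.isClosed_topologicalClosure _).completeSpace_coe

/-- `(B, Λ)` is a group measure space decomposition of the von Neumann algebra generated by all
canonical unitaries, for the trace given by the vacuum vector. -/
abbrev IsGMS (B : VonNeumannAlgebra H) (Λ : Subgroup (unitary (H →L[ℂ] H))) : Prop :=
  IsGMSDecomposition (𝒮.alg Set.univ) (fun T => inner ℂ 𝒮.vac (T 𝒮.vac)) B Λ

variable {𝒮}

theorem smul_mem_vonNeumann {N : VonNeumannAlgebra H} (c : ℂ) {x : H →L[ℂ] H} (hx : x ∈ N) :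
    c • x ∈ N :=
  N.toStarSubalgebra.smul_mem hx c

theorem isClosed_hull (X : Set (H →L[ℂ] H)) : IsClosed (𝒮.hull X : Set H) :=
  Submodule.isClosed_topologicalClosure _

theorem apply_vac_mem_hull {X : Set (H →L[ℂ] H)} {x : H →L[ℂ] H} (hx : x ∈ X) :
    x 𝒮.vac ∈ 𝒮.hull X :=
  Submodule.le_topologicalClosure _ (Submodule.subset_span ⟨x, hx, rfl⟩)

theorem hull_le {X : Set (H →L[ℂ] H)} {K : Submodule ℂ H} (hK : IsClosed (K : Set H))
    (h : ∀ x ∈ X, x 𝒮.vac ∈ K) : 𝒮.hull X ≤ K := by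
  refine Submodule.topologicalClosure_minimal _ (Submodule.span_le.2 ?_) hK
  rintro _ ⟨x, hx, rfl⟩
  exact h x hx

theorem map_hull {X : Set (H →L[ℂ] H)} {K : Submodule ℂ H} (hK : IsClosed (K : Set H))
    {T : H →L[ℂ] H} (h : ∀ x ∈ X, T (x 𝒮.vac) ∈ K) {y : H} (hy : y ∈ 𝒮.hull X) : T y ∈ K := by
  have h1 : 𝒮.hull X ≤ K.comap T.toLinearMap := hull_le (hK.preimage T.continuous) h
  exact h1 hy

theorem inner_eq_zero_of_hull {X : Set (H →L[ℂ] H)} {z : H}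
    (h : ∀ x ∈ X, inner ℂ z (x 𝒮.vac) = 0) {y : H} (hy : y ∈ 𝒮.hull X) : inner ℂ z y = 0 := by
  have h1 : 𝒮.hull X ≤ (Submodule.span ℂ {z})ᗮ :=
    hull_le (Submodule.isClosed_orthogonal _) fun x hx => by
      rw [Submodule.mem_orthogonal_singleton_iff_inner_right]; exact h x hx
  exact (Submodule.mem_orthogonal_singleton_iff_inner_right).1 (h1 hy)

variable {B : VonNeumannAlgebra H} {Λ : Subgroup (unitary (H →L[ℂ] H))}

theorem IsGMS.isLeft_of_mem (hG : 𝒮.IsGMS B Λ) {b : H →L[ℂ] H} (hb : b ∈ B) : 𝒮.IsLeft b :=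
  mem_alg_univ.1 (hG.le hb)

theorem IsGMS.isLeft_of_mem_group (hG : 𝒮.IsGMS B Λ) {v : unitary (H →L[ℂ] H)} (hv : v ∈ Λ) :
    𝒮.IsLeft v :=
  mem_alg_univ.1 (hG.mem v hv)

theorem IsGMS.conj_mem (hG : 𝒮.IsGMS B Λ) {v : unitary (H →L[ℂ] H)} (hv : v ∈ Λ)
    {b : H →L[ℂ] H} (hb : b ∈ B) : star (v : H →L[ℂ] H) * b * v ∈ B := by
  have h := hG.normalizes v⁻¹ (Λ.inv_mem hv) b hb
  rwa [← Unitary.star_eq_inv, Unitary.coe_star, star_star] at h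

/-- The subspaces `v B vac`, `v ∈ Λ`, are mutually orthogonal. -/
theorem IsGMS.inner_eq_zero (hG : 𝒮.IsGMS B Λ) {v w : unitary (H →L[ℂ] H)} (hv : v ∈ Λ)
    (hw : w ∈ Λ) (hvw : v ≠ w) {b c : H →L[ℂ] H} (hb : b ∈ B) (hc : c ∈ B) :
    inner ℂ ((v : H →L[ℂ] H) (b 𝒮.vac)) ((w : H →L[ℂ] H) (c 𝒮.vac)) = 0 := by
  have hu : v⁻¹ * w ∈ Λ := Λ.mul_mem (Λ.inv_mem hv) hw
  have hne : v⁻¹ * w ≠ 1 := fun h => hvw (inv_mul_eq_one.1 h)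
  have h1 := (hG.condExp_eq_zero _ hu hne).2 (star b * ((v⁻¹ * w).1 * c * star (v⁻¹ * w).1))
    (mul_mem (star_mem hb) (hG.normalizes _ hu c hc))
  have h2 : star b * ((v⁻¹ * w).1 * c * star (v⁻¹ * w).1) * (v⁻¹ * w).1 =
      star b * (star v.1 * w.1 * c) := by
    rw [mul_assoc, mul_assoc ((v⁻¹ * w).1 * c), (Unitary.mem_iff.1 (v⁻¹ * w).2).1, mul_one]
    rfl
  rw [h2] at h1
  simp only [mul_zero, zero_apply, inner_zero_right] at h1
  rw [← inner_star_right, ← inner_star_right]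
  exact h1.symm

/-- The subspaces `v B vac`, `v ∈ Λ`, are total: the projection onto their closed linear span
lies in the commutant of the algebra and fixes the cyclic vector. -/
theorem IsGMS.mem_hull (hG : 𝒮.IsGMS B Λ) (y : H) :
    y ∈ 𝒮.hull {x | ∃ v ∈ Λ, ∃ b ∈ B, x = (v : H →L[ℂ] H) * b} := by
  set X := {x | ∃ v ∈ Λ, ∃ b ∈ B, x = (v : H →L[ℂ] H) * b} with hX
  have hB : ∀ c ∈ B, ∀ y ∈ 𝒮.hull X, c y ∈ 𝒮.hull X := by
    intro c hc y hy
    refine map_hull (isClosed_hull X) ?_ hy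
    rintro _ ⟨v, hv, b, hb, rfl⟩
    have h1 : c * (v.1 * b) = v.1 * (star v.1 * c * v.1 * b) := by
      simp only [← mul_assoc, (Unitary.mem_iff.1 v.2).2, one_mul]
    change (c * (v.1 * b)) 𝒮.vac ∈ _
    rw [h1]
    exact apply_vac_mem_hull (x := v.1 * (star v.1 * c * v.1 * b))
      ⟨v, hv, _, mul_mem (hG.conj_mem hv hc) hb, rfl⟩
  have hΛ : ∀ w ∈ Λ, ∀ y ∈ 𝒮.hull X, (w : H →L[ℂ] H) y ∈ 𝒮.hull X := by
    intro w hw y hy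
    refine map_hull (isClosed_hull X) ?_ hy
    rintro _ ⟨v, hv, b, hb, rfl⟩
    exact apply_vac_mem_hull (x := w.1 * (v.1 * b)) ⟨w * v, Λ.mul_mem hw hv, b, hb, by
      rw [Submonoid.coe_mul, mul_assoc]⟩
  have hcomm : ∀ T ∈ 𝒮.alg Set.univ,
      (𝒮.hull X).starProjection * T = T * (𝒮.hull X).starProjection := by
    intro T hT
    rw [← hG.generates] at hT
    refine mem_generatedBy.1 hT _ ?_
    rintro z (hz | ⟨w, hw, rfl⟩)
    · exact ⟨starProjection_commute (hB z hz) (hB _ (star_mem hz)),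
        starProjection_commute (hB _ (star_mem hz)) (by rw [star_star]; exact hB z hz)⟩
    · have h1 := starProjection_commute (K := 𝒮.hull X) (hΛ w hw) (hΛ w⁻¹ (Λ.inv_mem hw))
      exact ⟨h1, commute_star_of_unitary w.2 h1⟩
  have hvac : 𝒮.vac ∈ 𝒮.hull X :=
    apply_vac_mem_hull (x := 1) ⟨1, Λ.one_mem, 1, one_mem B, by simp⟩
  have hU : ∀ i, 𝒮.basis i ∈ 𝒮.hull X := by
    intro i
    have h1 := DFunLike.congr_fun (hcomm _ (U_mem_alg (Set.mem_univ i))) 𝒮.vac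
    change (𝒮.hull X).starProjection (𝒮.U i 𝒮.vac) =
      𝒮.U i ((𝒮.hull X).starProjection 𝒮.vac) at h1
    rw [Submodule.starProjection_eq_self_iff.2 hvac, 𝒮.left_base] at h1
    exact Submodule.starProjection_eq_self_iff.1 h1
  exact supp_le (A := Set.univ) (isClosed_hull X) (fun i _ => hU i) fun i hi => (hi trivial).elim

theorem unitary_vac_ne_zero (v : unitary (H →L[ℂ] H)) : (v : H →L[ℂ] H) 𝒮.vac ≠ 0 := by
  rw [← norm_ne_zero_iff, unitary_norm_map, norm_ne_zero_iff]
  exact 𝒮.basis_ne_zero 1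

/-- Two elements of `Λ` that are proportional, even with coefficients in `B`, are equal. -/
theorem IsGMS.eq_of_apply_vac (hG : 𝒮.IsGMS B Λ) {v w : unitary (H →L[ℂ] H)} (hv : v ∈ Λ)
    (hw : w ∈ Λ) {b : H →L[ℂ] H} (hb : b ∈ B)
    (h : (v : H →L[ℂ] H) 𝒮.vac = (w : H →L[ℂ] H) (b 𝒮.vac)) : v = w := by
  by_contra hne
  have h1 := hG.inner_eq_zero hv hw hne (one_mem B) hb
  rw [← h] at h1
  exact unitary_vac_ne_zero v (inner_self_eq_zero.1 h1)

theorem IsGMS.eq_of_smul (hG : 𝒮.IsGMS B Λ) {v w : unitary (H →L[ℂ] H)} (hv : v ∈ Λ)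
    (hw : w ∈ Λ) {c : ℂ} (h : (v : H →L[ℂ] H) = c • (w : H →L[ℂ] H)) : v = w :=
  hG.eq_of_apply_vac hv hw (b := c • 1) (smul_mem_vonNeumann c (one_mem B)) (by
    rw [h]
    simp)

/-- The only vectors of the form `x vac` in the closure of `B vac` are those with `x ∈ B`. -/
theorem IsGMS.mem_of_vac_mem_hull (hG : 𝒮.IsGMS B Λ) {x : H →L[ℂ] H} (hx : 𝒮.IsLeft x)
    (h : x 𝒮.vac ∈ 𝒮.hull B) : x ∈ B := by
  refine hG.maximal x (mem_alg_univ.2 hx) fun b hb => ?_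
  have hbL := hG.isLeft_of_mem hb
  refine (hbL.mul hx).ext (hx.mul hbL) ?_
  have hspan : ∀ y ∈ Submodule.span ℂ ((fun x : H →L[ℂ] H => x 𝒮.vac) '' (B : Set (H →L[ℂ] H))),
      ∃ c ∈ B, y = c 𝒮.vac := by
    intro y hy
    induction hy using Submodule.span_induction with
    | mem y hy => obtain ⟨c, hc, rfl⟩ := hy; exact ⟨c, hc, rfl⟩
    | zero => exact ⟨0, zero_mem B, rfl⟩
    | add y z _ _ hy hz =>
      obtain ⟨c, hc, rfl⟩ := hy
      obtain ⟨d, hd, rfl⟩ := hz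
      exact ⟨c + d, add_mem hc hd, rfl⟩
    | smul a y _ hy =>
      obtain ⟨c, hc, rfl⟩ := hy
      exact ⟨a • c, smul_mem_vonNeumann a hc, rfl⟩
  have hest : ∀ c ∈ B, ‖(b * x) 𝒮.vac - (x * b) 𝒮.vac‖ ≤ 2 * ‖b‖ * ‖x 𝒮.vac - c 𝒮.vac‖ := by
    intro c hc
    have hcL := hG.isLeft_of_mem hc
    have h1 : (b * x) 𝒮.vac - (x * b) 𝒮.vac = b ((x - c) 𝒮.vac) - ((x - c) * b) 𝒮.vac := by
      have h2 : (b * c) 𝒮.vac = (c * b) 𝒮.vac := by rw [hG.abelian b hb c hc]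
      simp only [mul_apply_eq_comp, sub_apply, map_sub] at h2 ⊢
      rw [h2]
      abel
    -- right multiplication by `b` is bounded for the vacuum norm, by traciality
    have h3 : ‖((x - c) * b) 𝒮.vac‖ ≤ ‖b‖ * ‖(x - c) 𝒮.vac‖ := by
      rw [← ((hx.sub hcL).mul hbL).norm_star, star_mul, ← (hx.sub hcL).norm_star, ← norm_star b]
      exact (star b).le_opNorm _
    rw [h1]
    have h4 := b.le_opNorm ((x - c) 𝒮.vac)
    have h5 := norm_sub_le (b ((x - c) 𝒮.vac)) (((x - c) * b) 𝒮.vac)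
    change _ ≤ 2 * ‖b‖ * ‖(x - c) 𝒮.vac‖
    linarith
  rw [← sub_eq_zero, ← norm_le_zero_iff]
  refine le_of_forall_pos_le_add fun ε hε => ?_
  have hδ : 0 < ε / (2 * ‖b‖ + 1) := by positivity
  obtain ⟨y, hy, hxy⟩ := Metric.mem_closure_iff.1 h _ hδ
  obtain ⟨c, hc, rfl⟩ := hspan y hy
  refine (hest c hc).trans ?_
  rw [dist_eq_norm] at hxy
  calc 2 * ‖b‖ * ‖x 𝒮.vac - c 𝒮.vac‖ ≤ (2 * ‖b‖ + 1) * (ε / (2 * ‖b‖ + 1)) := by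
        gcongr
        linarith
    _ = 0 + ε := by field_simp; ring

/-! ### Symmetries -/

variable (𝒮) in
/-- A symmetry of a twisted group von Neumann algebra: an automorphism `perm` of the index group
whose action on the basis vectors is implemented by a unitary that conjugates the canonical
unitaries accordingly. -/
structure Symmetry where
  /-- The implementing unitary. -/
  op : unitary (H →L[ℂ] H)
  /-- The automorphism of the index group. -/
  perm : MulAut I
  op_basis : ∀ i, (op : H →L[ℂ] H) (𝒮.basis i) = 𝒮.basis (perm i)
  op_U : ∀ i, (op : H →L[ℂ] H) * 𝒮.U i * star (op : H →L[ℂ] H) = 𝒮.U (perm i)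

/-- Conjugation by the symmetry maps `B` and `Λ` into themselves. -/
def Symmetry.Preserves (s : 𝒮.Symmetry) (B : VonNeumannAlgebra H)
    (Λ : Subgroup (unitary (H →L[ℂ] H))) : Prop :=
  (∀ b ∈ B, (s.op : H →L[ℂ] H) * b * star (s.op : H →L[ℂ] H) ∈ B) ∧
    ∀ v ∈ Λ, s.op * v * s.op⁻¹ ∈ Λ

/-- Indices that are not fixed have an infinite orbit. -/
def Symmetry.FreeOffFixed (s : 𝒮.Symmetry) : Prop :=
  ∀ i, s.perm i ≠ i → Function.Injective fun n : ℕ => (s.perm ^ n) i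

theorem Symmetry.pow_basis (s : 𝒮.Symmetry) (n : ℕ) (i : I) :
    ((s.op ^ n : unitary (H →L[ℂ] H)) : H →L[ℂ] H) (𝒮.basis i) = 𝒮.basis ((s.perm ^ n) i) := by
  induction n with
  | zero => rfl
  | succ n ih =>
    rw [pow_succ', pow_succ']
    change (s.op : H →L[ℂ] H) (((s.op ^ n : unitary (H →L[ℂ] H)) : H →L[ℂ] H) (𝒮.basis i)) = _
    rw [ih, s.op_basis]
    rfl

theorem Symmetry.conj_pow_vac (s : 𝒮.Symmetry) (n : ℕ) (x : H →L[ℂ] H) :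
    ((s.op ^ n : unitary (H →L[ℂ] H)).1 * x * star (s.op ^ n : unitary (H →L[ℂ] H)).1) 𝒮.vac =
      (s.op ^ n : unitary (H →L[ℂ] H)).1 (x 𝒮.vac) := by
  have h : star (s.op ^ n : unitary (H →L[ℂ] H)).1 𝒮.vac = 𝒮.vac := by
    have h1 := s.pow_basis n 1
    rw [map_one (s.perm ^ n)] at h1
    have h2 := congrArg (fun y => star (s.op ^ n : unitary (H →L[ℂ] H)).1 y) h1
    simp only [unitary_star_apply] at h2
    exact h2.symm
  change (s.op ^ n : unitary (H →L[ℂ] H)).1 (x (star (s.op ^ n : unitary (H →L[ℂ] H)).1 𝒮.vac)) = _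
  rw [h]

theorem Symmetry.conj_vac (s : 𝒮.Symmetry) (x : H →L[ℂ] H) :
    (s.op.1 * x * star s.op.1) 𝒮.vac = s.op.1 (x 𝒮.vac) := by
  simpa only [pow_one] using s.conj_pow_vac 1 x

theorem Symmetry.Preserves.pow_mem {s : 𝒮.Symmetry} (hs : s.Preserves B Λ) (n : ℕ)
    {b : H →L[ℂ] H} (hb : b ∈ B) :
    (s.op ^ n : unitary (H →L[ℂ] H)).1 * b * star (s.op ^ n : unitary (H →L[ℂ] H)).1 ∈ B := by
  induction n with
  | zero => simpa using hb
  | succ n ih =>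
    rw [pow_succ']
    simpa only [Submonoid.coe_mul, star_mul, mul_assoc] using hs.1 _ ih

theorem Symmetry.Preserves.pow_mem_group {s : 𝒮.Symmetry} (hs : s.Preserves B Λ) (n : ℕ)
    {v : unitary (H →L[ℂ] H)} (hv : v ∈ Λ) : s.op ^ n * v * (s.op ^ n)⁻¹ ∈ Λ := by
  induction n with
  | zero => simpa using hv
  | succ n ih =>
    rw [pow_succ']
    simpa only [mul_inv_rev, mul_assoc] using hs.2 _ ih

theorem mem_of_weak_limit {𝒰 : Ultrafilter ℕ} {T : ℕ → H →L[ℂ] H} (hT : ∀ n, T n ∈ B)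
    {S : H →L[ℂ] H} (hS : ∀ x y, Filter.Tendsto (fun n => inner ℂ x (T n y)) 𝒰
      (nhds (inner ℂ x (S y)))) : S ∈ B := by
  refine mem_of_commutes_commutant fun R hR => ?_
  ext1 y
  refine ext_inner_left ℂ fun x => ?_
  change inner ℂ x (R (S y)) = inner ℂ x (S (R y))
  rw [← inner_star_left]
  refine tendsto_nhds_unique (hS (star R x) y) ?_
  refine (hS x (R y)).congr fun n => ?_
  rw [inner_star_left]
  exact congrArg _ (DFunLike.congr_fun (hR _ (hT n)) y)

/-- The expectation onto the fixed points of a symmetry preserves `B`: it is a weak limit of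
conjugates by powers of the symmetry. -/
theorem Symmetry.Preserves.exists_fixed_part {s : 𝒮.Symmetry} (hs : s.Preserves B Λ)
    (hfree : s.FreeOffFixed) {b : H →L[ℂ] H} (hb : b ∈ B) :
    ∃ c ∈ B, (∀ i, s.perm i = i → inner ℂ (𝒮.basis i) (c 𝒮.vac) = inner ℂ (𝒮.basis i) (b 𝒮.vac)) ∧
      ∀ i, s.perm i ≠ i → inner ℂ (𝒮.basis i) (c 𝒮.vac) = 0 := by
  set T : ℕ → H →L[ℂ] H := fun n =>
    (s.op ^ n : unitary (H →L[ℂ] H)).1 * b * star (s.op ^ n : unitary (H →L[ℂ] H)).1 with hT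
  have hnorm : ∀ n, ‖T n‖ ≤ ‖b‖ := fun n => by
    rw [hT]
    simp only [← Unitary.coe_star]
    rw [CStarRing.norm_mul_coe_unitary, CStarRing.norm_coe_unitary_mul]
  obtain ⟨c, hc⟩ := exists_weak_limit (Filter.hyperfilter ℕ) T ‖b‖ hnorm
  have hcoef : ∀ i n, inner ℂ (𝒮.basis ((s.perm ^ n) i)) (T n 𝒮.vac) =
      inner ℂ (𝒮.basis i) (b 𝒮.vac) := fun i n => by
    rw [hT, s.conj_pow_vac, ← s.pow_basis, unitary_inner_map]
  refine ⟨c, mem_of_weak_limit (fun n => hs.pow_mem n hb) hc, fun i hi => ?_, fun i hi => ?_⟩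
  · refine tendsto_nhds_unique (hc _ _) (tendsto_const_nhds.congr fun n => ?_)
    have h1 : (s.perm ^ n) i = i := by
      induction n with
      | zero => rfl
      | succ n ih => rw [pow_succ']; change s.perm ((s.perm ^ n) i) = i; rw [ih, hi]
    rw [← hcoef i n, h1]
  · refine tendsto_nhds_unique (hc _ _) ?_
    have hinj : Function.Injective fun n : ℕ => (s.perm ^ n)⁻¹ i := by
      intro m n hmn
      refine hfree i hi ?_
      have h1 : i = (s.perm ^ m) ((s.perm ^ n)⁻¹ i) := by
        have h0 : (s.perm ^ m)⁻¹ i = (s.perm ^ n)⁻¹ i := hmn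
        rw [← h0]
        exact (MulAut.apply_inv_self _ (s.perm ^ m) i).symm
      have h2 : (s.perm ^ n) i = (s.perm ^ m) i := by
        conv_lhs => rw [h1]
        rw [← MulAut.mul_apply, (Commute.pow_pow_self s.perm n m).eq, MulAut.mul_apply,
          MulAut.apply_inv_self]
      exact h2.symm
    have h3 := tendsto_inner_zero_of_orthonormal 𝒮.basis.orthonormal (b 𝒮.vac) hinj
    have h4 : (Filter.hyperfilter ℕ : Filter ℕ) ≤ Filter.atTop := by
      rw [← Nat.cofinite_eq_atTop]; exact Filter.hyperfilter_le_cofinite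
    refine (h3.mono_left h4).congr fun n => ?_
    rw [← hcoef _ n, MulAut.apply_inv_self]

/-- `A` is the set of common fixed points of a finite family of symmetries that preserve `(B, Λ)`
and have no nontrivial finite orbits. -/
structure IsFixedSubgroup (B : VonNeumannAlgebra H) (Λ : Subgroup (unitary (H →L[ℂ] H)))
    (E : List 𝒮.Symmetry) (A : Subgroup I) : Prop where
  preserves : ∀ s ∈ E, s.Preserves B Λ
  free : ∀ s ∈ E, s.FreeOffFixed
  mem_iff : ∀ i, i ∈ A ↔ ∀ s ∈ E, s.perm i = i

/-- If `A` is a fixed point subgroup, then the expectation onto `alg A` preserves `B`. -/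
theorem IsFixedSubgroup.exists_expectation {E : List 𝒮.Symmetry} {A : Subgroup I}
    (hA : IsFixedSubgroup B Λ E A) (hG : 𝒮.IsGMS B Λ) {b : H →L[ℂ] H} (hb : b ∈ B) :
    ∃ c ∈ B, c ∈ 𝒮.alg A ∧ c 𝒮.vac = (𝒮.supp A).starProjection (b 𝒮.vac) := by
  classical
  have key : ∀ F : List 𝒮.Symmetry, (∀ s ∈ F, s.Preserves B Λ ∧ s.FreeOffFixed) →
      ∃ c ∈ B, ∀ i, inner ℂ (𝒮.basis i) (c 𝒮.vac) =
        if ∀ s ∈ F, s.perm i = i then inner ℂ (𝒮.basis i) (b 𝒮.vac) else 0 := by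
    intro F
    induction F with
    | nil => exact fun _ => ⟨b, hb, fun i => by simp⟩
    | cons s F ih =>
      intro hF
      obtain ⟨c, hc, h⟩ := ih fun t ht => hF t (List.mem_cons_of_mem _ ht)
      obtain ⟨hs, hs'⟩ := hF s List.mem_cons_self
      obtain ⟨d, hd, h1, h2⟩ := hs.exists_fixed_part hs' hc
      refine ⟨d, hd, fun i => ?_⟩
      by_cases hi : s.perm i = i
      · rw [h1 i hi, h i]
        simp [hi]
      · rw [h2 i hi]
        simp [hi]
  obtain ⟨c, hc, h⟩ := key E fun s hs => ⟨hA.preserves s hs, hA.free s hs⟩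
  refine ⟨c, hc, mem_alg_iff.2 ⟨hG.isLeft_of_mem hc, fun i hi => ?_⟩, 𝒮.ext_inner fun i => ?_⟩
  · rw [h, if_neg]
    exact fun h' => hi ((hA.mem_iff i).2 h')
  · rw [inner_proj_supp, h]
    exact if_congr (hA.mem_iff i).symm rfl rfl

/-- An element of `Λ` outside `alg A` is orthogonal to `supp A`, because a symmetry that fixes
`A` moves it through infinitely many elements of `Λ`. -/
theorem IsFixedSubgroup.inner_eq_zero {E : List 𝒮.Symmetry} {A : Subgroup I}
    (hA : IsFixedSubgroup B Λ E A) (hG : 𝒮.IsGMS B Λ) {v : unitary (H →L[ℂ] H)} (hv : v ∈ Λ)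
    (hvA : (v : H →L[ℂ] H) ∉ 𝒮.alg A) {b : H →L[ℂ] H} (hb : b ∈ B) {i : I} (hi : i ∈ A) :
    inner ℂ ((v : H →L[ℂ] H) (b 𝒮.vac)) (𝒮.basis i) = 0 := by
  obtain ⟨j, hj, hj'⟩ : ∃ j ∉ A, inner ℂ (𝒮.basis j) ((v : H →L[ℂ] H) 𝒮.vac) ≠ 0 := by
    by_contra! h
    exact hvA (mem_alg_iff.2 ⟨hG.isLeft_of_mem_group hv, h⟩)
  obtain ⟨s, hsE, hsj⟩ : ∃ s ∈ E, s.perm j ≠ j := by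
    by_contra! h
    exact hj ((hA.mem_iff j).2 h)
  have hs := hA.preserves s hsE
  set w : ℕ → unitary (H →L[ℂ] H) := fun n => s.op ^ n * v * (s.op ^ n)⁻¹ with hw
  have hw1 : ∀ n, (w n : H →L[ℂ] H) = (s.op ^ n : unitary (H →L[ℂ] H)).1 * v *
      star (s.op ^ n : unitary (H →L[ℂ] H)).1 := fun n => rfl
  -- if `v` were fixed by a power of `s`, then its nonzero coefficient at `j` would occur at
  -- infinitely many indices
  have hperiod : ∀ k, 0 < k → w k ≠ v := by
    intro k hk hkv
    have hcomm : Commute (s.op ^ k) v := by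
      have : s.op ^ k * v * (s.op ^ k)⁻¹ = v := hkv
      exact mul_inv_eq_iff_eq_mul.1 this
    have hall : ∀ n, w (k * n) = v := fun n => by
      rw [hw]
      simp only [pow_mul]
      rw [(hcomm.pow_left n).eq, mul_inv_cancel_right]
    have hinj : Function.Injective fun n : ℕ => (s.perm ^ (k * n)) j := fun m n hmn =>
      Nat.eq_of_mul_eq_mul_left hk (hA.free s hsE j hsj hmn)
    have h1 := tendsto_inner_zero_of_orthonormal 𝒮.basis.orthonormal ((v : H →L[ℂ] H) 𝒮.vac) hinj
    have h2 : ∀ n, inner ℂ (𝒮.basis ((s.perm ^ (k * n)) j)) ((v : H →L[ℂ] H) 𝒮.vac) =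
        inner ℂ (𝒮.basis j) ((v : H →L[ℂ] H) 𝒮.vac) := fun n => by
      conv_lhs => rw [← hall n, hw1, s.conj_pow_vac, ← s.pow_basis, unitary_inner_map]
    exact hj' (tendsto_nhds_unique (tendsto_const_nhds.congr fun n => (h2 n).symm) h1)
  have hlt : ∀ m n, m < n → w m ≠ w n := by
    intro m n hmn h
    refine hperiod (n - m) (Nat.sub_pos_of_lt hmn) ?_
    obtain ⟨k, rfl⟩ := Nat.exists_eq_add_of_lt hmn
    have h' : s.op ^ m * v * (s.op ^ m)⁻¹ =
      s.op ^ (m + (k + 1)) * v * (s.op ^ (m + (k + 1)))⁻¹ := h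
    rw [pow_add s.op m, mul_inv_rev] at h'
    have h'' : s.op ^ m * v * (s.op ^ m)⁻¹ =
      s.op ^ m * (s.op ^ (k + 1) * v * (s.op ^ (k + 1))⁻¹) * (s.op ^ m)⁻¹ := by
      rw [h']; group
    have h3 := mul_left_cancel (mul_right_cancel h'')
    rw [show m + k + 1 - m = k + 1 by omega]
    exact h3.symm
  have hne : ∀ m n, m ≠ n → w m ≠ w n := fun m n hmn =>
    (lt_or_gt_of_ne hmn).elim (hlt m n) fun h => (hlt n m h).symm
  have hz : ∀ n, (s.op ^ n : unitary (H →L[ℂ] H)).1 ((v : H →L[ℂ] H) (b 𝒮.vac)) =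
      (w n : H →L[ℂ] H) (((s.op ^ n : unitary (H →L[ℂ] H)).1 * b *
        star (s.op ^ n : unitary (H →L[ℂ] H)).1) 𝒮.vac) := fun n => by
    rw [s.conj_pow_vac, hw1]
    change _ = (s.op ^ n : unitary (H →L[ℂ] H)).1 ((v : H →L[ℂ] H)
      (star (s.op ^ n : unitary (H →L[ℂ] H)).1 ((s.op ^ n : unitary (H →L[ℂ] H)).1 (b 𝒮.vac))))
    rw [unitary_star_apply]
  -- the images of `v b vac` under the powers of `s` lie in the orthogonal subspaces `w n B vac`,
  -- and they all have the same inner product with the fixed vector `basis i`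
  refine inner_eq_zero_of_orthogonal_sequence (r := ‖(v : H →L[ℂ] H) (b 𝒮.vac)‖)
    (z := fun n => (s.op ^ n : unitary (H →L[ℂ] H)).1 ((v : H →L[ℂ] H) (b 𝒮.vac)))
    (y := 𝒮.basis i) (fun m n hmn => ?_) (fun n => unitary_norm_map _ _) fun n => ?_
  · simp only [hz]
    exact hG.inner_eq_zero (hs.pow_mem_group m hv) (hs.pow_mem_group n hv) (hne m n hmn)
      (hs.pow_mem m hb) (hs.pow_mem n hb)
  · have h1 : (s.perm ^ n) i = i := by
      induction n with
      | zero => rfl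
      | succ n ih =>
        rw [pow_succ']
        change s.perm ((s.perm ^ n) i) = i
        rw [ih, (hA.mem_iff i).1 hi s hsE]
    conv_lhs => rw [← h1]
    rw [← s.pow_basis, unitary_inner_map]

/-- If `A` is a fixed point subgroup, then the part of the decomposition inside `alg A`
is total in `supp A`. -/
theorem IsFixedSubgroup.basis_mem_hull {E : List 𝒮.Symmetry} {A : Subgroup I}
    (hA : IsFixedSubgroup B Λ E A) (hG : 𝒮.IsGMS B Λ) {i : I} (hi : i ∈ A) :
    𝒮.basis i ∈ 𝒮.hull {x | ∃ v ∈ Λ, (v : H →L[ℂ] H) ∈ 𝒮.alg A ∧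
      ∃ b ∈ B, b ∈ 𝒮.alg A ∧ x = (v : H →L[ℂ] H) * b} := by
  set X := {x | ∃ v ∈ Λ, (v : H →L[ℂ] H) ∈ 𝒮.alg A ∧ ∃ b ∈ B, x = (v : H →L[ℂ] H) * b} with hX
  have h1 : 𝒮.basis i ∈ 𝒮.hull X := by
    have h2 : 𝒮.basis i - (𝒮.hull X).starProjection (𝒮.basis i) = 0 := by
      rw [← inner_self_eq_zero (𝕜 := ℂ)]
      refine inner_eq_zero_of_hull ?_ (hG.mem_hull _)
      rintro _ ⟨v, hv, b, hb, rfl⟩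
      change inner ℂ _ ((v : H →L[ℂ] H) (b 𝒮.vac)) = 0
      by_cases hvA : (v : H →L[ℂ] H) ∈ 𝒮.alg A
      · have h3 : (v : H →L[ℂ] H) (b 𝒮.vac) ∈ 𝒮.hull X :=
          apply_vac_mem_hull (x := (v : H →L[ℂ] H) * b) ⟨v, hv, hvA, b, hb, rfl⟩
        exact Submodule.inner_left_of_mem_orthogonal h3
          ((𝒮.hull X).sub_starProjection_mem_orthogonal _)
      · rw [← inner_conj_symm, inner_sub_right, hA.inner_eq_zero hG hv hvA hb hi,
          inner_eq_zero_of_hull (X := X) ?_ (Submodule.starProjection_apply_mem _ _), sub_zero,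
          map_zero]
        rintro _ ⟨w, hw, hwA, c, hc, rfl⟩
        refine hG.inner_eq_zero hv hw ?_ hb hc
        rintro rfl
        exact hvA hwA
    rw [sub_eq_zero] at h2
    rw [h2]
    exact Submodule.starProjection_apply_mem _ _
  rw [← Submodule.starProjection_eq_self_iff.2 (basis_mem_supp (𝒮 := 𝒮) (A := (A : Set I)) hi)]
  refine map_hull (isClosed_hull _) ?_ h1
  rintro _ ⟨v, hv, hvA, b, hb, rfl⟩
  obtain ⟨c, hc, hcA, hcb⟩ := hA.exists_expectation hG hb
  have h3 := DFunLike.congr_fun (proj_supp_commute_of_mem_alg hvA) (b 𝒮.vac)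
  change (v : H →L[ℂ] H) ((𝒮.supp A).starProjection (b 𝒮.vac)) =
    (𝒮.supp A).starProjection ((v : H →L[ℂ] H) (b 𝒮.vac)) at h3
  change (𝒮.supp A).starProjection ((v : H →L[ℂ] H) (b 𝒮.vac)) ∈ _
  rw [← h3, ← hcb]
  exact apply_vac_mem_hull (x := (v : H →L[ℂ] H) * c) ⟨v, hv, hvA, c, hc, hcA, rfl⟩

end TwistedSystem

end Decomposition

/-! ### Two commuting copies of a group and the diagonal symmetry -/

section Corner

variable {I H L : Type*} [CommGroup I] [NormedAddCommGroup H] [InnerProductSpace ℂ H]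
  [CompleteSpace H] [CommGroup L]

namespace TwistedSystem

variable {𝒮 : TwistedSystem I H}

theorem alg_commute_of_commute {A A' : Set I}
    (h : ∀ i ∈ A, ∀ j ∈ A', 𝒮.U i * 𝒮.U j = 𝒮.U j * 𝒮.U i) {x y : H →L[ℂ] H}
    (hx : x ∈ 𝒮.alg A) (hy : y ∈ 𝒮.alg A') : x * y = y * x := by
  refine (mem_generatedBy_of_unitary (unitary_image_U A')).1 hy x ?_
  rintro _ ⟨j, hj, rfl⟩
  refine (mem_generatedBy_of_unitary (unitary_image_U A)).1 hx _ ?_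
  rintro _ ⟨i, hi, rfl⟩
  exact h i hi j hj

variable (𝒮) in
/-- Two embeddings `j₁`, `j₂` of a group `L` in the index group with commuting independent
ranges, both of which are fixed point subgroups for symmetries of `(B, Λ)`, together with a
symmetry `diag` sending `j₁ g` to `j₁ g * j₂ g` (it acts as the comultiplication of the group von
Neumann algebra of `L`) and a symmetry `flip` sending `j₁ g` to `j₂ g`. -/
structure Corner (B : VonNeumannAlgebra H) (Λ : Subgroup (unitary (H →L[ℂ] H)))
    (j₁ j₂ : L →* I) where
  /-- Symmetries whose common fixed points are the range of `j₁`. -/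
  E₁ : List 𝒮.Symmetry
  /-- Symmetries whose common fixed points are the range of `j₂`. -/
  E₂ : List 𝒮.Symmetry
  fixed₁ : IsFixedSubgroup B Λ E₁ j₁.range
  fixed₂ : IsFixedSubgroup B Λ E₂ j₂.range
  /-- The diagonal symmetry. -/
  diag : 𝒮.Symmetry
  /-- The flip. -/
  flip : 𝒮.Symmetry
  diag_preserves : diag.Preserves B Λ
  flip_preserves : flip.Preserves B Λ
  diag_perm : ∀ g, diag.perm (j₁ g) = j₁ g * j₂ g
  flip_perm : ∀ g, flip.perm (j₁ g) = j₂ g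
  U_mul : ∀ g h, 𝒮.U (j₁ g) * 𝒮.U (j₂ h) = 𝒮.U (j₁ g * j₂ h)
  U_mul' : ∀ g h, 𝒮.U (j₂ h) * 𝒮.U (j₁ g) = 𝒮.U (j₁ g * j₂ h)
  inj : ∀ g h g' h', j₁ g * j₂ h = j₁ g' * j₂ h' → g = g' ∧ h = h'

namespace Corner

variable {B : VonNeumannAlgebra H} {Λ : Subgroup (unitary (H →L[ℂ] H))} {j₁ j₂ : L →* I}
  (C : 𝒮.Corner B Λ j₁ j₂)

include C

theorem commute {x y : H →L[ℂ] H} (hx : x ∈ 𝒮.alg j₁.range) (hy : y ∈ 𝒮.alg j₂.range) :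
    x * y = y * x := by
  refine alg_commute_of_commute ?_ hx hy
  rintro _ ⟨g, rfl⟩ _ ⟨h, rfl⟩
  rw [C.U_mul, C.U_mul']

theorem basis_mul (g h : L) : 𝒮.basis (j₁ g * j₂ h) = 𝒮.U (j₂ h) (𝒮.basis (j₁ g)) := by
  rw [← 𝒮.left_base, ← 𝒮.left_base (j₁ g)]
  exact (DFunLike.congr_fun (C.U_mul' g h) 𝒮.vac).symm

/-- Slicing at `j₂ h` in the second leg. -/
theorem slice {x : H →L[ℂ] H} (hx : x ∈ 𝒮.alg j₁.range) {y : H} (hy : y ∈ 𝒮.supp j₂.range) (h : L) :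
    (𝒮.supp j₁.range).starProjection (star (𝒮.U (j₂ h)) (x y)) =
      inner ℂ (𝒮.basis (j₂ h)) y • x 𝒮.vac := by
  classical
  have h1 : star (𝒮.U (j₂ h)) (x y) = x (star (𝒮.U (j₂ h)) y) :=
    (DFunLike.congr_fun (C.commute hx (star_mem (U_mem_alg (Set.mem_range_self h)))) y).symm
  have h2 : (𝒮.supp j₁.range).starProjection (star (𝒮.U (j₂ h)) y) =
      inner ℂ (𝒮.basis (j₂ h)) y • 𝒮.vac := by
    refine 𝒮.ext_inner fun i => ?_
    rw [inner_proj_supp, inner_smul_right, 𝒮.inner_basis]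
    split_ifs with hi h1i h1i
    · rw [h1i, inner_star_right, mul_one]
      congr 1
      exact 𝒮.left_base _
    · obtain ⟨g, rfl⟩ := hi
      rw [inner_star_right, ← C.basis_mul, mul_zero]
      refine hy _ ?_
      rintro ⟨h', hh'⟩
      have := (C.inj 1 h' g h (by rw [map_one, one_mul, hh'])).1
      rw [← this, map_one] at h1i
      exact h1i rfl
    · exact absurd (h1i ▸ j₁.range.one_mem) hi
    · rw [mul_zero]
  have h3 := DFunLike.congr_fun (proj_supp_commute_of_mem_alg hx) (star (𝒮.U (j₂ h)) y)
  change x ((𝒮.supp j₁.range).starProjection _) = (𝒮.supp j₁.range).starProjection (x _) at h3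
  rw [h1]
  refine h3.symm.trans ?_
  rw [h2, map_smul]

theorem inner_basis_mul {x : H →L[ℂ] H} (hx : x ∈ 𝒮.alg j₁.range) {y : H}
    (hy : y ∈ 𝒮.supp j₂.range) (g h : L) :
    inner ℂ (𝒮.basis (j₁ g * j₂ h)) (x y) =
      inner ℂ (𝒮.basis (j₂ h)) y * inner ℂ (𝒮.basis (j₁ g)) (x 𝒮.vac) := by
  classical
  rw [C.basis_mul, ← inner_star_right, ← inner_smul_right, ← C.slice hx hy, inner_proj_supp,
    if_pos (show j₁ g ∈ (j₁.range : Set I) from ⟨g, rfl⟩)]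

/-- The products of the parts of the decomposition in the two legs are total. -/
theorem basis_mul_mem_hull (hG : 𝒮.IsGMS B Λ) (g h : L) :
    𝒮.basis (j₁ g * j₂ h) ∈ 𝒮.hull {x | ∃ v ∈ Λ, (v : H →L[ℂ] H) ∈ 𝒮.alg j₁.range ∧
      ∃ b ∈ B, b ∈ 𝒮.alg j₁.range ∧ ∃ w ∈ Λ, (w : H →L[ℂ] H) ∈ 𝒮.alg j₂.range ∧
      ∃ c ∈ B, c ∈ 𝒮.alg j₂.range ∧ x = (v : H →L[ℂ] H) * b * (w * c)} := by
  rw [C.basis_mul]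
  refine map_hull (isClosed_hull _) ?_ (C.fixed₁.basis_mem_hull hG (i := j₁ g) ⟨g, rfl⟩)
  rintro _ ⟨v, hv, hv1, b, hb, hb1, rfl⟩
  have h1 : 𝒮.U (j₂ h) (((v : H →L[ℂ] H) * b) 𝒮.vac) =
      ((v : H →L[ℂ] H) * b) (𝒮.basis (j₂ h)) := by
    rw [← 𝒮.left_base (j₂ h)]
    exact (DFunLike.congr_fun (C.commute (mul_mem hv1 hb1)
      (U_mem_alg (Set.mem_range_self h))) 𝒮.vac).symm
  rw [h1]
  refine map_hull (isClosed_hull _) ?_ (C.fixed₂.basis_mem_hull hG (i := j₂ h) ⟨h, rfl⟩)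
  rintro _ ⟨w, hw, hw1, c, hc, hc1, rfl⟩
  exact apply_vac_mem_hull (x := v.1 * b * (w.1 * c))
    ⟨v, hv, hv1, b, hb, hb1, w, hw, hw1, c, hc, hc1, rfl⟩

theorem diag_coeff (x : H →L[ℂ] H) (hx : x 𝒮.vac ∈ 𝒮.supp j₁.range) (g h : L) [Decidable (g = h)] :
    inner ℂ (𝒮.basis (j₁ g * j₂ h)) (C.diag.op.1 (x 𝒮.vac)) =
      if g = h then inner ℂ (𝒮.basis (j₁ g)) (x 𝒮.vac) else 0 := by
  split_ifs with hgh
  · rw [← hgh, ← C.diag_perm, ← C.diag.op_basis, unitary_inner_map]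
  · rw [← MulAut.apply_inv_self _ C.diag.perm (j₁ g * j₂ h), ← C.diag.op_basis, unitary_inner_map]
    refine hx _ ?_
    rintro ⟨k, hk⟩
    have h1 := congrArg C.diag.perm hk
    rw [C.diag_perm, MulAut.apply_inv_self] at h1
    obtain ⟨h2, h3⟩ := C.inj _ _ _ _ h1
    exact hgh (h2.symm.trans h3)

theorem diag_apply_mem_hull (hG : 𝒮.IsGMS B Λ) {x : H →L[ℂ] H}
    (hx : x 𝒮.vac ∈ 𝒮.supp j₁.range) :
    C.diag.op.1 (x 𝒮.vac) ∈ 𝒮.hull {x | ∃ v ∈ Λ, (v : H →L[ℂ] H) ∈ 𝒮.alg j₁.range ∧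
      ∃ b ∈ B, b ∈ 𝒮.alg j₁.range ∧ ∃ w ∈ Λ, (w : H →L[ℂ] H) ∈ 𝒮.alg j₂.range ∧
      ∃ c ∈ B, c ∈ 𝒮.alg j₂.range ∧ x = (v : H →L[ℂ] H) * b * (w * c)} := by
  refine map_supp_of_basis (isClosed_hull _) ?_ hx
  rintro _ ⟨g, rfl⟩
  rw [C.diag.op_basis, C.diag_perm]
  exact C.basis_mul_mem_hull hG g g

omit C in
theorem eq_smul_U {A : Subgroup I} {x : H →L[ℂ] H} (hx : x ∈ 𝒮.alg A) {r : I}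
    (h : ∀ i ∈ A, i ≠ r → inner ℂ (𝒮.basis i) (x 𝒮.vac) = 0) :
    x = inner ℂ (𝒮.basis r) (x 𝒮.vac) • 𝒮.U r := by
  classical
  refine (isLeft_of_mem_alg hx).ext ((𝒮.isLeft_U r).smul _) (𝒮.ext_inner fun i => ?_)
  change _ = inner ℂ (𝒮.basis i) (inner ℂ (𝒮.basis r) (x 𝒮.vac) • 𝒮.U r 𝒮.vac)
  rw [inner_smul_right, show 𝒮.U r 𝒮.vac = 𝒮.basis r from 𝒮.left_base r, 𝒮.inner_basis]
  split_ifs with hi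
  · rw [hi, mul_one]
  · rw [mul_zero]
    by_cases hiA : i ∈ A
    · exact h i hiA hi
    · exact (mem_alg_iff.1 hx).2 i hiA

/-- The elements of `Λ` in the first leg are canonical unitaries: they are group-like for the
comultiplication. -/
theorem exists_eq_U (hG : 𝒮.IsGMS B Λ) {v : unitary (H →L[ℂ] H)} (hv : v ∈ Λ)
    (hv1 : (v : H →L[ℂ] H) ∈ 𝒮.alg j₁.range) : ∃ g, (v : H →L[ℂ] H) = 𝒮.U (j₁ g) := by
  classical
  set w := C.diag.op * v * C.diag.op⁻¹ with hw
  have hwΛ : w ∈ Λ := C.diag_preserves.2 v hv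
  have hwvac : (w : H →L[ℂ] H) 𝒮.vac = C.diag.op.1 ((v : H →L[ℂ] H) 𝒮.vac) := C.diag.conj_vac _
  -- the image `w` of `v` is a product of elements in the two legs, since otherwise it would be
  -- orthogonal to all the subspaces `v₁ B v₂ B vac`, which span
  obtain ⟨v₁, hv₁, hv₁A, v₂, hv₂, hv₂A, hwv⟩ : ∃ v₁ ∈ Λ, (v₁ : H →L[ℂ] H) ∈ 𝒮.alg j₁.range ∧
      ∃ v₂ ∈ Λ, (v₂ : H →L[ℂ] H) ∈ 𝒮.alg j₂.range ∧ w = v₁ * v₂ := by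
    by_contra! hne
    refine unitary_vac_ne_zero (𝒮 := 𝒮) w (inner_self_eq_zero (𝕜 := ℂ).1 ?_)
    refine inner_eq_zero_of_hull ?_ (hwvac ▸ C.diag_apply_mem_hull hG (mem_alg_iff.1 hv1).2)
    rintro _ ⟨v₁, hv₁, hv₁A, b, hb, -, v₂, hv₂, hv₂A, c, hc, -, rfl⟩
    have h1 : (v₁ : H →L[ℂ] H) * b * (v₂ * c) =
        (v₁ * v₂ : unitary (H →L[ℂ] H)).1 * (star v₂.1 * b * v₂.1 * c) := by
      rw [Submonoid.coe_mul]
      simp only [← mul_assoc]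
      rw [mul_assoc v₁.1 v₂.1, (Unitary.mem_iff.1 v₂.2).2, mul_one]
    rw [h1]
    have h2 := hG.inner_eq_zero hwΛ (Λ.mul_mem hv₁ hv₂) (hne v₁ hv₁ hv₁A v₂ hv₂ hv₂A)
      (one_mem B) (mul_mem (hG.conj_mem hv₂ hb) hc)
    exact h2
  -- the coefficients of `w` are carried by the diagonal, and those of `v₁ v₂` form a matrix of
  -- rank one, so that there is only one nonzero coefficient
  have hcoef : ∀ g h, (if g = h then inner ℂ (𝒮.basis (j₁ g)) (v.1 𝒮.vac) else 0) =
      inner ℂ (𝒮.basis (j₂ h)) (v₂.1 𝒮.vac) * inner ℂ (𝒮.basis (j₁ g)) (v₁.1 𝒮.vac) := by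
    intro g h
    rw [← C.diag_coeff v.1 (mem_alg_iff.1 hv1).2, ← hwvac, hwv,
      ← C.inner_basis_mul hv₁A (mem_alg_iff.1 hv₂A).2]
    rfl
  obtain ⟨i, hi⟩ := 𝒮.exists_inner_ne_zero (unitary_vac_ne_zero (𝒮 := 𝒮) v)
  obtain ⟨r, rfl⟩ : i ∈ j₁.range := by
    by_contra h
    exact hi ((mem_alg_iff.1 hv1).2 i h)
  have hr := hcoef r r
  rw [if_pos rfl] at hr
  have h12 := hr ▸ hi
  have h1 : ∀ g, g ≠ r → inner ℂ (𝒮.basis (j₁ g)) (v₁.1 𝒮.vac) = 0 := fun g hg => by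
    have := hcoef g r
    rw [if_neg hg, eq_comm, mul_eq_zero] at this
    exact this.resolve_left (left_ne_zero_of_mul h12)
  have h2 : ∀ g, g ≠ r → inner ℂ (𝒮.basis (j₂ g)) (v₂.1 𝒮.vac) = 0 := fun g hg => by
    have := hcoef r g
    rw [if_neg hg.symm, eq_comm, mul_eq_zero] at this
    exact this.resolve_right (right_ne_zero_of_mul h12)
  have h0 : ∀ g, g ≠ r → inner ℂ (𝒮.basis (j₁ g)) (v.1 𝒮.vac) = 0 := fun g hg => by
    have := hcoef g g
    rw [if_pos rfl, h1 g hg, mul_zero] at this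
    exact this
  have e0 := eq_smul_U hv1 (r := j₁ r) (by rintro _ ⟨g, rfl⟩ hg; exact h0 g fun h => hg (h ▸ rfl))
  have e1 := eq_smul_U hv₁A (r := j₁ r) (by rintro _ ⟨g, rfl⟩ hg; exact h1 g fun h => hg (h ▸ rfl))
  have e2 := eq_smul_U hv₂A (r := j₂ r) (by rintro _ ⟨g, rfl⟩ hg; exact h2 g fun h => hg (h ▸ rfl))
  set a := inner ℂ (𝒮.basis (j₁ r)) (v.1 𝒮.vac)
  set a₁ := inner ℂ (𝒮.basis (j₁ r)) (v₁.1 𝒮.vac)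
  set a₂ := inner ℂ (𝒮.basis (j₂ r)) (v₂.1 𝒮.vac)
  -- proportional elements of `Λ` are equal, so that `a = a₁ = a₂`, whence `a = a * a`
  have f1 : v₁ = v := hG.eq_of_smul hv₁ hv (c := a₁ * a⁻¹) (by
    rw [e0, smul_smul, mul_assoc, inv_mul_cancel₀ hi, mul_one]; exact e1)
  have f2 : v₂ = C.flip.op * v * C.flip.op⁻¹ :=
    hG.eq_of_smul hv₂ (C.flip_preserves.2 v hv) (c := a₂ * a⁻¹) (by
      change v₂.1 = (a₂ * a⁻¹) • (C.flip.op.1 * v.1 * star C.flip.op.1)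
      rw [e0, mul_smul_comm, smul_mul_assoc, C.flip.op_U, C.flip_perm, smul_smul, mul_assoc,
        inv_mul_cancel₀ hi, mul_one]
      exact e2)
  have g1 : a₁ = a := by simp only [a₁, a, f1]
  have g2 : a₂ = a := by
    simp only [a₂, a, f2]
    change inner ℂ (𝒮.basis (j₂ r)) ((C.flip.op.1 * v.1 * star C.flip.op.1) 𝒮.vac) = _
    rw [C.flip.conj_vac, ← C.flip_perm, ← C.flip.op_basis, unitary_inner_map]
  have ha : a = 1 := by
    rw [g1, g2] at hr
    exact (mul_left_cancel₀ hi (hr.symm.trans (mul_one a).symm))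
  exact ⟨r, by rw [e0, ha, one_smul]⟩

/-- The canonical unitaries that occur in the expansion of an element of `B` in the first leg
belong to `B`: they are slices of the comultiplication of that element. -/
theorem U_mem_of_inner_ne_zero (hG : 𝒮.IsGMS B Λ) {b : H →L[ℂ] H} (hb : b ∈ B)
    (hb1 : b ∈ 𝒮.alg j₁.range) {r : L} (hr : inner ℂ (𝒮.basis (j₁ r)) (b 𝒮.vac) ≠ 0) :
    𝒮.U (j₁ r) ∈ B := by
  classical
  set X : Set (H →L[ℂ] H) := {x | ∃ b ∈ B, b ∈ 𝒮.alg j₁.range ∧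
    ∃ c ∈ B, c ∈ 𝒮.alg j₂.range ∧ x = b * c} with hX
  set y := C.diag.op.1 (b 𝒮.vac) with hy
  have hyB : y ∈ 𝒮.hull B := by
    rw [hy, ← C.diag.conj_vac]
    exact apply_vac_mem_hull (C.diag_preserves.1 b hb)
  -- the component of `y` orthogonal to `hull X` vanishes: it lies in `hull B`, hence is orthogonal
  -- to `v w B vac` for `v w ≠ 1`
  have hyX : y ∈ 𝒮.hull X := by
    set P := (𝒮.hull X).starProjection with hP
    have hzB : y - P y ∈ 𝒮.hull B := by
      refine Submodule.sub_mem _ hyB (?_ : P y ∈ 𝒮.hull B)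
      refine hull_le (isClosed_hull _) ?_ (Submodule.starProjection_apply_mem _ y)
      rintro _ ⟨b, hb, -, c, hc, -, rfl⟩
      exact apply_vac_mem_hull (X := (B : Set (H →L[ℂ] H))) (mul_mem hb hc)
    have hz : inner ℂ (y - P y) y = 0 := by
      refine inner_eq_zero_of_hull ?_ (C.diag_apply_mem_hull hG (mem_alg_iff.1 hb1).2)
      rintro _ ⟨v, hv, hvA, c, hc, hcA, w, hw, hwA, d, hd, hdA, rfl⟩
      have h1 : v.1 * c * (w.1 * d) = (v * w : unitary (H →L[ℂ] H)).1 * (c * d) := by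
        rw [Submonoid.coe_mul, mul_assoc, mul_assoc, ← mul_assoc c, C.commute hcA hwA, mul_assoc]
      rw [h1]
      by_cases hvw : v * w = 1
      · rw [hvw]
        have h2 : (c * d) 𝒮.vac ∈ 𝒮.hull X := apply_vac_mem_hull ⟨c, hc, hcA, d, hd, hdA, rfl⟩
        rw [Submonoid.coe_one, one_mul]
        exact Submodule.inner_left_of_mem_orthogonal h2
          ((𝒮.hull X).sub_starProjection_mem_orthogonal y)
      · rw [← inner_conj_symm, map_eq_zero]
        refine inner_eq_zero_of_hull ?_ hzB
        intro e he
        exact hG.inner_eq_zero (Λ.mul_mem hv hw) Λ.one_mem hvw (mul_mem hc hd) he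
    have h3 : inner ℂ (y - P y) (P y) = 0 :=
      Submodule.starProjection_inner_eq_zero _ _ (Submodule.starProjection_apply_mem _ y)
    have h4 : y - P y = 0 := by
      rw [← inner_self_eq_zero (𝕜 := ℂ), inner_sub_right, hz, h3, sub_zero]
    rw [sub_eq_zero] at h4
    rw [h4]
    exact Submodule.starProjection_apply_mem _ y
  -- slice `y` at `j₂ r` in the second leg
  have h1 : ((𝒮.supp j₁.range).starProjection * star (𝒮.U (j₂ r))) y ∈ 𝒮.hull B := by
    refine map_hull (isClosed_hull _) ?_ hyX
    rintro _ ⟨b, hb, hbA, c, hc, hcA, rfl⟩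
    change (𝒮.supp j₁.range).starProjection (star (𝒮.U (j₂ r)) (b (c 𝒮.vac))) ∈ _
    rw [C.slice hbA (mem_alg_iff.1 hcA).2]
    exact Submodule.smul_mem _ _ (apply_vac_mem_hull hb)
  have h2 : ((𝒮.supp j₁.range).starProjection * star (𝒮.U (j₂ r))) y =
      inner ℂ (𝒮.basis (j₁ r)) (b 𝒮.vac) • 𝒮.basis (j₁ r) := by
    refine 𝒮.ext_inner fun i => ?_
    change inner ℂ _ ((𝒮.supp j₁.range).starProjection (star (𝒮.U (j₂ r)) y)) = _
    rw [inner_proj_supp, inner_smul_right, 𝒮.inner_basis]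
    split_ifs with hi hir hir
    · rw [hir, inner_star_right, ← C.basis_mul, C.diag_coeff b (mem_alg_iff.1 hb1).2, if_pos rfl,
        mul_one]
    · obtain ⟨g, rfl⟩ := hi
      rw [inner_star_right, ← C.basis_mul, C.diag_coeff b (mem_alg_iff.1 hb1).2, if_neg, mul_zero]
      rintro rfl
      exact hir rfl
    · exact absurd ⟨r, hir.symm⟩ hi
    · rw [mul_zero]
  rw [h2] at h1
  refine hG.mem_of_vac_mem_hull (𝒮.isLeft_U _) ?_
  have h3 := Submodule.smul_mem _ (inner ℂ (𝒮.basis (j₁ r)) (b 𝒮.vac))⁻¹ h1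
  rw [smul_smul, inv_mul_cancel₀ hr, one_smul] at h3
  rw [show 𝒮.U (j₁ r) 𝒮.vac = 𝒮.basis (j₁ r) from 𝒮.left_base _]
  exact h3

/-- Each element of `L` is the product of elements whose canonical unitaries lie in `Λ` and
in `B`. -/
theorem exists_decomposition (hG : 𝒮.IsGMS B Λ) (g : L) :
    ∃ p q, g = p * q ∧ 𝒮.U (j₁ p) ∈ B ∧ 𝒮.left (j₁ q) ∈ Λ := by
  obtain ⟨v, hv, hvA, b, hb, hbA, hne⟩ : ∃ v ∈ Λ, (v : H →L[ℂ] H) ∈ 𝒮.alg j₁.range ∧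
      ∃ b ∈ B, b ∈ 𝒮.alg j₁.range ∧ inner ℂ (𝒮.basis (j₁ g)) (v.1 (b 𝒮.vac)) ≠ 0 := by
    by_contra! h
    refine 𝒮.basis_ne_zero (j₁ g) (inner_self_eq_zero (𝕜 := ℂ).1 ?_)
    refine inner_eq_zero_of_hull ?_ (C.fixed₁.basis_mem_hull hG (i := j₁ g) ⟨g, rfl⟩)
    rintro _ ⟨v, hv, hvA, b, hb, hbA, rfl⟩
    exact h v hv hvA b hb hbA
  obtain ⟨q, hq⟩ := C.exists_eq_U hG hv hvA
  refine ⟨q⁻¹ * g, q, by rw [mul_comm q⁻¹, inv_mul_cancel_right], ?_, ?_⟩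
  · refine C.U_mem_of_inner_ne_zero hG hb hbA fun h => hne ?_
    obtain ⟨c, hc⟩ := 𝒮.star_U_basis (j₁ q) (j₁ g)
    rw [hq, ← inner_star_left, hc, inner_smul_left, ← map_inv, ← map_mul, h, mul_zero]
  · convert hv using 1
    exact Subtype.ext hq.symm

end Corner

end TwistedSystem

end Corner

/-! ### Characters of the dual of a discrete abelian group -/

section Characters

theorem integral_circle_hom_eq_zero {K : Type*} [CommGroup K] [TopologicalSpace K]
    [IsTopologicalGroup K] [CompactSpace K] [MeasurableSpace K] [BorelSpace K]
    (ψ : K →* Circle) {x₀ : K} (hx₀ : ψ x₀ ≠ 1) : ∫ x, (ψ x : ℂ) ∂haarProb K = 0 := by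
  have h1 : ∫ x, (ψ (x₀ * x) : ℂ) ∂haarProb K = ∫ x, (ψ x : ℂ) ∂haarProb K :=
    integral_mul_left_eq_self (fun x => (ψ x : ℂ)) x₀
  simp only [map_mul, Circle.coe_mul] at h1
  rw [integral_const_mul] at h1
  have h2 : ((ψ x₀ : ℂ) - 1) * ∫ x, (ψ x : ℂ) ∂haarProb K = 0 := by
    rw [sub_mul, one_mul, h1, sub_self]
  refine (mul_eq_zero.1 h2).resolve_left fun h3 => hx₀ ?_
  exact Circle.ext (sub_eq_zero.1 h3)

/-- Characters separate the points of an abelian group, since `ℚ / ℤ` is injective and embeds in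
the circle. -/
theorem exists_monoidHom_circle_ne_one {A : Type*} [CommGroup A] {h : A} (hh : h ≠ 1) :
    ∃ x : A →* Circle, x h ≠ 1 := by
  obtain ⟨c, hc⟩ := CharacterModule.exists_character_apply_ne_zero_of_ne_zero
    (A := Additive A) (a := Additive.ofMul h) (by simpa using hh)
  let e : AddCircle (1 : ℚ) →+ AddCircle (1 : ℝ) :=
    QuotientAddGroup.map _ _ (Rat.castHom ℝ).toAddMonoidHom (by
      rw [AddSubgroup.zmultiples_le]
      exact ⟨1, by simp⟩)
  have he : Function.Injective e := by
    rw [injective_iff_map_eq_zero]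
    intro q
    induction q using QuotientAddGroup.induction_on with
    | H q =>
      intro hq
      have h1 : ((q : ℝ) : AddCircle (1 : ℝ)) = 0 := hq
      obtain ⟨n, hn⟩ := (AddCircle.coe_eq_zero_iff (1 : ℝ)).1 h1
      refine (AddCircle.coe_eq_zero_iff (1 : ℚ)).2 ⟨n, ?_⟩
      have h2 : ((n • (1 : ℚ) : ℚ) : ℝ) = (q : ℝ) := by rw [← hn]; simp
      exact_mod_cast h2
  refine ⟨{ toFun := fun a => AddCircle.toCircle (e (c (Additive.ofMul a)))
            map_one' := by rw [ofMul_one, map_zero, map_zero, AddCircle.toCircle_zero]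
            map_mul' := fun a b => by
              rw [ofMul_mul, map_add, map_add, AddCircle.toCircle_add] }, fun h1 => hc ?_⟩
  apply he
  apply AddCircle.injective_toCircle (T := (1 : ℝ)) one_ne_zero
  rw [map_zero, AddCircle.toCircle_zero]
  exact h1

variable {A : Type*} [CommGroup A] [TopologicalSpace A] [DiscreteTopology A]

theorem exists_dual_apply_ne_one {h : A} (hh : h ≠ 1) : ∃ x : PontryaginDual A, x h ≠ 1 := by
  obtain ⟨x, hx⟩ := exists_monoidHom_circle_ne_one hh
  exact ⟨{ toMonoidHom := x, continuous_toFun := continuous_of_discreteTopology }, hx⟩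

omit [DiscreteTopology A] in
theorem continuous_evalAt (h : A) : Continuous (evalAt h) :=
  (continuous_eval_const (F := C(A, Circle)) h).comp
    (ContinuousMonoidHom.isInducing_toContinuousMap A Circle).continuous

theorem integral_eval (h : A) [Decidable (h = 1)] :
    ∫ x : PontryaginDual A, (x h : ℂ) ∂haarProb (PontryaginDual A) = if h = 1 then 1 else 0 := by
  split_ifs with hh
  · simp [hh]
  · obtain ⟨x, hx⟩ := exists_dual_apply_ne_one hh
    exact integral_circle_hom_eq_zero (evalAt h) hx

/-- Evaluation at `h`, as a continuous function on the dual group. -/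
def evalFun (h : A) : C(PontryaginDual A, ℂ) :=
  ⟨fun x => (x h : ℂ), continuous_subtype_val.comp (continuous_evalAt h)⟩

variable (A) in
/-- The star algebra of trigonometric polynomials on the dual group. -/
def trigPolynomials : StarSubalgebra ℂ C(PontryaginDual A, ℂ) where
  toSubalgebra := Algebra.adjoin ℂ (Set.range evalFun)
  star_mem' := by
    change Algebra.adjoin ℂ (Set.range (evalFun (A := A))) ≤
      star (Algebra.adjoin ℂ (Set.range (evalFun (A := A))))
    refine Algebra.adjoin_le ?_
    rintro - ⟨h, rfl⟩
    refine Algebra.subset_adjoin ⟨h⁻¹, ContinuousMap.ext fun x => ?_⟩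
    change ((x h⁻¹ : Circle) : ℂ) = starRingEnd ℂ (x h : ℂ)
    rw [map_inv, Circle.coe_inv_eq_conj]

theorem trigPolynomials_toSubmodule :
    Subalgebra.toSubmodule (trigPolynomials A).toSubalgebra =
      Submodule.span ℂ (Set.range evalFun) := by
  apply Algebra.adjoin_eq_span_of_subset
  refine Set.Subset.trans ?_ Submodule.subset_span
  intro f hf
  refine Submonoid.closure_induction (fun _ => id) ⟨1, ?_⟩ ?_ hf
  · ext x
    change ((x 1 : Circle) : ℂ) = 1
    rw [map_one, Circle.coe_one]
  · rintro - - - - ⟨g, rfl⟩ ⟨h, rfl⟩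
    refine ⟨g * h, ?_⟩
    ext x
    change ((x (g * h) : Circle) : ℂ) = (x g : ℂ) * (x h : ℂ)
    rw [map_mul, Circle.coe_mul]

theorem span_evalFun_closure : (Submodule.span ℂ (Set.range (evalFun (A := A)))).topologicalClosure
    = ⊤ := by
  have hsep : (trigPolynomials A).SeparatesPoints := by
    intro x y hxy
    obtain ⟨h, hh⟩ := DFunLike.ne_iff.1 hxy
    exact ⟨_, ⟨evalFun h, Algebra.subset_adjoin ⟨h, rfl⟩, rfl⟩, fun h' => hh (Circle.ext h')⟩
  rw [← trigPolynomials_toSubmodule]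
  exact congr_arg (Subalgebra.toSubmodule <| StarSubalgebra.toSubalgebra ·)
    (ContinuousMap.starSubalgebra_topologicalClosure_eq_top_of_separatesPoints _ hsep)

instance : (haarProb (PontryaginDual A)).Regular := by unfold haarProb; infer_instance

/-- A square integrable function on the dual group all of whose Fourier coefficients vanish
is zero. -/
theorem ae_eq_zero_of_integral_eval {f : PontryaginDual A → ℂ}
    (hf : MemLp f 2 (haarProb (PontryaginDual A)))
    (h0 : ∀ h : A, ∫ x, (x h : ℂ) * f x ∂haarProb (PontryaginDual A) = 0) :
    f =ᵐ[haarProb (PontryaginDual A)] 0 := by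
  let T := ContinuousMap.toLp (E := ℂ) 2 (haarProb (PontryaginDual A)) ℂ
  have h1 : ∀ h : A, inner ℂ (hf.toLp f) (T (evalFun h)) = 0 := by
    intro h
    rw [← inner_conj_symm, L2.inner_def, map_eq_zero, ← h0 h⁻¹]
    refine integral_congr_ae ?_
    filter_upwards [hf.coeFn_toLp, ContinuousMap.coeFn_toLp (E := ℂ) (p := 2) (𝕜 := ℂ)
      (haarProb (PontryaginDual A)) (evalFun h)] with x hx1 hx2
    rw [hx1, hx2, RCLike.inner_apply, map_inv, Circle.coe_inv_eq_conj, mul_comm]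
    rfl
  have h2 : ∀ g, inner ℂ (hf.toLp f) (T g) = 0 := by
    have h3 : (⊤ : Submodule ℂ C(PontryaginDual A, ℂ)) ≤
        (((Submodule.span ℂ {hf.toLp f})ᗮ).comap T.toLinearMap) := by
      rw [← span_evalFun_closure]
      refine Submodule.topologicalClosure_minimal _ (Submodule.span_le.2 ?_)
        ((Submodule.isClosed_orthogonal _).preimage T.continuous)
      rintro _ ⟨h, rfl⟩
      exact Submodule.mem_orthogonal_singleton_iff_inner_right.2 (h1 h)
    exact fun g => Submodule.mem_orthogonal_singleton_iff_inner_right.1 (h3 trivial)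
  have h4 : hf.toLp f = 0 := by
    rw [← inner_self_eq_zero (𝕜 := ℂ)]
    have hd := ContinuousMap.toLp_denseRange ℂ (haarProb (PontryaginDual A)) ℂ
      (p := 2) (by norm_num)
    exact hd.induction_on (p := fun y => inner ℂ (hf.toLp f) y = 0) (hf.toLp f)
      (isClosed_eq (innerSL ℂ (hf.toLp f)).continuous continuous_const) h2
  exact (hf.toLp_eq_toLp_iff (MemLp.zero' (ε := ℂ))).1 (h4.trans (MemLp.toLp_zero _).symm)

/-- Pontryagin duality for discrete groups: a continuous character of the dual group is the
evaluation at a point. -/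
theorem exists_eq_eval (φ : PontryaginDual A →* Circle) (hφ : Continuous φ) :
    ∃ h : A, ∀ x, φ x = x h := by
  by_contra! hne
  have hc : Continuous fun x => (((φ x)⁻¹ : Circle) : ℂ) :=
    continuous_subtype_val.comp hφ.inv
  have hf : MemLp (fun x => (((φ x)⁻¹ : Circle) : ℂ)) 2 (haarProb (PontryaginDual A)) :=
    MemLp.of_bound hc.aestronglyMeasurable 1
      (Filter.Eventually.of_forall fun x => by rw [Circle.norm_coe])
  have h0 := ae_eq_zero_of_integral_eval hf fun h => by
    obtain ⟨x, hx⟩ := hne h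
    have h1 := integral_circle_hom_eq_zero (evalAt h * φ⁻¹) (x₀ := x) (by
      change x h * (φ x)⁻¹ ≠ 1
      rw [Ne, mul_inv_eq_one]
      exact hx.symm)
    refine Eq.trans ?_ h1
    refine integral_congr_ae (Filter.Eventually.of_forall fun x => ?_)
    exact (Circle.coe_mul _ _).symm
  obtain ⟨x, hx⟩ := h0.exists
  exact Circle.coe_ne_zero _ hx

end Characters

/-! ### Relations between multiplication operators and Koopman operators -/

section Operators

variable {X : Type*} [MeasurableSpace X] {μ : Measure X}

theorem koopman_apply_ae (e : X ≃ᵐ X) (he : MeasurePreserving e μ μ) (ξ : Lp ℂ 2 μ) :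
    (koopman e he).1 ξ =ᵐ[μ] fun x => ξ (e.symm x) :=
  Lp.coeFn_compMeasurePreserving ξ (he.symm e)

theorem circleMul_apply_ae (w : X → Circle) (hw : Measurable fun x => (w x : ℂ)) (ξ : Lp ℂ 2 μ) :
    (circleMul (μ := μ) w hw).1 ξ =ᵐ[μ] fun x => (w x : ℂ) * ξ x :=
  coeFn_mulOp _ (memLp_circle hw) ξ

theorem koopman_mul_koopman (e f : X ≃ᵐ X) (he : MeasurePreserving e μ μ)
    (hf : MeasurePreserving f μ μ) :
    (koopman e he).1 * (koopman f hf).1 = (koopman (f.trans e) (hf.trans he)).1 := by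
  ext1 ξ
  refine Lp.ext ?_
  change (koopman e he).1 ((koopman f hf).1 ξ) =ᵐ[μ] _
  filter_upwards [koopman_apply_ae e he ((koopman f hf).1 ξ),
    (he.symm e).quasiMeasurePreserving.ae (koopman_apply_ae f hf ξ),
    koopman_apply_ae (f.trans e) (hf.trans he) ξ] with x h1 h2 h3
  rw [h1, h2, h3]
  rfl

theorem koopman_congr {e f : X ≃ᵐ X} (he : MeasurePreserving e μ μ)
    (hf : MeasurePreserving f μ μ) (h : ∀ x, e x = f x) : koopman e he = koopman f hf := by
  have : e = f := MeasurableEquiv.ext (funext h)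
  subst this
  rfl

theorem koopman_mul_mulOp (e : X ≃ᵐ X) (he : MeasurePreserving e μ μ) {f g : X → ℂ}
    (hf : MemLp f ∞ μ) (hg : MemLp g ∞ μ) (hfg : ∀ x, g (e x) = f x) :
    (koopman e he).1 * mulOp f hf = mulOp g hg * (koopman e he).1 := by
  ext1 ξ
  refine Lp.ext ?_
  change (koopman e he).1 (mulOp f hf ξ) =ᵐ[μ] mulOp g hg ((koopman e he).1 ξ)
  filter_upwards [koopman_apply_ae e he (mulOp f hf ξ),
    (he.symm e).quasiMeasurePreserving.ae (coeFn_mulOp f hf ξ),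
    coeFn_mulOp g hg ((koopman e he).1 ξ), koopman_apply_ae e he ξ] with x h1 h2 h3 h4
  rw [h1, h2, h3, h4, ← hfg, MeasurableEquiv.apply_symm_apply]

theorem mulOp_comm {f g : X → ℂ} (hf : MemLp f ∞ μ) (hg : MemLp g ∞ μ) :
    mulOp f hf * mulOp g hg = mulOp g hg * mulOp f hf := by
  ext1 ξ
  refine Lp.ext ?_
  change mulOp f hf (mulOp g hg ξ) =ᵐ[μ] mulOp g hg (mulOp f hf ξ)
  filter_upwards [coeFn_mulOp f hf (mulOp g hg ξ), coeFn_mulOp g hg ξ,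
    coeFn_mulOp g hg (mulOp f hf ξ), coeFn_mulOp f hf ξ] with x h1 h2 h3 h4
  rw [h1, h2, h3, h4, mul_left_comm]

theorem mulOp_smul (c : ℂ) {f g : X → ℂ} (hf : MemLp f ∞ μ) (hg : MemLp g ∞ μ)
    (h : ∀ x, g x = c * f x) : mulOp g hg = c • mulOp f hf := by
  ext1 ξ
  refine Lp.ext ?_
  change mulOp g hg ξ =ᵐ[μ] (c • mulOp f hf ξ : Lp ℂ 2 μ)
  filter_upwards [coeFn_mulOp f hf ξ, coeFn_mulOp g hg ξ, Lp.coeFn_smul c (mulOp f hf ξ)]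
    with x h1 h2 h3
  rw [h2, h3, Pi.smul_apply, h1, h, smul_eq_mul, mul_assoc]

end Operators

/-! ### The crossed product as a twisted group von Neumann algebra -/

section System

variable {L₁ L₂ : Type*} [CommGroup L₁] [CommGroup L₂] [TopologicalSpace L₂]
  [DiscreteTopology L₂] [Countable L₁] [MeasurableSpace L₁] [DiscreteMeasurableSpace L₁]

local notation "𝕂" => PontryaginDual (Fin 3 → L₂)
local notation "𝔾" => (Fin 3 → L₁)
local notation "ℍ" => L2 (PontryaginDual (Fin 3 → L₂)) (Fin 3 → L₁)

/-- Translation of the second variable. -/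
def sndTranslation (g : 𝔾) : 𝕂 × 𝔾 ≃ᵐ 𝕂 × 𝔾 :=
  (MeasurableEquiv.refl 𝕂).prodCongr (MeasurableEquiv.mulLeft g)

theorem measurePreserving_sndTranslation (g : 𝔾) :
    MeasurePreserving (sndTranslation (L₂ := L₂) g) (prodMeasure 𝕂 𝔾) (prodMeasure 𝕂 𝔾) :=
  (MeasurePreserving.id (haarProb 𝕂)).prod (measurePreserving_mul_left (Measure.count : Measure 𝔾) g)

theorem measurable_twistedChar (ι : L₁ →* PontryaginDual L₂) (h : Fin 3 → L₂) :
    Measurable fun p : 𝕂 × 𝔾 => ((cubeHom ι p.2 h * (p.1 h)⁻¹ : Circle) : ℂ) := by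
  simp only [Circle.coe_mul]
  refine Measurable.mul ?_ (measurable_circle_inv ((measurable_eval h).comp measurable_fst))
  exact (Measurable.of_discrete (f := fun s : 𝔾 => (cubeHom ι s h : ℂ))).comp measurable_snd

/-- The unitary of the commutant given by the character `h`, twisted so as to be invariant under
the diagonal translations. -/
def twistedChar (ι : L₁ →* PontryaginDual L₂) (h : Fin 3 → L₂) : unitary (ℍ →L[ℂ] ℍ) :=
  circleMul (fun p : 𝕂 × 𝔾 => cubeHom ι p.2 h * (p.1 h)⁻¹) (measurable_twistedChar ι h)

/-- The unitary of the commutant given by translation of the second variable. -/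
def sndUnitary (g : 𝔾) : unitary (ℍ →L[ℂ] ℍ) :=
  koopman (sndTranslation (L₂ := L₂) g) (measurePreserving_sndTranslation g)

omit [Countable L₁] [MeasurableSpace L₁] [DiscreteMeasurableSpace L₁] in
theorem cubeHom_mul_apply (ι : L₁ →* PontryaginDual L₂) (g g' : 𝔾) (h : Fin 3 → L₂) :
    cubeHom ι (g * g') h = cubeHom ι g h * cubeHom ι g' h := by
  rw [map_mul]; rfl

omit [Countable L₁] [MeasurableSpace L₁] [DiscreteMeasurableSpace L₁] in
theorem cubeHom_one_apply (ι : L₁ →* PontryaginDual L₂) (h : Fin 3 → L₂) :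
    cubeHom ι (1 : 𝔾) h = 1 := by
  rw [map_one]; rfl

/-- The commutation relation of the canonical unitaries. -/
theorem groupUnitary_mul_charUnitary (ι : L₁ →* PontryaginDual L₂) (g : 𝔾) (h : Fin 3 → L₂) :
    (groupUnitary (cubeHom ι) g).1 * (charUnitary L₁ h).1 =
      (cubeHom ι g h : ℂ) • ((charUnitary L₁ h).1 * (groupUnitary (cubeHom ι) g).1) := by
  have hw := measurable_circle_inv (w := fun p : 𝕂 × 𝔾 => p.1 h)
    ((measurable_eval h).comp measurable_fst)
  have hw' : Measurable fun p : 𝕂 × 𝔾 => ((cubeHom ι g h * (p.1 h)⁻¹ : Circle) : ℂ) := by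
    simp only [Circle.coe_mul]
    exact measurable_const.mul hw
  rw [← smul_mul_assoc]
  have h1 := mulOp_smul (μ := prodMeasure 𝕂 𝔾) (cubeHom ι g h : ℂ) (memLp_circle hw)
    (memLp_circle hw') fun p => Circle.coe_mul _ _
  refine Eq.trans ?_ (congrArg (· * (groupUnitary (cubeHom ι) g).1) h1)
  refine koopman_mul_mulOp _ (measurePreserving_translation (cubeHom ι) g) _ _ fun p => ?_
  change ((cubeHom ι g h * (cubeHom ι g h * p.1 h)⁻¹ : Circle) : ℂ) = (((p.1 h)⁻¹ : Circle) : ℂ)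
  rw [mul_inv, mul_inv_cancel_left]

theorem groupUnitary_comm_twistedChar (ι : L₁ →* PontryaginDual L₂) (g : 𝔾) (h : Fin 3 → L₂) :
    (groupUnitary (cubeHom ι) g).1 * (twistedChar ι h).1 =
      (twistedChar ι h).1 * (groupUnitary (cubeHom ι) g).1 := by
  refine koopman_mul_mulOp _ (measurePreserving_translation (cubeHom ι) g) _ _ fun p => ?_
  change ((cubeHom ι (g * p.2) h * (cubeHom ι g h * p.1 h)⁻¹ : Circle) : ℂ) =
    ((cubeHom ι p.2 h * (p.1 h)⁻¹ : Circle) : ℂ)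
  rw [cubeHom_mul_apply, mul_inv, mul_mul_mul_comm, mul_inv_cancel, one_mul]

theorem groupUnitary_comm_sndUnitary (ι : L₁ →* PontryaginDual L₂) (g g' : 𝔾) :
    (groupUnitary (cubeHom ι) g).1 * (sndUnitary (L₂ := L₂) g').1 =
      (sndUnitary (L₂ := L₂) g').1 * (groupUnitary (cubeHom ι) g).1 := by
  refine (koopman_mul_koopman _ _ (measurePreserving_translation (cubeHom ι) g)
    (measurePreserving_sndTranslation g')).trans (Eq.trans ?_ (koopman_mul_koopman _ _
      (measurePreserving_sndTranslation g') (measurePreserving_translation (cubeHom ι) g)).symm)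
  refine congrArg Subtype.val (koopman_congr _ _ fun p => ?_)
  exact Prod.ext rfl (mul_left_comm g g' p.2)

theorem linftyOps_comm_sndUnitary {T : ℍ →L[ℂ] ℍ} (hT : T ∈ linftyOps 𝕂 𝔾) (g : 𝔾) :
    T * (sndUnitary g).1 = (sndUnitary g).1 * T := by
  obtain ⟨f, hf, rfl⟩ := hT
  exact (koopman_mul_mulOp _ (measurePreserving_sndTranslation g) _ _ fun p => rfl).symm

theorem linftyOps_comm_twistedChar (ι : L₁ →* PontryaginDual L₂) {T : ℍ →L[ℂ] ℍ}
    (hT : T ∈ linftyOps 𝕂 𝔾) (h : Fin 3 → L₂) :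
    T * (twistedChar ι h).1 = (twistedChar ι h).1 * T := by
  obtain ⟨f, hf, rfl⟩ := hT
  exact mulOp_comm _ _

theorem charUnitary_mem_linftyOps (h : Fin 3 → L₂) :
    (charUnitary L₁ h).1 ∈ linftyOps 𝕂 𝔾 :=
  ⟨fun x => (((x h)⁻¹ : Circle) : ℂ),
    memLp_circle (w := fun x : 𝕂 => (x h)⁻¹) (measurable_circle_inv (measurable_eval h)), rfl⟩

omit [CommGroup L₁] in
theorem prodMeasure_restrict (g : 𝔾) :
    (prodMeasure 𝕂 𝔾).restrict (Set.univ ×ˢ {g}) = (haarProb 𝕂).map fun x => (x, g) := by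
  rw [prodMeasure, ← Measure.prod_restrict, Measure.restrict_univ, Measure.restrict_singleton,
    Measure.count_singleton, one_smul, Measure.prod_dirac]

omit [CommGroup L₁] in
theorem prodMeasure_slice_ne_top (g : 𝔾) : prodMeasure 𝕂 𝔾 (Set.univ ×ˢ {g}) ≠ ∞ := by
  simp [prodMeasure]

/-- The vector `1 ⊗ δ_g`. -/
def sliceVector (g : 𝔾) : ℍ :=
  indicatorConstLp 2 (MeasurableSet.univ.prod (measurableSet_singleton g))
    (prodMeasure_slice_ne_top g) 1

omit [CommGroup L₁] in
theorem sliceVector_ae (g : 𝔾) : (sliceVector (L₂ := L₂) g : 𝕂 × 𝔾 → ℂ) =ᵐ[prodMeasure 𝕂 𝔾]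
    (Set.univ ×ˢ {g} : Set (𝕂 × 𝔾)).indicator fun _ => 1 :=
  indicatorConstLp_coeFn

omit [CommGroup L₁] in
theorem inner_sliceVector (g : 𝔾) (ξ : ℍ) :
    inner ℂ (sliceVector g) ξ = ∫ x, ξ (x, g) ∂haarProb 𝕂 := by
  rw [sliceVector, L2.inner_indicatorConstLp_one, prodMeasure_restrict, integral_map]
  · exact measurable_prodMk_right.aemeasurable
  · rw [← prodMeasure_restrict]
    exact (Lp.aestronglyMeasurable ξ).restrict

theorem koopman_baseVector {e : 𝕂 × 𝔾 ≃ᵐ 𝕂 × 𝔾}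
    (he : MeasurePreserving e (prodMeasure 𝕂 𝔾) (prodMeasure 𝕂 𝔾)) {g : 𝔾}
    (h : ∀ p, (e p).2 = g ↔ p.2 = 1) : (koopman e he).1 (baseVector 𝕂 𝔾) = sliceVector g := by
  refine Lp.ext ?_
  filter_upwards [koopman_apply_ae e he (baseVector 𝕂 𝔾), sliceVector_ae g,
    (he.symm e).quasiMeasurePreserving.ae (sliceVector_ae (1 : 𝔾))] with p h1 h2 h3
  rw [h1, h2]
  refine h3.trans ?_
  have h4 := h (e.symm p)
  rw [MeasurableEquiv.apply_symm_apply] at h4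
  by_cases hp : p.2 = g
  · rw [Set.indicator_of_mem (by simpa using h4.1 hp), Set.indicator_of_mem (by simpa using hp)]
  · rw [Set.indicator_of_notMem (by simpa using fun h' => hp (h4.2 h')),
      Set.indicator_of_notMem (by simpa using hp)]

theorem groupUnitary_baseVector (ι : L₁ →* PontryaginDual L₂) (g : 𝔾) :
    (groupUnitary (cubeHom ι) g).1 (baseVector 𝕂 𝔾) = sliceVector g :=
  koopman_baseVector (measurePreserving_translation (cubeHom ι) g) fun _ => mul_eq_left

theorem sndUnitary_baseVector (g : 𝔾) :
    (sndUnitary g).1 (baseVector 𝕂 𝔾) = sliceVector g :=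
  koopman_baseVector (measurePreserving_sndTranslation g) fun _ => mul_eq_left

theorem twistedChar_baseVector (ι : L₁ →* PontryaginDual L₂) (h : Fin 3 → L₂) :
    (twistedChar ι h).1 (baseVector 𝕂 𝔾) = (charUnitary L₁ h).1 (baseVector 𝕂 𝔾) := by
  refine Lp.ext ?_
  filter_upwards [circleMul_apply_ae _ (measurable_twistedChar ι h) (baseVector 𝕂 𝔾),
    circleMul_apply_ae (fun p : 𝕂 × 𝔾 => (p.1 h)⁻¹) (measurable_circle_inv
      ((measurable_eval h).comp measurable_fst)) (baseVector 𝕂 𝔾),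
    sliceVector_ae (1 : 𝔾)] with p h1 h2 h3
  have h3' : baseVector 𝕂 𝔾 p = _ := h3
  refine h1.trans (Eq.trans ?_ h2.symm)
  rw [h3']
  by_cases hp : p.2 = 1
  · rw [hp, cubeHom_one_apply, one_mul]
  · rw [Set.indicator_of_notMem (by simpa using hp), mul_zero, mul_zero]

theorem inner_baseVector_charUnitary_sliceVector (g : 𝔾) (h : Fin 3 → L₂)
    [Decidable (g = 1 ∧ h = 1)] :
    inner ℂ (baseVector 𝕂 𝔾) ((charUnitary L₁ h).1 (sliceVector g)) =
      if g = 1 ∧ h = 1 then 1 else 0 := by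
  classical
  have h0 := inner_sliceVector (1 : 𝔾) ((charUnitary L₁ h).1 (sliceVector g))
  refine h0.trans ?_
  have h1 : ∀ᵐ p ∂prodMeasure 𝕂 𝔾, (charUnitary L₁ h).1 (sliceVector g) p =
      (((p.1 h)⁻¹ : Circle) : ℂ) * (Set.univ ×ˢ {g} : Set (𝕂 × 𝔾)).indicator (fun _ => 1) p := by
    filter_upwards [circleMul_apply_ae (fun p : 𝕂 × 𝔾 => (p.1 h)⁻¹) (measurable_circle_inv
      ((measurable_eval h).comp measurable_fst)) (sliceVector g), sliceVector_ae g] with p h2 h3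
    rw [← h3]
    exact h2
  have h2 : ∀ᵐ x ∂haarProb 𝕂, (charUnitary L₁ h).1 (sliceVector g) (x, (1 : 𝔾)) =
      ((x h⁻¹ : Circle) : ℂ) *
        (Set.univ ×ˢ {g} : Set (𝕂 × 𝔾)).indicator (fun _ => 1) (x, (1 : 𝔾)) := by
    have h3 := ae_restrict_of_ae (s := Set.univ ×ˢ {(1 : 𝔾)}) h1
    rw [prodMeasure_restrict] at h3
    have h4 := ae_of_ae_map measurable_prodMk_right.aemeasurable h3
    filter_upwards [h4] with x hx
    rw [hx, map_inv]
  rw [integral_congr_ae h2]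
  by_cases hg : g = 1
  · have h3 := integral_eval (A := Fin 3 → L₂) h⁻¹
    simp only [inv_eq_one] at h3
    simpa [hg] using h3
  · simp [hg, Ne.symm hg]

omit [CommGroup L₁] in
theorem eq_zero_of_inner_charUnitary_sliceVector {ξ : ℍ}
    (h : ∀ (g : 𝔾) (h : Fin 3 → L₂), inner ℂ ((charUnitary L₁ h).1 (sliceVector g)) ξ = 0) :
    ξ = 0 := by
  have hslice : ∀ g : 𝔾, ∀ᵐ p ∂(prodMeasure 𝕂 𝔾).restrict (Set.univ ×ˢ {g}), ξ p = 0 := by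
    intro g
    have hmeas : AEMeasurable (fun x : 𝕂 => (x, g)) (haarProb 𝕂) :=
      measurable_prodMk_right.aemeasurable
    have hmem : MemLp (fun x => ξ (x, g)) 2 (haarProb 𝕂) := by
      have h1 := (Lp.memLp ξ).restrict (Set.univ ×ˢ {g})
      rw [prodMeasure_restrict] at h1
      exact h1.comp_of_map hmeas
    have h0 := ae_eq_zero_of_integral_eval hmem fun k => by
      have h1 : inner ℂ (sliceVector g) ((charUnitary L₁ k⁻¹).1 ξ) = 0 := by
        rw [← h g k, ← unitary_inner_map (charUnitary L₁ k)]
        congr 1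
        rw [map_inv]
        exact unitary_apply_star (charUnitary L₁ k) ξ
      rw [inner_sliceVector] at h1
      rw [← h1]
      refine integral_congr_ae ?_
      have h2 := ae_restrict_of_ae (s := Set.univ ×ˢ {g})
        (circleMul_apply_ae (μ := prodMeasure 𝕂 𝔾) (fun p : 𝕂 × 𝔾 => (p.1 k⁻¹)⁻¹)
        (measurable_circle_inv ((measurable_eval k⁻¹).comp measurable_fst)) ξ)
      rw [prodMeasure_restrict] at h2
      filter_upwards [ae_of_ae_map hmeas h2] with x hx
      refine Eq.trans ?_ hx.symm
      rw [map_inv, inv_inv]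
    rw [prodMeasure_restrict, ae_map_iff hmeas]
    · exact h0
    · exact (Lp.stronglyMeasurable ξ).measurable (measurableSet_singleton 0)
  refine Lp.ext ?_
  have h1 := (ae_restrict_iUnion_iff (μ := prodMeasure 𝕂 𝔾) (fun g : 𝔾 => Set.univ ×ˢ {g})
    fun p => ξ p = 0).2 hslice
  have h2 : (⋃ g : 𝔾, (Set.univ ×ˢ {g} : Set (𝕂 × 𝔾))) = Set.univ := by
    ext p; simp
  rw [h2, Measure.restrict_univ] at h1
  filter_upwards [h1, Lp.coeFn_zero ℂ 2 (prodMeasure 𝕂 𝔾)] with p hp hp0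
  rw [hp, hp0]
  rfl

/-- The canonical unitary `u_h u_g`. -/
def leftUnitary (ι : L₁ →* PontryaginDual L₂) (i : 𝔾 × (Fin 3 → L₂)) : unitary (ℍ →L[ℂ] ℍ) :=
  charUnitary L₁ i.2 * groupUnitary (cubeHom ι) i.1

theorem leftUnitary_baseVector (ι : L₁ →* PontryaginDual L₂) (i : 𝔾 × (Fin 3 → L₂)) :
    (leftUnitary ι i).1 (baseVector 𝕂 𝔾) = (charUnitary L₁ i.2).1 (sliceVector i.1) := by
  rw [← groupUnitary_baseVector ι]
  rfl

theorem sndUnitary_twistedChar_baseVector (ι : L₁ →* PontryaginDual L₂)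
    (i : 𝔾 × (Fin 3 → L₂)) :
    (sndUnitary i.1 * twistedChar ι i.2).1 (baseVector 𝕂 𝔾) =
      (charUnitary L₁ i.2).1 (sliceVector i.1) := by
  rw [← sndUnitary_baseVector]
  change (sndUnitary i.1).1 ((twistedChar ι i.2).1 (baseVector 𝕂 𝔾)) = _
  rw [twistedChar_baseVector]
  exact (DFunLike.congr_fun
    (linftyOps_comm_sndUnitary (charUnitary_mem_linftyOps (L₁ := L₁) i.2) i.1) _).symm

theorem sndUnitary_sliceVector (g g' : 𝔾) :
    (sndUnitary (L₂ := L₂) g).1 (sliceVector g') = sliceVector (g * g') := by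
  have h := DFunLike.congr_fun (koopman_mul_koopman _ _ (measurePreserving_sndTranslation g)
    (measurePreserving_sndTranslation g')) (baseVector 𝕂 𝔾)
  rw [← sndUnitary_baseVector]
  refine h.trans (koopman_baseVector _ fun p => ?_)
  change g * (g' * p.2) = g * g' ↔ _
  rw [← mul_assoc, mul_eq_left]

theorem orthonormal_charUnitary_sliceVector :
    Orthonormal ℂ fun i : 𝔾 × (Fin 3 → L₂) => (charUnitary L₁ i.2).1 (sliceVector i.1) := by
  classical
  rw [orthonormal_iff_ite]
  rintro ⟨g, h⟩ ⟨g', h'⟩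
  -- unitaries of the commutant reduce the computation to an inner product with `1 ⊗ δ_e`
  have h1 : (charUnitary L₁ h').1 (sliceVector g') =
      (charUnitary L₁ h).1 ((charUnitary L₁ (h⁻¹ * h')).1 (sliceVector (L₂ := L₂) g')) := by
    conv_lhs => rw [← mul_inv_cancel_left h h', map_mul]
    rfl
  have h2 : sliceVector (L₂ := L₂) g' = (sndUnitary g).1 (sliceVector (g⁻¹ * g')) := by
    rw [sndUnitary_sliceVector, mul_inv_cancel_left]
  have h3 : (charUnitary L₁ (h⁻¹ * h')).1 ((sndUnitary g).1 (sliceVector (g⁻¹ * g'))) =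
      (sndUnitary g).1 ((charUnitary L₁ (h⁻¹ * h')).1 (sliceVector (g⁻¹ * g'))) :=
    DFunLike.congr_fun (linftyOps_comm_sndUnitary
      (charUnitary_mem_linftyOps (L₁ := L₁) (h⁻¹ * h')) g) _
  rw [h1, unitary_inner_map, h2, h3, ← sndUnitary_baseVector g, unitary_inner_map,
    inner_baseVector_charUnitary_sliceVector]
  refine if_congr ?_ rfl rfl
  rw [inv_mul_eq_one, inv_mul_eq_one, Prod.mk.injEq]

theorem leftUnitary_mul (ι : L₁ →* PontryaginDual L₂) (i j : 𝔾 × (Fin 3 → L₂)) :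
    (leftUnitary ι i).1 * (leftUnitary ι j).1 =
      (cubeHom ι i.1 j.2 : ℂ) • (leftUnitary ι (i * j)).1 := by
  have h1 : ∀ {a b c d : ℍ →L[ℂ] ℍ} {z : ℂ}, b * c = z • (c * b) →
      (a * b) * (c * d) = z • (a * c * (b * d)) := by
    intro a b c d z h
    rw [mul_assoc, ← mul_assoc b, h, smul_mul_assoc, mul_smul_comm, mul_assoc, mul_assoc]
  have h2 : (leftUnitary ι (i * j)).1 = (charUnitary L₁ i.2).1 * (charUnitary L₁ j.2).1 *
      ((groupUnitary (cubeHom ι) i.1).1 * (groupUnitary (cubeHom ι) j.1).1) := by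
    have hc := congrArg Subtype.val ((charUnitary L₁).map_mul i.2 j.2)
    have hg := congrArg Subtype.val ((groupUnitary (cubeHom ι)).map_mul i.1 j.1)
    exact congrArg₂ (· * ·) hc hg
  rw [h2]
  exact h1 (groupUnitary_mul_charUnitary ι i.1 j.2)

variable (L₁ L₂) in
/-- The orthonormal basis of vectors `u_h (1 ⊗ δ_g)`. -/
def systemBasis : HilbertBasis (𝔾 × (Fin 3 → L₂)) ℂ ℍ :=
  HilbertBasis.mkOfOrthogonalEqBot orthonormal_charUnitary_sliceVector (by
    rw [Submodule.eq_bot_iff]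
    intro ξ hξ
    refine eq_zero_of_inner_charUnitary_sliceVector fun g h => ?_
    exact (Submodule.mem_orthogonal _ _).1 hξ _ (Submodule.subset_span ⟨(g, h), rfl⟩))

theorem systemBasis_apply (i : 𝔾 × (Fin 3 → L₂)) :
    systemBasis L₁ L₂ i = (charUnitary L₁ i.2).1 (sliceVector i.1) := by
  rw [systemBasis, HilbertBasis.coe_mkOfOrthogonalEqBot]

theorem systemBasis_one : systemBasis L₁ L₂ 1 = baseVector 𝕂 𝔾 := by
  rw [systemBasis_apply, Prod.snd_one, Prod.fst_one, map_one]
  rfl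

theorem leftUnitary_comm_right (ι : L₁ →* PontryaginDual L₂) (i j : 𝔾 × (Fin 3 → L₂)) :
    (leftUnitary ι i).1 * (sndUnitary j.1 * twistedChar ι j.2).1 =
      (sndUnitary j.1 * twistedChar ι j.2).1 * (leftUnitary ι i).1 := by
  have h1 : Commute (charUnitary L₁ i.2).1 (sndUnitary j.1).1 :=
    linftyOps_comm_sndUnitary (charUnitary_mem_linftyOps _) _
  have h2 : Commute (charUnitary L₁ i.2).1 (twistedChar ι j.2).1 :=
    linftyOps_comm_twistedChar ι (charUnitary_mem_linftyOps _) _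
  have h3 : Commute (groupUnitary (cubeHom ι) i.1).1 (sndUnitary j.1).1 :=
    groupUnitary_comm_sndUnitary ι _ _
  have h4 : Commute (groupUnitary (cubeHom ι) i.1).1 (twistedChar ι j.2).1 :=
    groupUnitary_comm_twistedChar ι _ _
  exact Commute.mul_left (h1.mul_right h2) (h3.mul_right h4)

/-- The canonical unitaries of the crossed product, as a twisted system over `L₁³ × L₂³`. -/
def system (ι : L₁ →* PontryaginDual L₂) : TwistedSystem (𝔾 × (Fin 3 → L₂)) ℍ where
  basis := systemBasis L₁ L₂
  left := leftUnitary ι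
  right i := sndUnitary i.1 * twistedChar ι i.2
  left_base i := by rw [systemBasis_one, systemBasis_apply, leftUnitary_baseVector]
  right_base i := by rw [systemBasis_one, systemBasis_apply, sndUnitary_twistedChar_baseVector]
  comm := leftUnitary_comm_right ι
  left_mul i j := ⟨cubeHom ι i.1 j.2, leftUnitary_mul ι i j⟩

theorem system_vac (ι : L₁ →* PontryaginDual L₂) : (system ι).vac = baseVector 𝕂 𝔾 :=
  systemBasis_one

theorem system_U_fst (ι : L₁ →* PontryaginDual L₂) (g : 𝔾) :
    (system ι).left (g, 1) = groupUnitary (cubeHom ι) g := by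
  change charUnitary L₁ 1 * groupUnitary (cubeHom ι) g = _
  rw [map_one, one_mul]

theorem system_U_snd (ι : L₁ →* PontryaginDual L₂) (h : Fin 3 → L₂) :
    (system ι).left (1, h) = charUnitary L₁ h := by
  change charUnitary L₁ h * groupUnitary (cubeHom ι) 1 = _
  rw [map_one, mul_one]

theorem algA_eq (ι : L₁ →* PontryaginDual L₂) : algA ι = (system ι).alg Set.univ := by
  refine le_antisymm (generatedBy_le ?_) (generatedBy_le ?_)
  · rintro T (hT | ⟨g, rfl⟩)
    · refine TwistedSystem.mem_alg_univ.2 fun i => ?_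
      exact Commute.mul_right (linftyOps_comm_sndUnitary hT i.1)
        (linftyOps_comm_twistedChar ι hT i.2)
    · have h := (system ι).isLeft_U (g, 1)
      rw [TwistedSystem.U, system_U_fst] at h
      exact TwistedSystem.mem_alg_univ.2 h
  · rintro _ ⟨i, -, rfl⟩
    refine mul_mem (S := VonNeumannAlgebra ℍ) ?_ ?_
    · exact subset_generatedBy _ (Or.inl (charUnitary_mem_linftyOps i.2))
    · exact subset_generatedBy _ (Or.inr ⟨i.1, rfl⟩)

theorem traceA_eq (ι : L₁ →* PontryaginDual L₂) : traceA L₁ L₂ =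
    fun T => inner ℂ (system ι).vac (T (system ι).vac) := by
  rw [system_vac]
  rfl

theorem isGMSDecomposition_iff (ι : L₁ →* PontryaginDual L₂) {B : VonNeumannAlgebra ℍ}
    {Λ : Subgroup (unitary (ℍ →L[ℂ] ℍ))} :
    IsGMSDecomposition (algA ι) (traceA L₁ L₂) B Λ ↔ (system ι).IsGMS B Λ := by
  rw [algA_eq, traceA_eq ι]

/-- Two canonical unitaries commute if and only if the bicharacter takes the same values. -/
theorem system_U_comm_iff (ι : L₁ →* PontryaginDual L₂) (i j : 𝔾 × (Fin 3 → L₂)) :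
    (system ι).U i * (system ι).U j = (system ι).U j * (system ι).U i ↔
      cubeHom ι i.1 j.2 = cubeHom ι j.1 i.2 := by
  have key : ∀ i j : 𝔾 × (Fin 3 → L₂), (system ι).U i * (system ι).U j =
      (cubeHom ι i.1 j.2 : ℂ) • (system ι).U (i * j) := leftUnitary_mul ι
  rw [key, key, mul_comm j i]
  refine ⟨fun h => ?_, fun h => by rw [h]⟩
  have h1 := DFunLike.congr_fun h (system ι).vac
  change (_ : ℂ) • (system ι).U (i * j) (system ι).vac =
    (_ : ℂ) • (system ι).U (i * j) (system ι).vac at h1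
  exact Circle.ext (smul_left_injective ℂ (TwistedSystem.unitary_vac_ne_zero _) h1)

/-! ### The action of `SL(3, ℤ)` by symmetries -/

/-- The action of `a ∈ SL(3, ℤ)` on the index group: `a` on `L₁³` and the inverse transpose
of `a` on `L₂³`. -/
def slPerm (a : Matrix.SpecialLinearGroup (Fin 3) ℤ) : MulAut (𝔾 × (Fin 3 → L₂)) where
  toFun p := (matAct a.1 p.1, matAct a⁻¹.1.transpose p.2)
  invFun p := (matAct a⁻¹.1 p.1, matAct a.1.transpose p.2)
  left_inv p := by
    simp only [← matAct_mul, ← Matrix.transpose_mul]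
    simp only [← Matrix.SpecialLinearGroup.coe_mul, inv_mul_cancel,
      Matrix.SpecialLinearGroup.coe_one, Matrix.transpose_one, matAct_one]
  right_inv p := by
    simp only [← matAct_mul, ← Matrix.transpose_mul]
    simp only [← Matrix.SpecialLinearGroup.coe_mul, mul_inv_cancel,
      Matrix.SpecialLinearGroup.coe_one, Matrix.transpose_one, matAct_one]
  map_mul' p q := by simp only [Prod.fst_mul, Prod.snd_mul, map_mul, Prod.mk_mul_mk]

theorem conj_eq_of_mul_eq {H : Type*} [NormedAddCommGroup H] [InnerProductSpace ℂ H]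
    [CompleteSpace H] (u : unitary (H →L[ℂ] H)) {x y : H →L[ℂ] H} (h : u.1 * x = y * u.1) :
    u.1 * x * star u.1 = y := by
  rw [h, mul_assoc, (Unitary.mem_iff.1 u.2).2, mul_one]

theorem slUnitary_mul_groupUnitary (ι : L₁ →* PontryaginDual L₂)
    (a : Matrix.SpecialLinearGroup (Fin 3) ℤ) (g : 𝔾) :
    (slUnitary (L₁ := L₁) (L₂ := L₂) a).1 * (groupUnitary (cubeHom ι) g).1 =
      (groupUnitary (cubeHom ι) (matAct a.1 g)).1 * (slUnitary a).1 := by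
  refine (koopman_mul_koopman _ _ (measurePreserving_slAct a)
    (measurePreserving_translation (cubeHom ι) g)).trans (Eq.trans ?_ (koopman_mul_koopman _ _
      (measurePreserving_translation (cubeHom ι) (matAct a.1 g)) (measurePreserving_slAct a)).symm)
  refine congrArg Subtype.val (koopman_congr _ _ fun p => Prod.ext ?_ ?_)
  · change dualAct a.1 (cubeHom ι g * p.1) = cubeHom ι (matAct a.1 g) * dualAct a.1 p.1
    rw [cubeHom_matAct, map_mul]
  · change matAct a.1 (g * p.2) = matAct a.1 g * matAct a.1 p.2
    rw [map_mul]

theorem slUnitary_mul_charUnitary (a : Matrix.SpecialLinearGroup (Fin 3) ℤ) (h : Fin 3 → L₂) :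
    (slUnitary (L₁ := L₁) a).1 * (charUnitary L₁ h).1 =
      (charUnitary L₁ (matAct a⁻¹.1.transpose h)).1 * (slUnitary a).1 := by
  refine koopman_mul_mulOp _ (measurePreserving_slAct a) _ _ fun p => ?_
  change (((dualAct a.1 p.1 (matAct a⁻¹.1.transpose h))⁻¹ : Circle) : ℂ) = (((p.1 h)⁻¹ : Circle) : ℂ)
  rw [dualAct_apply, ← matAct_mul, ← Matrix.transpose_mul, ← Matrix.SpecialLinearGroup.coe_mul,
    inv_mul_cancel, Matrix.SpecialLinearGroup.coe_one, Matrix.transpose_one, matAct_one]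

theorem slUnitary_baseVector (a : Matrix.SpecialLinearGroup (Fin 3) ℤ) :
    (slUnitary (L₁ := L₁) (L₂ := L₂) a).1 (baseVector 𝕂 𝔾) = baseVector 𝕂 𝔾 := by
  refine koopman_baseVector (measurePreserving_slAct a) fun p => ?_
  have h : matAct a.1 p.2 = 1 ↔ p.2 = 1 := by
    refine ⟨fun h => ?_, fun h => by rw [h, map_one]⟩
    have h1 := congrArg (matAct a⁻¹.1) h
    rwa [← matAct_mul, ← Matrix.SpecialLinearGroup.coe_mul, inv_mul_cancel,
      Matrix.SpecialLinearGroup.coe_one, matAct_one, map_one] at h1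
  exact h

theorem mul_mul_eq_of_semiconj {R : Type*} [Monoid R] {u x y x' y' : R} (hx : u * x = x' * u)
    (hy : u * y = y' * u) : u * (x * y) = x' * y' * u := by
  rw [← mul_assoc, hx, mul_assoc, hy, mul_assoc]

theorem slUnitary_mul_leftUnitary (ι : L₁ →* PontryaginDual L₂)
    (a : Matrix.SpecialLinearGroup (Fin 3) ℤ) (i : 𝔾 × (Fin 3 → L₂)) :
    (slUnitary a).1 * (leftUnitary ι i).1 = (leftUnitary ι (slPerm a i)).1 * (slUnitary a).1 :=
  mul_mul_eq_of_semiconj (slUnitary_mul_charUnitary a i.2) (slUnitary_mul_groupUnitary ι a i.1)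

theorem slUnitary_systemBasis (ι : L₁ →* PontryaginDual L₂)
    (a : Matrix.SpecialLinearGroup (Fin 3) ℤ) (i : 𝔾 × (Fin 3 → L₂)) :
    (slUnitary a).1 (systemBasis L₁ L₂ i) = systemBasis L₁ L₂ (slPerm a i) := by
  rw [systemBasis_apply, systemBasis_apply, ← leftUnitary_baseVector ι,
    ← leftUnitary_baseVector ι (slPerm a i)]
  refine (DFunLike.congr_fun (slUnitary_mul_leftUnitary ι a i) (baseVector 𝕂 𝔾)).trans ?_
  exact congrArg (leftUnitary ι (slPerm a i)).1 (slUnitary_baseVector a)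

/-- The symmetry of the crossed product given by `a ∈ SL(3, ℤ)`. -/
def slSymmetry (ι : L₁ →* PontryaginDual L₂) (a : Matrix.SpecialLinearGroup (Fin 3) ℤ) :
    (system ι).Symmetry where
  op := slUnitary a
  perm := slPerm a
  op_U i := conj_eq_of_mul_eq _ (slUnitary_mul_leftUnitary ι a i)
  op_basis := slUnitary_systemBasis ι a

theorem beta_apply (a : Matrix.SpecialLinearGroup (Fin 3) ℤ) (x : ℍ →L[ℂ] ℍ) :
    beta L₁ L₂ a x = (slUnitary a).1 * x * star (slUnitary a).1 := rfl

end System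

/-! ### Standard group measure space decompositions -/

section Standard

variable {I H : Type*} [CommGroup I] [NormedAddCommGroup H] [InnerProductSpace ℂ H]
  [CompleteSpace H]

namespace TwistedSystem

variable {𝒮 : TwistedSystem I H}

/-- If `A` is a maximal subgroup of indices with commuting canonical unitaries, and `Λ` is a group
of multiples of canonical unitaries indexed by a complement of `A`, then `(alg A, Λ)` is a group
measure space decomposition. -/
theorem isGMS_alg (A : Subgroup I) (Λ : Subgroup (unitary (H →L[ℂ] H)))
    (hcomm : ∀ i ∈ A, ∀ j ∈ A, 𝒮.U i * 𝒮.U j = 𝒮.U j * 𝒮.U i)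
    (hmax : ∀ i, (∀ p ∈ A, 𝒮.U p * 𝒮.U i = 𝒮.U i * 𝒮.U p) → i ∈ A)
    (hΛ : ∀ v ∈ Λ, ∃ q, ∃ c : ℂ, (v : H →L[ℂ] H) = c • 𝒮.U q ∧ (q ∈ A → v = 1))
    (hgen : ∀ i, ∃ v ∈ Λ, ∃ p ∈ A, ∃ c : ℂ, 𝒮.U i = c • ((v : H →L[ℂ] H) * 𝒮.U p)) :
    𝒮.IsGMS (𝒮.alg A) Λ where
  le := generatedBy_mono (Set.image_mono (Set.subset_univ _))
  abelian x hx y hy := alg_commute_of_commute hcomm hx hy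
  maximal x hx hb := (mem_alg_univ.1 hx).mem_alg fun i hi => by
    by_contra hne
    exact hi (hmax i fun p hp =>
      (mem_alg_univ.1 hx).commute_of_inner_ne_zero (hb _ (U_mem_alg hp)).symm hne)
  mem v hv := by
    obtain ⟨q, c, hq, -⟩ := hΛ v hv
    rw [hq]
    exact smul_mem_vonNeumann c (U_mem_alg (Set.mem_univ q))
  normalizes v hv b hb := by
    obtain ⟨q, c, hq, -⟩ := hΛ v hv
    refine conj_mem_of_generators v.2 ?_ hb
    rintro _ ⟨p, hp, rfl⟩
    obtain ⟨d, hd⟩ := 𝒮.U_mul_comm q p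
    have h1 : (v : H →L[ℂ] H) * 𝒮.U p = ((d : ℂ) • 𝒮.U p) * v := by
      rw [hq, smul_mul_assoc, hd, mul_smul_comm, smul_mul_assoc]
    rw [h1, mul_assoc, (Unitary.mem_iff.1 v.2).2, mul_one]
    exact smul_mem_vonNeumann _ (U_mem_alg hp)
  generates := by
    refine le_antisymm (generatedBy_le ?_) (generatedBy_le ?_)
    · rintro x (hx | ⟨v, hv, rfl⟩)
      · exact (generatedBy_mono (Set.image_mono (Set.subset_univ _)) :
          𝒮.alg A ≤ 𝒮.alg Set.univ) hx
      · obtain ⟨q, c, hq, -⟩ := hΛ v hv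
        rw [hq]
        exact smul_mem_vonNeumann c (U_mem_alg (Set.mem_univ q))
    · rintro _ ⟨i, -, rfl⟩
      obtain ⟨v, hv, p, hp, c, h⟩ := hgen i
      rw [h]
      refine smul_mem_vonNeumann c (mul_mem (S := VonNeumannAlgebra H) ?_ ?_)
      · exact subset_generatedBy _ (Or.inr ⟨v, hv, rfl⟩)
      · exact subset_generatedBy _ (Or.inl (U_mem_alg hp))
  condExp_eq_zero v hv hne := by
    obtain ⟨q, c, hq, hqA⟩ := hΛ v hv
    refine ⟨zero_mem (𝒮.alg A), fun b hb => ?_⟩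
    have h1 : inner ℂ (𝒮.basis q) (star b 𝒮.vac) = 0 :=
      (mem_alg_iff.1 (star_mem hb)).2 q fun h => hne (hqA h)
    have h2 : inner ℂ 𝒮.vac ((b * (v : H →L[ℂ] H)) 𝒮.vac) = 0 := by
      change inner ℂ 𝒮.vac (b ((v : H →L[ℂ] H) 𝒮.vac)) = 0
      rw [← inner_star_left, hq]
      change inner ℂ _ (c • 𝒮.U q 𝒮.vac) = 0
      rw [show 𝒮.U q 𝒮.vac = 𝒮.basis q from 𝒮.left_base q, inner_smul_right, ← inner_conj_symm, h1,
        map_zero, mul_zero]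
    change inner ℂ 𝒮.vac ((b * 0) 𝒮.vac) = inner ℂ 𝒮.vac ((b * (v : H →L[ℂ] H)) 𝒮.vac)
    rw [h2]
    simp

theorem Symmetry.conj_mem_alg (s : 𝒮.Symmetry) {A A' : Set I} (h : ∀ i ∈ A, s.perm i ∈ A')
    {x : H →L[ℂ] H} (hx : x ∈ 𝒮.alg A) : s.op.1 * x * star s.op.1 ∈ 𝒮.alg A' := by
  refine conj_mem_of_generators s.op.2 ?_ hx
  rintro _ ⟨i, hi, rfl⟩
  rw [s.op_U]
  exact U_mem_alg (h i hi)

theorem Symmetry.star_conj_U (s : 𝒮.Symmetry) (i : I) :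
    star s.op.1 * 𝒮.U i * s.op.1 = 𝒮.U (s.perm⁻¹ i) := by
  have h := s.op_U (s.perm⁻¹ i)
  rw [MulAut.apply_inv_self] at h
  rw [← h]
  simp only [mul_assoc, (Unitary.mem_iff.1 s.op.2).1, mul_one]
  rw [← mul_assoc, (Unitary.mem_iff.1 s.op.2).1, one_mul]

theorem Symmetry.star_conj_mem_alg (s : 𝒮.Symmetry) {A A' : Set I}
    (h : ∀ i ∈ A, s.perm⁻¹ i ∈ A') {x : H →L[ℂ] H} (hx : x ∈ 𝒮.alg A) :
    star s.op.1 * x * s.op.1 ∈ 𝒮.alg A' := by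
  have h1 := conj_mem_of_generators (N := 𝒮.alg A') (u := star s.op.1) (Unitary.star_mem s.op.2)
    (X := 𝒮.U '' A) (x := x) ?_ hx
  · rwa [star_star] at h1
  rintro _ ⟨i, hi, rfl⟩
  rw [star_star, s.star_conj_U]
  exact U_mem_alg (h i hi)

end TwistedSystem

end Standard

/-! ### Orthogonal complements and admissible decompositions -/

section Orthogonality

variable {L₁ L₂ : Type*} [CommGroup L₁] [CommGroup L₂] [TopologicalSpace L₂]

theorem map_mul_apply_dual (ι : L₁ →* PontryaginDual L₂) (g g' : L₁) (h : L₂) :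
    ι (g * g') h = ι g h * ι g' h := by
  rw [map_mul]; rfl

theorem exists_mul_of_isCompl {G : Type*} [CommGroup G] {P Q : Subgroup G} (h : IsCompl P Q)
    (g : G) : ∃ p ∈ P, ∃ q ∈ Q, p * q = g :=
  Subgroup.mem_sup.1 (h.sup_eq_top ▸ Subgroup.mem_top g)

theorem apply_eq_one_of_mem_closure {ι : L₁ →* PontryaginDual L₂} {P : Subgroup L₁} {h : L₂}
    (hh : h ∈ perpRight ι P) {x : PontryaginDual L₂}
    (hx : x ∈ (P.map ι).topologicalClosure) : x h = 1 := by
  have h1 : (P.map ι).topologicalClosure ≤ (evalAt (A := L₂) h).ker := by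
    refine Subgroup.topologicalClosure_minimal _ ?_ ?_
    · rintro _ ⟨g, hg, rfl⟩
      exact hh g hg
    · exact isClosed_singleton.preimage (continuous_evalAt h)
  exact h1 hx

variable [DiscreteTopology L₂] {ι : L₁ →* PontryaginDual L₂}

theorem eq_one_of_forall_apply (hdense : DenseRange ι) {h : L₂} (hh : ∀ g, ι g h = 1) : h = 1 := by
  by_contra hne
  obtain ⟨x, hx⟩ := exists_dual_apply_ne_one hne
  refine hx (hdense.induction_on (p := fun x => x h = 1) x ?_ hh)
  exact isClosed_singleton.preimage (continuous_evalAt h)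

omit [DiscreteTopology L₂] in
theorem eq_one_of_forall_apply' (hinj : Function.Injective ι) {g : L₁} (hg : ∀ h, ι g h = 1) :
    g = 1 :=
  hinj ((PontryaginDual.ext hg).trans (map_one ι).symm)

omit [DiscreteTopology L₂] in
theorem apply_eq_one_of_perp_both {P Q : Subgroup L₁} (hPQ : IsCompl P Q) {h : L₂}
    (hP : h ∈ perpRight ι P) (hQ : h ∈ perpRight ι Q) (g : L₁) : ι g h = 1 := by
  obtain ⟨p, hp, q, hq, rfl⟩ := exists_mul_of_isCompl hPQ g
  rw [map_mul_apply_dual, hP p hp, hQ q hq, one_mul]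

/-- The orthogonal complements of an admissible decomposition decompose `L₂`: by Pontryagin
duality, the restriction of a character to one of the summands of the dual group extends trivially
to the other one. -/
theorem Admissible.isCompl_perpRight (hdense : DenseRange ι) {P Q : Subgroup L₁}
    (hPQ : Admissible ι P Q) : IsCompl (perpRight ι P) (perpRight ι Q) := by
  constructor
  · rw [Subgroup.disjoint_def]
    exact fun hP hQ => eq_one_of_forall_apply hdense (apply_eq_one_of_perp_both hPQ.1 hP hQ)
  · rw [codisjoint_iff, eq_top_iff]
    intro h _
    set KP := (P.map ι).topologicalClosure with hKP
    set KQ := (Q.map ι).topologicalClosure with hKQ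
    have : CompactSpace KP := isCompact_iff_compactSpace.1
      (Subgroup.isClosed_topologicalClosure _).isCompact
    have : CompactSpace KQ := isCompact_iff_compactSpace.1
      (Subgroup.isClosed_topologicalClosure _).isCompact
    let f : KP × KQ →* PontryaginDual L₂ := KP.subtype.coprod KQ.subtype
    have hf : ∀ p, f p = p.1.1 * p.2.1 := fun p => rfl
    have hbij : Function.Bijective f := by
      refine ⟨?_, fun x => ?_⟩
      · rw [injective_iff_map_eq_one]
        rintro ⟨a, b⟩ hab
        rw [hf] at hab
        have h1 : a.1 = b.1⁻¹ := mul_eq_one_iff_eq_inv.1 hab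
        have h2 : a.1 = 1 := Subgroup.disjoint_def.1 hPQ.2.disjoint a.2
          (h1 ▸ KQ.inv_mem b.2)
        have h3 : b.1 = 1 := by rwa [h2, one_mul] at hab
        exact Prod.ext (Subtype.ext h2) (Subtype.ext h3)
      · obtain ⟨a, ha, b, hb, hab⟩ := exists_mul_of_isCompl hPQ.2 x
        exact ⟨(⟨a, ha⟩, ⟨b, hb⟩), hab⟩
    let e : KP × KQ ≃* PontryaginDual L₂ := MulEquiv.ofBijective f hbij
    have hcont : Continuous e := (continuous_subtype_val.comp continuous_fst).mul
      (continuous_subtype_val.comp continuous_snd)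
    have hsymm : Continuous e.symm :=
      Continuous.continuous_symm_of_equiv_compact_to_t2 (f := e.toEquiv) hcont
    obtain ⟨k, hk⟩ := exists_eq_eval
      (((evalAt h).comp KQ.subtype).comp ((MonoidHom.snd KP KQ).comp e.symm.toMonoidHom))
      ((continuous_evalAt h).comp (continuous_subtype_val.comp (continuous_snd.comp hsymm)))
    have hk' : ∀ p : KP × KQ, p.2.1 h = (p.1.1 * p.2.1) k := by
      intro p
      rw [← hf, ← hk]
      change p.2.1 h = (e.symm (e p)).2.1 h
      rw [MulEquiv.symm_apply_apply]
    refine Subgroup.mem_sup.2 ⟨k, fun g hg => ?_, k⁻¹ * h, fun g hg => ?_, mul_inv_cancel_left k h⟩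
    · have h1 := hk' (⟨ι g, Subgroup.le_topologicalClosure _ ⟨g, hg, rfl⟩⟩, 1)
      change (1 : Circle) = (ι g * 1) k at h1
      rw [mul_one] at h1
      exact h1.symm
    · have h1 := hk' (1, ⟨ι g, Subgroup.le_topologicalClosure _ ⟨g, hg, rfl⟩⟩)
      change ι g h = (1 * ι g) k at h1
      rw [one_mul] at h1
      rw [map_mul, map_inv, h1, inv_mul_cancel]

omit [DiscreteTopology L₂] in
/-- If `L₁` and `L₂` are decomposed compatibly with the bicharacter, then the summand of `L₁` is
the orthogonal complement of that of `L₂`. -/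
theorem eq_perpLeft (hinj : Function.Injective ι) {P Q : Subgroup L₁} {P' Q' : Subgroup L₂}
    (hPQ : IsCompl P Q) (hPQ' : IsCompl P' Q') (hP : P' ≤ perpRight ι P)
    (hQ : Q' ≤ perpRight ι Q) : P = perpLeft ι P' := by
  refine le_antisymm (fun g hg h hh => hP hh g hg) fun g hg => ?_
  obtain ⟨p, hp, q, hq, rfl⟩ := exists_mul_of_isCompl hPQ g
  have h1 : q = 1 := by
    refine eq_one_of_forall_apply' hinj fun h => ?_
    obtain ⟨p', hp', q', hq', rfl⟩ := exists_mul_of_isCompl hPQ' h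
    have h2 := hg p' hp'
    rw [map_mul_apply_dual, hP hp' p hp, one_mul] at h2
    rw [map_mul, h2, hQ hq' q hq, one_mul]
  rw [h1, mul_one]
  exact hp

theorem eq_perpRight (hdense : DenseRange ι) {P Q : Subgroup L₁} {P' Q' : Subgroup L₂}
    (hPQ : IsCompl P Q) (hPQ' : IsCompl P' Q') (hP : P' ≤ perpRight ι P)
    (hQ : Q' ≤ perpRight ι Q) : P' = perpRight ι P := by
  refine le_antisymm hP fun h hh => ?_
  obtain ⟨p', hp', q', hq', rfl⟩ := exists_mul_of_isCompl hPQ' h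
  have h1 : q' = 1 := by
    refine eq_one_of_forall_apply hdense fun g => ?_
    obtain ⟨p, hp, q, hq, rfl⟩ := exists_mul_of_isCompl hPQ g
    have h2 := hh p hp
    rw [map_mul, hP hp' p hp, one_mul] at h2
    rw [map_mul_apply_dual, h2, hQ hq' q hq, one_mul]
  rw [h1, mul_one]
  exact hp'

/-- Compatible decompositions of `L₁` and `L₂` are admissible. -/
theorem admissible_of_isCompl (hdense : DenseRange ι) {P Q : Subgroup L₁} {P' Q' : Subgroup L₂}
    (hPQ : IsCompl P Q) (hPQ' : IsCompl P' Q') (hP : P' ≤ perpRight ι P)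
    (hQ : Q' ≤ perpRight ι Q) : Admissible ι P Q := by
  refine ⟨hPQ, ?_, ?_⟩
  · rw [Subgroup.disjoint_def]
    intro x hxP hxQ
    refine PontryaginDual.ext fun h => ?_
    obtain ⟨p', hp', q', hq', rfl⟩ := exists_mul_of_isCompl hPQ' h
    rw [map_mul, apply_eq_one_of_mem_closure (hP hp') hxP,
      apply_eq_one_of_mem_closure (hQ hq') hxQ, one_mul]
    rfl
  · rw [codisjoint_iff, eq_top_iff]
    have hcl : IsClosed (((P.map ι).topologicalClosure ⊔ (Q.map ι).topologicalClosure :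
        Subgroup (PontryaginDual L₂)) : Set (PontryaginDual L₂)) := by
      rw [Subgroup.mul_normal]
      exact ((Subgroup.isClosed_topologicalClosure _).isCompact.mul
        (Subgroup.isClosed_topologicalClosure _).isCompact).isClosed
    intro x _
    refine hdense.induction_on (p := fun x => x ∈ ((P.map ι).topologicalClosure ⊔
      (Q.map ι).topologicalClosure : Subgroup (PontryaginDual L₂))) x hcl fun g => ?_
    obtain ⟨p, hp, q, hq, rfl⟩ := exists_mul_of_isCompl hPQ g
    rw [map_mul]
    exact Subgroup.mul_mem_sup (Subgroup.le_topologicalClosure _ ⟨p, hp, rfl⟩)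
      (Subgroup.le_topologicalClosure _ ⟨q, hq, rfl⟩)

end Orthogonality

/-! ### The decomposition associated with an admissible decomposition -/

section Associated

variable {L₁ L₂ : Type*} [CommGroup L₁] [CommGroup L₂] [TopologicalSpace L₂]
  [DiscreteTopology L₂] [Countable L₁] [MeasurableSpace L₁] [DiscreteMeasurableSpace L₁]
  {ι : L₁ →* PontryaginDual L₂}

theorem mem_cube {L : Type*} [CommGroup L] {P : Subgroup L} {x : Fin 3 → L} :
    x ∈ cube P ↔ ∀ k, x k ∈ P :=
  ⟨fun h k => h k trivial, fun h k _ => h k⟩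

theorem mulSingle_mem_cube {L : Type*} [CommGroup L] {P : Subgroup L} {k : Fin 3} {g : L}
    (hg : g ∈ P) : Pi.mulSingle k g ∈ cube P := by
  rw [mem_cube]
  intro l
  by_cases hl : l = k
  · subst hl
    rwa [Pi.mulSingle_eq_same]
  · rw [Pi.mulSingle_eq_of_ne hl]
    exact P.one_mem

theorem matAct_mem_cube {L : Type*} [CommGroup L] {P : Subgroup L} (a : Matrix (Fin 3) (Fin 3) ℤ)
    {x : Fin 3 → L} (hx : x ∈ cube P) : matAct a x ∈ cube P :=
  mem_cube.2 fun k => by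
    change ∏ j, x j ^ a k j ∈ P
    exact P.prod_mem fun j _ => P.zpow_mem (mem_cube.1 hx j) _

omit [Countable L₁] [MeasurableSpace L₁] [DiscreteMeasurableSpace L₁] in
theorem cubeHom_apply (g : Fin 3 → L₁) (h : Fin 3 → L₂) :
    cubeHom ι g h = ∏ k, ι (g k) (h k) := rfl

omit [Countable L₁] [MeasurableSpace L₁] [DiscreteMeasurableSpace L₁] in
theorem cubeHom_eq_one {P : Subgroup L₁} {g : Fin 3 → L₁} {h : Fin 3 → L₂} (hg : g ∈ cube P)
    (hh : h ∈ cube (perpRight ι P)) : cubeHom ι g h = 1 := by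
  rw [cubeHom_apply]
  exact Finset.prod_eq_one fun k _ => mem_cube.1 hh k _ (mem_cube.1 hg k)

omit [Countable L₁] [MeasurableSpace L₁] [DiscreteMeasurableSpace L₁] in
theorem cubeHom_mulSingle_left (k : Fin 3) (g : L₁) (h : Fin 3 → L₂) :
    cubeHom ι (Pi.mulSingle k g) h = ι g (h k) := by
  rw [cubeHom_apply, Finset.prod_eq_single k]
  · rw [Pi.mulSingle_eq_same]
  · intro l _ hl
    rw [Pi.mulSingle_eq_of_ne hl, map_one]
    rfl
  · exact fun h => absurd (Finset.mem_univ k) h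

omit [Countable L₁] [MeasurableSpace L₁] [DiscreteMeasurableSpace L₁] in
theorem cubeHom_mulSingle_right (k : Fin 3) (g : Fin 3 → L₁) (h : L₂) :
    cubeHom ι g (Pi.mulSingle k h) = ι (g k) h := by
  rw [cubeHom_apply, Finset.prod_eq_single k]
  · rw [Pi.mulSingle_eq_same]
  · intro l _ hl
    rw [Pi.mulSingle_eq_of_ne hl, map_one]
  · exact fun h => absurd (Finset.mem_univ k) h

theorem exists_cube_mul {L : Type*} [CommGroup L] {P Q : Subgroup L} (hPQ : IsCompl P Q)
    (g : Fin 3 → L) : ∃ p ∈ cube P, ∃ q ∈ cube Q, p * q = g := by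
  choose p hp q hq h using fun k => exists_mul_of_isCompl hPQ (g k)
  exact ⟨p, mem_cube.2 hp, q, mem_cube.2 hq, funext h⟩

variable (ι) in
theorem stdB_eq (P : Subgroup L₁) (P' : Subgroup L₂) :
    stdB ι P P' = (system ι).alg ((cube P).prod (cube P') : Subgroup _) := by
  rw [stdB, groupAlg, groupAlg, join_generatedBy]
  refine le_antisymm (generatedBy_le ?_) (generatedBy_le ?_)
  · rintro _ (⟨g, hg, rfl⟩ | ⟨h, hh, rfl⟩)
    · have h1 : (system ι).U (g, 1) ∈ (system ι).alg ((cube P).prod (cube P') : Subgroup _) :=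
        TwistedSystem.U_mem_alg ⟨hg, (cube P').one_mem⟩
      rwa [TwistedSystem.U, system_U_fst] at h1
    · have h1 : (system ι).U (1, h) ∈ (system ι).alg ((cube P).prod (cube P') : Subgroup _) :=
        TwistedSystem.U_mem_alg ⟨(cube P).one_mem, hh⟩
      rwa [TwistedSystem.U, system_U_snd] at h1
  · rintro _ ⟨i, ⟨hi, hi'⟩, rfl⟩
    refine mul_mem (S := VonNeumannAlgebra _) ?_ ?_
    · exact subset_generatedBy _ (Or.inr ⟨i.2, hi', rfl⟩)
    · exact subset_generatedBy _ (Or.inl ⟨i.1, hi, rfl⟩)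

theorem leftUnitary_mul_of_eq_one {i j : (Fin 3 → L₁) × (Fin 3 → L₂)}
    (h : cubeHom ι i.1 j.2 = 1) : leftUnitary ι i * leftUnitary ι j = leftUnitary ι (i * j) := by
  refine Subtype.ext ((leftUnitary_mul ι i j).trans ?_)
  rw [h, Circle.coe_one, one_smul]

variable (ι) in
theorem leftUnitary_one : leftUnitary ι 1 = 1 :=
  Subtype.ext (system ι).U_one

theorem leftUnitary_injective : Function.Injective (leftUnitary ι) := fun i j h =>
  (system ι).basis_injective (by
    rw [← (system ι).left_base, ← (system ι).left_base j]
    exact congrArg (fun u : unitary (_ →L[ℂ] _) => u.1 (system ι).vac) h)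

theorem mem_stdLambda {Q : Subgroup L₁} {Q' : Subgroup L₂} (hQ : Q' ≤ perpRight ι Q)
    {v : unitary (L2 (PontryaginDual (Fin 3 → L₂)) (Fin 3 → L₁) →L[ℂ]
      L2 (PontryaginDual (Fin 3 → L₂)) (Fin 3 → L₁))} :
    v ∈ stdLambda ι Q Q' ↔ ∃ i : (Fin 3 → L₁) × (Fin 3 → L₂),
      i ∈ (cube Q).prod (cube Q') ∧ v = leftUnitary ι i := by
  have h1 : ∀ {i j : (Fin 3 → L₁) × (Fin 3 → L₂)}, i ∈ (cube Q).prod (cube Q') →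
      j ∈ (cube Q).prod (cube Q') → cubeHom ι i.1 j.2 = 1 := fun hi hj =>
    cubeHom_eq_one hi.1 (mem_cube.2 fun k => hQ (mem_cube.1 hj.2 k))
  constructor
  · let S : Subgroup (unitary (L2 (PontryaginDual (Fin 3 → L₂)) (Fin 3 → L₁) →L[ℂ]
        L2 (PontryaginDual (Fin 3 → L₂)) (Fin 3 → L₁))) :=
      { carrier := {v | ∃ i : (Fin 3 → L₁) × (Fin 3 → L₂),
          i ∈ (cube Q).prod (cube Q') ∧ v = leftUnitary ι i}
        one_mem' := ⟨1, Subgroup.one_mem _, (leftUnitary_one ι).symm⟩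
        mul_mem' := by
          rintro _ _ ⟨i, hi, rfl⟩ ⟨j, hj, rfl⟩
          exact ⟨i * j, Subgroup.mul_mem _ hi hj, leftUnitary_mul_of_eq_one (h1 hi hj)⟩
        inv_mem' := by
          rintro _ ⟨i, hi, rfl⟩
          refine ⟨i⁻¹, Subgroup.inv_mem _ hi, ?_⟩
          rw [inv_eq_iff_mul_eq_one, leftUnitary_mul_of_eq_one (h1 hi (Subgroup.inv_mem _ hi)),
            mul_inv_cancel, leftUnitary_one] }
    have h2 : stdLambda ι Q Q' ≤ S := by
      refine sup_le ?_ ?_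
      · rintro _ ⟨g, hg, rfl⟩
        exact ⟨(g, 1), ⟨hg, Subgroup.one_mem _⟩, (system_U_fst ι g).symm⟩
      · rintro _ ⟨h, hh, rfl⟩
        exact ⟨(1, h), ⟨Subgroup.one_mem _, hh⟩, (system_U_snd ι h).symm⟩
    exact fun hv => h2 hv
  · rintro ⟨i, hi, rfl⟩
    exact Subgroup.mul_mem _ (Subgroup.mem_sup_right ⟨i.2, hi.2, rfl⟩)
      (Subgroup.mem_sup_left ⟨i.1, hi.1, rfl⟩)

/-- Compatible decompositions of `L₁` and `L₂` give a group measure space decomposition. -/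
theorem isGMS_std (hinj : Function.Injective ι) (hdense : DenseRange ι) {P Q : Subgroup L₁}
    {P' Q' : Subgroup L₂} (hPQ : IsCompl P Q) (hPQ' : IsCompl P' Q') (hP : P' ≤ perpRight ι P)
    (hQ : Q' ≤ perpRight ι Q) : (system ι).IsGMS (stdB ι P P') (stdLambda ι Q Q') := by
  rw [stdB_eq]
  have hP1 := eq_perpLeft hinj hPQ hPQ' hP hQ
  have hP2 := eq_perpRight hdense hPQ hPQ' hP hQ
  refine TwistedSystem.isGMS_alg _ _ (fun i hi j hj => ?_) (fun i h => ?_) (fun v hv => ?_)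
    fun i => ?_
  · rw [system_U_comm_iff, cubeHom_eq_one hi.1 (hP2 ▸ hj.2), cubeHom_eq_one hj.1 (hP2 ▸ hi.2)]
  · refine ⟨mem_cube.2 fun k => ?_, mem_cube.2 fun k => ?_⟩
    · rw [hP1]
      intro p' hp'
      have h1 := (system_U_comm_iff ι _ i).1 (h (1, Pi.mulSingle k p')
        ⟨Subgroup.one_mem _, mulSingle_mem_cube hp'⟩)
      rw [cubeHom_one_apply, cubeHom_mulSingle_right] at h1
      exact h1.symm
    · rw [hP2]
      intro p hp
      have h1 := (system_U_comm_iff ι _ i).1 (h (Pi.mulSingle k p, 1)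
        ⟨mulSingle_mem_cube hp, Subgroup.one_mem _⟩)
      rw [cubeHom_mulSingle_left, map_one] at h1
      exact h1
  · obtain ⟨i, hi, rfl⟩ := (mem_stdLambda hQ).1 hv
    refine ⟨i, 1, (one_smul _ _).symm, fun hiP => ?_⟩
    have h1 : i = 1 := by
      refine Prod.ext (funext fun k => ?_) (funext fun k => ?_)
      · exact Subgroup.disjoint_def.1 hPQ.disjoint (mem_cube.1 hiP.1 k) (mem_cube.1 hi.1 k)
      · exact Subgroup.disjoint_def.1 hPQ'.disjoint (mem_cube.1 hiP.2 k) (mem_cube.1 hi.2 k)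
    rw [h1, leftUnitary_one]
  · obtain ⟨p, hp, q, hq, h1⟩ := exists_cube_mul hPQ i.1
    obtain ⟨p', hp', q', hq', h2⟩ := exists_cube_mul hPQ' i.2
    refine ⟨leftUnitary ι (q, q'), (mem_stdLambda hQ).2 ⟨_, ⟨hq, hq'⟩, rfl⟩, (p, p'), ⟨hp, hp'⟩, ?_⟩
    have h3 : (q, q') * (p, p') = i := by
      rw [Prod.mk_mul_mk, mul_comm q, mul_comm q', h1, h2]
    have h4 := leftUnitary_mul ι (q, q') (p, p')
    rw [h3] at h4
    refine ⟨((cubeHom ι q p')⁻¹ : Circle), ?_⟩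
    change (leftUnitary ι i).1 = _ • ((leftUnitary ι (q, q')).1 * (leftUnitary ι (p, p')).1)
    rw [h4, smul_smul, ← Circle.coe_mul, inv_mul_cancel, Circle.coe_one, one_smul]

omit [TopologicalSpace L₂] [DiscreteTopology L₂] [Countable L₁] [MeasurableSpace L₁]
  [DiscreteMeasurableSpace L₁] in
theorem slPerm_mem {P : Subgroup L₁} {P' : Subgroup L₂} (a : Matrix.SpecialLinearGroup (Fin 3) ℤ)
    {i : (Fin 3 → L₁) × (Fin 3 → L₂)} (hi : i ∈ (cube P).prod (cube P')) :
    slPerm a i ∈ (cube P).prod (cube P') :=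
  ⟨matAct_mem_cube _ hi.1, matAct_mem_cube _ hi.2⟩

omit [TopologicalSpace L₂] [DiscreteTopology L₂] [Countable L₁] [MeasurableSpace L₁]
  [DiscreteMeasurableSpace L₁] in
theorem slPerm_inv_mem {P : Subgroup L₁} {P' : Subgroup L₂}
    (a : Matrix.SpecialLinearGroup (Fin 3) ℤ)
    {i : (Fin 3 → L₁) × (Fin 3 → L₂)} (hi : i ∈ (cube P).prod (cube P')) :
    (slPerm a)⁻¹ i ∈ (cube P).prod (cube P') :=
  ⟨matAct_mem_cube _ hi.1, matAct_mem_cube _ hi.2⟩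

theorem isInvariantPair_std (P Q : Subgroup L₁) (P' Q' : Subgroup L₂) (hQ : Q' ≤ perpRight ι Q) :
    IsInvariantPair (beta L₁ L₂) (stdB ι P P') (stdLambda ι Q Q') := by
  intro a
  constructor
  · rw [stdB_eq]
    refine Set.Subset.antisymm ?_ fun x hx => ?_
    · rintro _ ⟨x, hx, rfl⟩
      exact (slSymmetry ι a).conj_mem_alg (fun i hi => slPerm_mem a hi) hx
    · refine ⟨star (slUnitary a).1 * x * (slUnitary a).1,
        (slSymmetry ι a).star_conj_mem_alg (fun i hi => slPerm_inv_mem a hi) hx, ?_⟩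
      rw [beta_apply]
      simp only [mul_assoc, (Unitary.mem_iff.1 (slUnitary a).2).2, mul_one]
      rw [← mul_assoc, (Unitary.mem_iff.1 (slUnitary a).2).2, one_mul]
  · refine Set.Subset.antisymm ?_ ?_
    · rintro _ ⟨_, ⟨v, hv, rfl⟩, rfl⟩
      obtain ⟨i, hi, rfl⟩ := (mem_stdLambda hQ).1 hv
      exact ⟨leftUnitary ι (slPerm a i), (mem_stdLambda hQ).2 ⟨_, slPerm_mem a hi, rfl⟩,
        ((slSymmetry ι a).op_U i).symm⟩
    · rintro _ ⟨v, hv, rfl⟩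
      obtain ⟨i, hi, rfl⟩ := (mem_stdLambda hQ).1 hv
      refine ⟨_, ⟨leftUnitary ι ((slPerm a)⁻¹ i),
        (mem_stdLambda hQ).2 ⟨_, slPerm_inv_mem a hi, rfl⟩, rfl⟩, ?_⟩
      refine ((slSymmetry ι a).op_U ((slPerm a)⁻¹ i)).trans ?_
      change (leftUnitary ι (slPerm a ((slPerm a)⁻¹ i))).1 = _
      rw [MulAut.apply_inv_self]

/-- The summands can be recovered from the associated decomposition, even up to multiples. -/
theorem le_of_stdB_eq {P P' : Subgroup L₁} {R R' : Subgroup L₂}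
    (h : stdB ι P R = stdB ι P' R') : P ≤ P' := by
  intro g hg
  have h1 : (system ι).U (Pi.mulSingle 0 g, 1) ∈
      (system ι).alg ((cube P).prod (cube R) : Subgroup _) :=
    TwistedSystem.U_mem_alg ⟨mulSingle_mem_cube hg, Subgroup.one_mem _⟩
  rw [← stdB_eq, h, stdB_eq] at h1
  by_contra hne
  have h2 := (TwistedSystem.mem_alg_iff.1 h1).2 (Pi.mulSingle 0 g, 1) fun h' => hne (by
    simpa using mem_cube.1 h'.1 0)
  rw [show (system ι).U (Pi.mulSingle 0 g, 1) (system ι).vac = _ from (system ι).left_base _,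
    inner_self_eq_zero] at h2
  exact (system ι).basis_ne_zero _ h2

theorem le_of_circleMultiples_stdLambda {Q Q' : Subgroup L₁} {R R' : Subgroup L₂}
    (hR' : R' ≤ perpRight ι Q')
    (h : circleMultiples (stdLambda ι Q R) ⊆ circleMultiples (stdLambda ι Q' R')) : Q ≤ Q' := by
  classical
  intro g hg
  have h1 : (groupUnitary (cubeHom ι) (Pi.mulSingle 0 g)).1 ∈ circleMultiples (stdLambda ι Q R) :=
    ⟨1, _, Subgroup.mem_sup_left ⟨_, mulSingle_mem_cube (k := 0) hg, rfl⟩, by simp⟩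
  obtain ⟨c, v, hv, hcv⟩ := h h1
  obtain ⟨i, hi, rfl⟩ := (mem_stdLambda hR').1 hv
  rw [← system_U_fst] at hcv
  have h2 : (system ι).basis (Pi.mulSingle 0 g, 1) = (c : ℂ) • (system ι).basis i := by
    rw [← (system ι).left_base, hcv, ← (system ι).left_base i]
    rfl
  have h3 := (system ι).inner_basis i (Pi.mulSingle 0 g, 1)
  rw [h2, inner_smul_right, (system ι).inner_basis, if_pos rfl, mul_one] at h3
  split_ifs at h3 with h4
  · have h5 := mem_cube.1 hi.1 0
    rw [h4] at h5
    simpa using h5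
  · exact absurd h3 c.coe_ne_zero

end Associated

/-! ### Elementary matrices -/

section Transvection

variable {L L₁ L₂ : Type*} [CommGroup L] [CommGroup L₁] [CommGroup L₂]

/-- The elementary matrix `1 + c e_{ij}`, `i ≠ j`, as an element of `SL(3, ℤ)`. -/
def elementary {i j : Fin 3} (hij : i ≠ j) (c : ℤ) : Matrix.SpecialLinearGroup (Fin 3) ℤ :=
  ⟨Matrix.transvection i j c, Matrix.det_transvection_of_ne i j hij c⟩

theorem elementary_mul {i j : Fin 3} (hij : i ≠ j) (c d : ℤ) :
    elementary hij c * elementary hij d = elementary hij (c + d) :=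
  Subtype.ext (Matrix.transvection_mul_transvection_same i j hij c d)

theorem elementary_zero {i j : Fin 3} (hij : i ≠ j) : elementary hij 0 = 1 :=
  Subtype.ext (Matrix.transvection_zero i j)

theorem elementary_inv {i j : Fin 3} (hij : i ≠ j) (c : ℤ) :
    (elementary hij c)⁻¹ = elementary hij (-c) := by
  rw [inv_eq_iff_mul_eq_one, elementary_mul, add_neg_cancel, elementary_zero]

theorem transvection_transpose (i j : Fin 3) (c : ℤ) :
    (Matrix.transvection i j c).transpose = Matrix.transvection j i c := by
  simp [Matrix.transvection]

theorem matAct_transvection (i j : Fin 3) (c : ℤ) (x : Fin 3 → L) :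
    matAct (Matrix.transvection i j c) x = x * Pi.mulSingle i (x j ^ c) := by
  ext k
  change ∏ l, x l ^ (Matrix.transvection i j c) k l = x k * (Pi.mulSingle i (x j ^ c) : Fin 3 → L) k
  have h1 : ∀ l, x l ^ (Matrix.transvection i j c) k l =
      x l ^ (1 : Matrix (Fin 3) (Fin 3) ℤ) k l * x l ^ Matrix.single i j c k l := fun l => by
    rw [← zpow_add]; rfl
  rw [Finset.prod_congr rfl fun l _ => h1 l, Finset.prod_mul_distrib]
  congr 1
  · simp [Matrix.one_apply]
  · by_cases hk : k = i
    · subst hk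
      rw [Pi.mulSingle_eq_same, Finset.prod_eq_single j]
      · simp
      · intro l _ hl
        rw [Matrix.single_apply_of_col_ne _ _ (Ne.symm hl), zpow_zero]
      · exact fun h => absurd (Finset.mem_univ j) h
    · rw [Pi.mulSingle_eq_of_ne hk]
      refine Finset.prod_eq_one fun l _ => ?_
      rw [Matrix.single_apply_of_row_ne (Ne.symm hk), zpow_zero]

theorem slPerm_mul (a b : Matrix.SpecialLinearGroup (Fin 3) ℤ) :
    slPerm (L₁ := L₁) (L₂ := L₂) (a * b) = slPerm a * slPerm b := by
  refine MulEquiv.ext fun p => Prod.ext ?_ ?_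
  · exact matAct_mul a.1 b.1 p.1
  · change matAct (a * b)⁻¹.1.transpose p.2 = matAct a⁻¹.1.transpose (matAct b⁻¹.1.transpose p.2)
    rw [← matAct_mul, ← Matrix.transpose_mul, ← Matrix.SpecialLinearGroup.coe_mul, mul_inv_rev]

theorem slPerm_elementary {i j : Fin 3} (hij : i ≠ j) (c : ℤ)
    (p : (Fin 3 → L₁) × (Fin 3 → L₂)) : slPerm (elementary hij c) p =
      (p.1 * Pi.mulSingle i (p.1 j ^ c), p.2 * Pi.mulSingle j (p.2 i ^ (-c))) := by
  refine Prod.ext (matAct_transvection i j c p.1) ?_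
  change matAct (elementary hij c)⁻¹.1.transpose p.2 = _
  rw [elementary_inv]
  change matAct (Matrix.transvection i j (-c)).transpose p.2 = _
  rw [transvection_transpose, matAct_transvection]

theorem slPerm_elementary_pow {i j : Fin 3} (hij : i ≠ j) (n : ℕ) :
    slPerm (L₁ := L₁) (L₂ := L₂) (elementary hij 1) ^ n = slPerm (elementary hij n) := by
  induction n with
  | zero =>
    refine MulEquiv.ext fun p => ?_
    rw [slPerm_elementary]
    simp
  | succ n ih => rw [pow_succ, ih, ← slPerm_mul, elementary_mul, Nat.cast_succ]

theorem slPerm_elementary_eq_iff {i j : Fin 3} (hij : i ≠ j) (p : (Fin 3 → L₁) × (Fin 3 → L₂)) :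
    slPerm (elementary hij 1) p = p ↔ p.1 j = 1 ∧ p.2 i = 1 := by
  rw [slPerm_elementary, Prod.ext_iff]
  simp

end Transvection

/-! ### Fixed point subgroups and corners for the action of `SL(3, ℤ)` -/

section Corners

variable {L₁ L₂ : Type*} [CommGroup L₁] [CommGroup L₂]

variable (L₁ L₂) in
/-- The embedding of `L₁` in the `k`-th coordinate. -/
def embLeft (k : Fin 3) : L₁ →* (Fin 3 → L₁) × (Fin 3 → L₂) :=
  (MonoidHom.inl _ _).comp (MonoidHom.mulSingle (fun _ => L₁) k)

variable (L₁ L₂) in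
/-- The embedding of `L₂` in the `k`-th coordinate. -/
def embRight (k : Fin 3) : L₂ →* (Fin 3 → L₁) × (Fin 3 → L₂) :=
  (MonoidHom.inr _ _).comp (MonoidHom.mulSingle (fun _ => L₂) k)

theorem embLeft_apply (k : Fin 3) (g : L₁) : embLeft L₁ L₂ k g = (Pi.mulSingle k g, 1) := rfl

theorem embRight_apply (k : Fin 3) (h : L₂) : embRight L₁ L₂ k h = (1, Pi.mulSingle k h) := rfl

theorem slPerm_embLeft {i j : Fin 3} (hij : i ≠ j) (c : ℤ) (g : L₁) :
    slPerm (elementary hij c) (embLeft L₁ L₂ j g) =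
      embLeft L₁ L₂ j g * embLeft L₁ L₂ i (g ^ c) := by
  rw [slPerm_elementary]
  simp [embLeft_apply]

theorem slPerm_embLeft_self {i j : Fin 3} (hij : i ≠ j) (c : ℤ) (g : L₁) :
    slPerm (elementary hij c) (embLeft L₁ L₂ i g) = embLeft L₁ L₂ i g := by
  rw [slPerm_elementary]
  simp [embLeft_apply, hij.symm]

theorem slPerm_embRight {i j : Fin 3} (hij : i ≠ j) (c : ℤ) (h : L₂) :
    slPerm (elementary hij c) (embRight L₁ L₂ i h) =
      embRight L₁ L₂ i h * embRight L₁ L₂ j (h ^ (-c)) := by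
  rw [slPerm_elementary]
  simp [embRight_apply]

theorem slPerm_embRight_self {i j : Fin 3} (hij : i ≠ j) (c : ℤ) (h : L₂) :
    slPerm (elementary hij c) (embRight L₁ L₂ j h) = embRight L₁ L₂ j h := by
  rw [slPerm_elementary]
  simp [embRight_apply, hij]

/-- `g` is first added to the `j`-th coordinate, and then removed from the `i`-th one. -/
theorem slPerm_flip_embLeft {i j : Fin 3} (hij : i ≠ j) (g : L₁) :
    slPerm (elementary hij (-1) * elementary hij.symm 1) (embLeft L₁ L₂ i g) =
      embLeft L₁ L₂ j g := by
  rw [slPerm_mul, MulAut.mul_apply, slPerm_embLeft, map_mul, slPerm_embLeft, slPerm_embLeft_self,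
    zpow_one, zpow_neg, zpow_one, map_inv, mul_left_comm, mul_inv_cancel, mul_one]

theorem slPerm_flip_embRight {i j : Fin 3} (hij : i ≠ j) (h : L₂) :
    slPerm (elementary hij.symm 1 * elementary hij (-1)) (embRight L₁ L₂ i h) =
      embRight L₁ L₂ j h := by
  rw [slPerm_mul, MulAut.mul_apply, slPerm_embRight, map_mul, slPerm_embRight,
    slPerm_embRight_self, neg_neg, zpow_one, zpow_neg, zpow_one, map_inv, mul_left_comm,
    mul_inv_cancel, mul_one]

theorem mem_range_embLeft {k : Fin 3} {p : (Fin 3 → L₁) × (Fin 3 → L₂)} :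
    p ∈ (embLeft L₁ L₂ k).range ↔ (∀ l, l ≠ k → p.1 l = 1) ∧ p.2 = 1 := by
  constructor
  · rintro ⟨g, rfl⟩
    exact ⟨fun l hl => Pi.mulSingle_eq_of_ne (M := fun _ => L₁) hl g, rfl⟩
  · rintro ⟨h1, h2⟩
    refine ⟨p.1 k, Prod.ext (funext fun l => ?_) h2.symm⟩
    by_cases hl : l = k
    · subst hl
      exact Pi.mulSingle_eq_same l _
    · rw [h1 l hl]
      exact Pi.mulSingle_eq_of_ne hl _

theorem mem_range_embRight {k : Fin 3} {p : (Fin 3 → L₁) × (Fin 3 → L₂)} :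
    p ∈ (embRight L₁ L₂ k).range ↔ (∀ l, l ≠ k → p.2 l = 1) ∧ p.1 = 1 := by
  constructor
  · rintro ⟨g, rfl⟩
    exact ⟨fun l hl => Pi.mulSingle_eq_of_ne (M := fun _ => L₂) hl g, rfl⟩
  · rintro ⟨h1, h2⟩
    refine ⟨p.2 k, Prod.ext h2.symm (funext fun l => ?_)⟩
    by_cases hl : l = k
    · subst hl
      exact Pi.mulSingle_eq_same l _
    · rw [h1 l hl]
      exact Pi.mulSingle_eq_of_ne hl _

variable [TopologicalSpace L₂] [DiscreteTopology L₂] [Countable L₁] [MeasurableSpace L₁]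
  [DiscreteMeasurableSpace L₁] {ι : L₁ →* PontryaginDual L₂}

variable {B : VonNeumannAlgebra (L2 (PontryaginDual (Fin 3 → L₂)) (Fin 3 → L₁))}
  {Λ : Subgroup (unitary (L2 (PontryaginDual (Fin 3 → L₂)) (Fin 3 → L₁) →L[ℂ]
    L2 (PontryaginDual (Fin 3 → L₂)) (Fin 3 → L₁)))}

theorem preserves_slSymmetry (hI : IsInvariantPair (beta L₁ L₂) B Λ)
    (a : Matrix.SpecialLinearGroup (Fin 3) ℤ) : (slSymmetry ι a).Preserves B Λ := by
  refine ⟨fun b hb => ?_, fun v hv => ?_⟩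
  · have h1 : beta L₁ L₂ a b ∈ (B : Set (_ →L[ℂ] _)) := by
      rw [← (hI a).1]
      exact ⟨b, hb, rfl⟩
    exact h1
  · have h1 : beta L₁ L₂ a v.1 ∈ Subtype.val '' (Λ : Set (unitary (_ →L[ℂ] _))) := by
      rw [← (hI a).2]
      exact ⟨v.1, ⟨v, hv, rfl⟩, rfl⟩
    obtain ⟨w, hw, hwv⟩ := h1
    have h2 : w = (slSymmetry ι a).op * v * (slSymmetry ι a).op⁻¹ := Subtype.ext hwv
    exact h2 ▸ hw

/-- The orbit of an index that is not fixed contains the powers of an element `≠ 1` of the torsion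
free group `L₁` or `L₂`. -/
theorem freeOffFixed_elementary [IsMulTorsionFree L₁] [IsMulTorsionFree L₂] {i j : Fin 3}
    (hij : i ≠ j) : (slSymmetry ι (elementary hij 1)).FreeOffFixed := by
  intro p hp m n hmn
  change (slPerm (elementary hij 1) ^ m) p = (slPerm (elementary hij 1) ^ n) p at hmn
  rw [slPerm_elementary_pow, slPerm_elementary_pow, slPerm_elementary, slPerm_elementary,
    Prod.mk.injEq, mul_right_inj, mul_right_inj, Pi.mulSingle_inj, Pi.mulSingle_inj] at hmn
  by_contra hne
  refine hp ((slPerm_elementary_eq_iff hij p).2 ⟨?_, ?_⟩)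
  · by_contra h1
    exact hne (Nat.cast_injective
      (injective_zpow_iff_not_isOfFinOrder.2 (not_isOfFinOrder_of_isMulTorsionFree h1) hmn.1))
  · by_contra h1
    exact hne (Nat.cast_injective (neg_injective
      (injective_zpow_iff_not_isOfFinOrder.2 (not_isOfFinOrder_of_isMulTorsionFree h1) hmn.2)))

/-- Four elementary matrices fixing the `k`-th basis vector have the `k`-th copy of `L₁` as their
common fixed points in `L₁³ × L₂³`. -/
theorem isFixedSubgroup_embLeft [IsMulTorsionFree L₁] [IsMulTorsionFree L₂]
    (hI : IsInvariantPair (beta L₁ L₂) B Λ) {k l m : Fin 3} (hkl : k ≠ l) (hkm : k ≠ m)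
    (hlm : l ≠ m) (hall : ∀ i, i = k ∨ i = l ∨ i = m) :
    TwistedSystem.IsFixedSubgroup (𝒮 := system ι) B Λ
      [slSymmetry ι (elementary hkl 1), slSymmetry ι (elementary hkm 1),
        slSymmetry ι (elementary hlm 1), slSymmetry ι (elementary hlm.symm 1)]
      (embLeft L₁ L₂ k).range where
  preserves := by
    simp only [List.forall_mem_cons, preserves_slSymmetry hI, true_and]
    simp
  free := by
    simp only [List.forall_mem_cons, freeOffFixed_elementary, true_and]
    simp
  mem_iff p := by
    rw [mem_range_embLeft]
    simp only [List.forall_mem_cons, slSymmetry, slPerm_elementary_eq_iff]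
    constructor
    · rintro ⟨h1, h2⟩
      simp [h1 l hkl.symm, h1 m hkm.symm, h2]
    · rintro ⟨⟨h1, h2⟩, ⟨h3, -⟩, ⟨-, h4⟩, ⟨-, h5⟩, -⟩
      refine ⟨fun i hi => ?_, funext fun i => ?_⟩
      · obtain rfl | rfl | rfl := hall i
        exacts [absurd rfl hi, h1, h3]
      · obtain rfl | rfl | rfl := hall i
        exacts [h2, h4, h5]

theorem isFixedSubgroup_embRight [IsMulTorsionFree L₁] [IsMulTorsionFree L₂]
    (hI : IsInvariantPair (beta L₁ L₂) B Λ) {k l m : Fin 3} (hkl : k ≠ l) (hkm : k ≠ m)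
    (hlm : l ≠ m) (hall : ∀ i, i = k ∨ i = l ∨ i = m) :
    TwistedSystem.IsFixedSubgroup (𝒮 := system ι) B Λ
      [slSymmetry ι (elementary hkl.symm 1), slSymmetry ι (elementary hkm.symm 1),
        slSymmetry ι (elementary hlm 1), slSymmetry ι (elementary hlm.symm 1)]
      (embRight L₁ L₂ k).range where
  preserves := by
    simp only [List.forall_mem_cons, preserves_slSymmetry hI, true_and]
    simp
  free := by
    simp only [List.forall_mem_cons, freeOffFixed_elementary, true_and]
    simp
  mem_iff p := by
    rw [mem_range_embRight]
    simp only [List.forall_mem_cons, slSymmetry, slPerm_elementary_eq_iff]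
    constructor
    · rintro ⟨h1, h2⟩
      simp [h1 l hkl.symm, h1 m hkm.symm, h2]
    · rintro ⟨⟨h1, h2⟩, ⟨-, h3⟩, ⟨h4, -⟩, ⟨h5, -⟩, -⟩
      refine ⟨fun i hi => ?_, funext fun i => ?_⟩
      · obtain rfl | rfl | rfl := hall i
        exacts [absurd rfl hi, h2, h3]
      · obtain rfl | rfl | rfl := hall i
        exacts [h1, h5, h4]

theorem leftUnitary_embLeft_mul (k l : Fin 3) (g g' : L₁) :
    leftUnitary ι (embLeft L₁ L₂ k g) * leftUnitary ι (embLeft L₁ L₂ l g') =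
      leftUnitary ι (embLeft L₁ L₂ k g * embLeft L₁ L₂ l g') :=
  leftUnitary_mul_of_eq_one (map_one (cubeHom ι (Pi.mulSingle k g)))

theorem leftUnitary_embRight_mul (k l : Fin 3) (h h' : L₂) :
    leftUnitary ι (embRight L₁ L₂ k h) * leftUnitary ι (embRight L₁ L₂ l h') =
      leftUnitary ι (embRight L₁ L₂ k h * embRight L₁ L₂ l h') :=
  leftUnitary_mul_of_eq_one (cubeHom_one_apply ι (Pi.mulSingle l h'))

/-- The corner given by the first two copies of `L₁`. -/
def cornerLeft [IsMulTorsionFree L₁] [IsMulTorsionFree L₂]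
    (hI : IsInvariantPair (beta L₁ L₂) B Λ) :
    (system ι).Corner B Λ (embLeft L₁ L₂ 0) (embLeft L₁ L₂ 1) where
  E₁ := _
  E₂ := _
  fixed₁ := isFixedSubgroup_embLeft hI (l := 1) (m := 2) (by decide) (by decide) (by decide)
    (by decide)
  fixed₂ := isFixedSubgroup_embLeft hI (l := 0) (m := 2) (by decide) (by decide) (by decide)
    (by decide)
  diag := slSymmetry ι (elementary (i := 1) (j := 0) (by decide) 1)
  flip := slSymmetry ι (elementary (i := 0) (j := 1) (by decide) (-1) *
    elementary (i := 1) (j := 0) (by decide) 1)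
  diag_preserves := preserves_slSymmetry hI _
  flip_preserves := preserves_slSymmetry hI _
  diag_perm g := (slPerm_embLeft _ 1 g).trans (by rw [zpow_one])
  flip_perm := slPerm_flip_embLeft _
  U_mul g h := congrArg Subtype.val (leftUnitary_embLeft_mul 0 1 g h)
  U_mul' g h := congrArg Subtype.val
    ((leftUnitary_embLeft_mul 1 0 h g).trans (congrArg _ (mul_comm _ _)))
  inj g h g' h' H := by
    have h0 := congrFun (congrArg Prod.fst H) 0
    have h1 := congrFun (congrArg Prod.fst H) 1
    simp [embLeft_apply] at h0 h1
    exact ⟨h0, h1⟩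

/-- The corner given by the first two copies of `L₂`. -/
def cornerRight [IsMulTorsionFree L₁] [IsMulTorsionFree L₂]
    (hI : IsInvariantPair (beta L₁ L₂) B Λ) :
    (system ι).Corner B Λ (embRight L₁ L₂ 0) (embRight L₁ L₂ 1) where
  E₁ := _
  E₂ := _
  fixed₁ := isFixedSubgroup_embRight hI (l := 1) (m := 2) (by decide) (by decide) (by decide)
    (by decide)
  fixed₂ := isFixedSubgroup_embRight hI (l := 0) (m := 2) (by decide) (by decide) (by decide)
    (by decide)
  diag := slSymmetry ι (elementary (i := 0) (j := 1) (by decide) (-1))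
  flip := slSymmetry ι (elementary (i := 1) (j := 0) (by decide) 1 *
    elementary (i := 0) (j := 1) (by decide) (-1))
  diag_preserves := preserves_slSymmetry hI _
  flip_preserves := preserves_slSymmetry hI _
  diag_perm g := (slPerm_embRight _ (-1) g).trans (by rw [neg_neg, zpow_one])
  flip_perm := slPerm_flip_embRight _
  U_mul g h := congrArg Subtype.val (leftUnitary_embRight_mul 0 1 g h)
  U_mul' g h := congrArg Subtype.val
    ((leftUnitary_embRight_mul 1 0 h g).trans (congrArg _ (mul_comm _ _)))
  inj g h g' h' H := by
    have h0 := congrFun (congrArg Prod.snd H) 0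
    have h1 := congrFun (congrArg Prod.snd H) 1
    simp [embRight_apply] at h0 h1
    exact ⟨h0, h1⟩

end Corners

/-! ### Invariant decompositions come from admissible decompositions -/

section Converse

/-- The group of unitaries of a von Neumann algebra. -/
def unitarySubgroup {H : Type*} [NormedAddCommGroup H] [InnerProductSpace ℂ H] [CompleteSpace H]
    (B : VonNeumannAlgebra H) : Subgroup (unitary (H →L[ℂ] H)) where
  carrier := {u | (u : H →L[ℂ] H) ∈ B}
  one_mem' := one_mem B
  mul_mem' hu hv := mul_mem (S := VonNeumannAlgebra H) hu hv
  inv_mem' hu := star_mem (S := VonNeumannAlgebra H) hu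

namespace TwistedSystem

variable {I H L : Type*} [CommGroup I] [NormedAddCommGroup H] [InnerProductSpace ℂ H]
  [CompleteSpace H] [Group L] {𝒮 : TwistedSystem I H} {B : VonNeumannAlgebra H}
  {Λ Λ' : Subgroup (unitary (H →L[ℂ] H))}

/-- Group measure space decompositions with the same algebra and comparable groups are equal. -/
theorem IsGMS.group_eq_of_le (hG : 𝒮.IsGMS B Λ) (hG' : 𝒮.IsGMS B Λ') (h : Λ' ≤ Λ) : Λ = Λ' := by
  refine le_antisymm (fun v hv => ?_) h
  by_contra hv'
  refine unitary_vac_ne_zero (𝒮 := 𝒮) v (inner_self_eq_zero (𝕜 := ℂ).1 ?_)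
  refine inner_eq_zero_of_hull ?_ (hG'.mem_hull _)
  rintro _ ⟨w, hw, b, hb, rfl⟩
  refine hG.inner_eq_zero hv (h hw) ?_ (one_mem B) hb
  rintro rfl
  exact hv' hw

theorem IsGMS.isCompl_comap (hG : 𝒮.IsGMS B Λ) (u : L →* unitary (H →L[ℂ] H))
    (hu : Function.Injective u)
    (h : ∀ g, ∃ p q, g = p * q ∧ (u p : H →L[ℂ] H) ∈ B ∧ u q ∈ Λ) :
    IsCompl ((unitarySubgroup B).comap u) (Λ.comap u) := by
  constructor
  · rw [Subgroup.disjoint_def]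
    intro g hB hΛ
    have h1 : u g = 1 := hG.eq_of_apply_vac hΛ Λ.one_mem (b := u g) hB rfl
    exact hu (h1.trans (map_one u).symm)
  · rw [codisjoint_iff, eq_top_iff]
    intro g _
    obtain ⟨p, q, rfl, hp, hq⟩ := h g
    exact Subgroup.mul_mem_sup hp hq

end TwistedSystem

variable {L₁ L₂ : Type*} [CommGroup L₁] [CommGroup L₂] [TopologicalSpace L₂]
  [DiscreteTopology L₂] [Countable L₁] [MeasurableSpace L₁] [DiscreteMeasurableSpace L₁]
  {ι : L₁ →* PontryaginDual L₂}

variable (ι) in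
/-- The canonical unitaries of the first copy of `L₁`. -/
def coordLeft : L₁ →* unitary (L2 (PontryaginDual (Fin 3 → L₂)) (Fin 3 → L₁) →L[ℂ]
    L2 (PontryaginDual (Fin 3 → L₂)) (Fin 3 → L₁)) :=
  (groupUnitary (cubeHom ι)).comp (MonoidHom.mulSingle (fun _ => L₁) 0)

variable (L₁ L₂) in
/-- The canonical unitaries of the first copy of `L₂`. -/
def coordRight : L₂ →* unitary (L2 (PontryaginDual (Fin 3 → L₂)) (Fin 3 → L₁) →L[ℂ]
    L2 (PontryaginDual (Fin 3 → L₂)) (Fin 3 → L₁)) :=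
  (charUnitary L₁).comp (MonoidHom.mulSingle (fun _ => L₂) 0)

theorem leftUnitary_embLeft (k : Fin 3) (g : L₁) :
    leftUnitary ι (embLeft L₁ L₂ k g) = groupUnitary (cubeHom ι) (Pi.mulSingle k g) :=
  system_U_fst ι _

theorem leftUnitary_embRight (ι : L₁ →* PontryaginDual L₂) (k : Fin 3) (h : L₂) :
    leftUnitary ι (embRight L₁ L₂ k h) = charUnitary L₁ (Pi.mulSingle k h) :=
  system_U_snd ι _

theorem apply_eq_one_of_commute {g : L₁} {h : L₂}
    (hgh : (coordLeft ι g).1 * (coordRight L₁ L₂ h).1 =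
      (coordRight L₁ L₂ h).1 * (coordLeft ι g).1) : ι g h = 1 := by
  have hl : coordLeft ι g = leftUnitary ι (embLeft L₁ L₂ 0 g) := (leftUnitary_embLeft 0 g).symm
  have hr : coordRight L₁ L₂ h = leftUnitary ι (embRight L₁ L₂ 0 h) :=
    (leftUnitary_embRight ι 0 h).symm
  rw [hl, hr] at hgh
  have h1 := (system_U_comm_iff ι (embLeft L₁ L₂ 0 g) (embRight L₁ L₂ 0 h)).1 hgh
  rw [embLeft_apply, embRight_apply, cubeHom_mulSingle_left, map_one] at h1
  change ι g ((Pi.mulSingle 0 h : Fin 3 → L₂) 0) = 1 at h1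
  rwa [Pi.mulSingle_eq_same] at h1

theorem coordLeft_injective : Function.Injective (coordLeft ι) := fun g g' h => by
  change groupUnitary (cubeHom ι) (Pi.mulSingle 0 g) =
    groupUnitary (cubeHom ι) (Pi.mulSingle 0 g') at h
  rw [← leftUnitary_embLeft, ← leftUnitary_embLeft] at h
  have h1 := congrArg Prod.fst (leftUnitary_injective h)
  exact Pi.mulSingle_injective 0 h1

theorem coordRight_injective (ι : L₁ →* PontryaginDual L₂) :
    Function.Injective (coordRight L₁ L₂) := fun g g' h => by
  change charUnitary L₁ (Pi.mulSingle 0 g) = charUnitary L₁ (Pi.mulSingle 0 g') at h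
  rw [← leftUnitary_embRight ι, ← leftUnitary_embRight ι] at h
  have h1 := congrArg Prod.snd (leftUnitary_injective h)
  exact Pi.mulSingle_injective 0 h1

variable {B : VonNeumannAlgebra (L2 (PontryaginDual (Fin 3 → L₂)) (Fin 3 → L₁))}
  {Λ : Subgroup (unitary (L2 (PontryaginDual (Fin 3 → L₂)) (Fin 3 → L₁) →L[ℂ]
    L2 (PontryaginDual (Fin 3 → L₂)) (Fin 3 → L₁)))}

/-- A group of unitaries that is invariant under `SL(3, ℤ)` contains all copies of what it
contains in the first coordinate. -/
theorem groupUnitary_mem_of_invariant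
    {S : Subgroup (unitary (L2 (PontryaginDual (Fin 3 → L₂)) (Fin 3 → L₁) →L[ℂ]
      L2 (PontryaginDual (Fin 3 → L₂)) (Fin 3 → L₁)))}
    (hS : ∀ a, ∀ v ∈ S, (slSymmetry ι a).op * v * (slSymmetry ι a).op⁻¹ ∈ S) {g : Fin 3 → L₁}
    (hg : g ∈ cube (S.comap (coordLeft ι))) : groupUnitary (cubeHom ι) g ∈ S := by
  have h1 : g ∈ S.comap (groupUnitary (cubeHom ι)) := by
    rw [← Finset.univ_prod_mulSingle g]
    refine Subgroup.prod_mem _ fun k _ => ?_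
    change groupUnitary (cubeHom ι) (Pi.mulSingle k (g k)) ∈ S
    have h2 : groupUnitary (cubeHom ι) (Pi.mulSingle 0 (g k)) ∈ S := mem_cube.1 hg k
    by_cases hk : 0 = k
    · rwa [← hk] at h2 ⊢
    · rw [← leftUnitary_embLeft] at h2 ⊢
      have h3 := hS (elementary hk (-1) * elementary (Ne.symm hk) 1) _ h2
      rw [← slPerm_flip_embLeft hk]
      convert h3 using 1
      exact Subtype.ext ((slSymmetry ι _).op_U _).symm
  exact h1

theorem charUnitary_mem_of_invariant (ι : L₁ →* PontryaginDual L₂)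
    {S : Subgroup (unitary (L2 (PontryaginDual (Fin 3 → L₂)) (Fin 3 → L₁) →L[ℂ]
    L2 (PontryaginDual (Fin 3 → L₂)) (Fin 3 → L₁)))}
    (hS : ∀ a, ∀ v ∈ S, (slSymmetry ι a).op * v * (slSymmetry ι a).op⁻¹ ∈ S) {h : Fin 3 → L₂}
    (hh : h ∈ cube (S.comap (coordRight L₁ L₂))) : charUnitary L₁ h ∈ S := by
  have h1 : h ∈ S.comap (charUnitary L₁) := by
    rw [← Finset.univ_prod_mulSingle h]
    refine Subgroup.prod_mem _ fun k _ => ?_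
    change charUnitary L₁ (Pi.mulSingle k (h k)) ∈ S
    have h2 : charUnitary L₁ (Pi.mulSingle 0 (h k)) ∈ S := mem_cube.1 hh k
    by_cases hk : 0 = k
    · rwa [← hk] at h2 ⊢
    · rw [← leftUnitary_embRight ι] at h2 ⊢
      have h3 := hS (elementary (Ne.symm hk) 1 * elementary hk (-1)) _ h2
      rw [← slPerm_flip_embRight hk]
      convert h3 using 1
      exact Subtype.ext ((slSymmetry ι _).op_U _).symm
  exact h1

theorem invariant_unitarySubgroup (ι : L₁ →* PontryaginDual L₂)
    (hI : IsInvariantPair (beta L₁ L₂) B Λ) (a : Matrix.SpecialLinearGroup (Fin 3) ℤ) :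
    ∀ v ∈ unitarySubgroup B, (slSymmetry ι a).op * v * (slSymmetry ι a).op⁻¹ ∈ unitarySubgroup B :=
  fun v hv => (preserves_slSymmetry (ι := ι) hI a).1 v.1 hv

theorem isCompl_comap_coordLeft [IsMulTorsionFree L₁] [IsMulTorsionFree L₂]
    (hG : (system ι).IsGMS B Λ) (hI : IsInvariantPair (beta L₁ L₂) B Λ) :
    IsCompl ((unitarySubgroup B).comap (coordLeft ι)) (Λ.comap (coordLeft ι)) :=
  hG.isCompl_comap _ coordLeft_injective fun g => by
    obtain ⟨p, q, h, hp, hq⟩ := (cornerLeft (ι := ι) hI).exists_decomposition hG g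
    exact ⟨p, q, h, leftUnitary_embLeft (ι := ι) 0 p ▸ hp, leftUnitary_embLeft (ι := ι) 0 q ▸ hq⟩

theorem isCompl_comap_coordRight [IsMulTorsionFree L₁] [IsMulTorsionFree L₂]
    (hG : (system ι).IsGMS B Λ) (hI : IsInvariantPair (beta L₁ L₂) B Λ) :
    IsCompl ((unitarySubgroup B).comap (coordRight L₁ L₂)) (Λ.comap (coordRight L₁ L₂)) :=
  hG.isCompl_comap _ (coordRight_injective ι) fun g => by
    obtain ⟨p, q, h, hp, hq⟩ := (cornerRight (ι := ι) hI).exists_decomposition hG g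
    exact ⟨p, q, h, leftUnitary_embRight ι 0 p ▸ hp, leftUnitary_embRight ι 0 q ▸ hq⟩

theorem comap_unitarySubgroup_le_perpRight (hG : (system ι).IsGMS B Λ) :
    (unitarySubgroup B).comap (coordRight L₁ L₂) ≤
      perpRight ι ((unitarySubgroup B).comap (coordLeft ι)) :=
  fun _ hh _ hg => apply_eq_one_of_commute (hG.abelian _ hg _ hh)

/-- Canonical unitaries in `Λ` commute: their commutator is a scalar in `Λ`. -/
theorem comap_le_perpRight (hG : (system ι).IsGMS B Λ) :
    Λ.comap (coordRight L₁ L₂) ≤ perpRight ι (Λ.comap (coordLeft ι)) := fun h hh g hg =>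
  apply_eq_one_of_commute (congrArg Subtype.val
    (hG.eq_of_smul (Λ.mul_mem hg hh) (Λ.mul_mem hh hg)
      (groupUnitary_mul_charUnitary ι (Pi.mulSingle 0 g) (Pi.mulSingle 0 h))))

theorem stdB_comap_le (hI : IsInvariantPair (beta L₁ L₂) B Λ) :
    stdB ι ((unitarySubgroup B).comap (coordLeft ι))
      ((unitarySubgroup B).comap (coordRight L₁ L₂)) ≤ B := by
  rw [stdB, groupAlg, groupAlg, join_generatedBy]
  refine generatedBy_le ?_
  rintro _ (⟨g, hg, rfl⟩ | ⟨h, hh, rfl⟩)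
  · exact groupUnitary_mem_of_invariant (invariant_unitarySubgroup ι hI) hg
  · exact charUnitary_mem_of_invariant ι (invariant_unitarySubgroup ι hI) hh

theorem stdLambda_comap_le (hI : IsInvariantPair (beta L₁ L₂) B Λ) :
    stdLambda ι (Λ.comap (coordLeft ι)) (Λ.comap (coordRight L₁ L₂)) ≤ Λ := by
  refine sup_le ?_ ?_
  · rintro _ ⟨g, hg, rfl⟩
    exact groupUnitary_mem_of_invariant (fun a => (preserves_slSymmetry (ι := ι) hI a).2) hg
  · rintro _ ⟨h, hh, rfl⟩
    exact charUnitary_mem_of_invariant ι (fun a => (preserves_slSymmetry (ι := ι) hI a).2) hh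

/-- An invariant group measure space decomposition is associated with the decompositions of `L₁`
and `L₂` into the elements whose canonical unitaries lie in `B` and in `Λ`. -/
theorem exists_admissible [IsMulTorsionFree L₁] [IsMulTorsionFree L₂]
    (hinj : Function.Injective ι) (hdense : DenseRange ι) (hG : (system ι).IsGMS B Λ)
    (hI : IsInvariantPair (beta L₁ L₂) B Λ) : ∃ P Q : Subgroup L₁, Admissible ι P Q ∧
      B = stdB ι P (perpRight ι P) ∧ Λ = stdLambda ι Q (perpRight ι Q) := by
  have hPQ := isCompl_comap_coordLeft hG hI
  have hPQ' := isCompl_comap_coordRight hG hI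
  have hP := comap_unitarySubgroup_le_perpRight hG
  have hQ := comap_le_perpRight hG
  have hB := stdB_comap_le (ι := ι) hI
  have hΛ := stdLambda_comap_le (ι := ι) hI
  have hS := isGMS_std hinj hdense hPQ hPQ' hP hQ
  have hBeq := le_antisymm
    (fun b hb => hS.maximal b (hG.le hb) fun c hc => hG.abelian c (hB hc) b hb) hB
  refine ⟨_, _, admissible_of_isCompl hdense hPQ hPQ' hP hQ, ?_, ?_⟩
  · rw [← eq_perpRight hdense hPQ hPQ' hP hQ]
    exact hBeq
  · rw [← eq_perpRight hdense hPQ.symm hPQ'.symm hQ hP]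
    rw [← hBeq] at hS
    exact hG.group_eq_of_le hS hΛ

end Converse

end GMS

end

theorem proposition6p1
    {L₁ L₂ : Type*} [CommGroup L₁] [CommGroup L₂] [Countable L₁] [Countable L₂]
    [IsMulTorsionFree L₁] [IsMulTorsionFree L₂]
    [MeasurableSpace L₁] [DiscreteMeasurableSpace L₁] [TopologicalSpace L₂] [DiscreteTopology L₂]
    (ι : L₁ →* PontryaginDual L₂) (hinj : Function.Injective ι) (hdense : DenseRange ι) :
    (∀ P₁ Q₁ : Subgroup L₁, GMS.Admissible ι P₁ Q₁ →
      ∀ P₂ Q₂ : Subgroup L₂, P₂ = GMS.perpRight ι P₁ → Q₂ = GMS.perpRight ι Q₁ →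
        (IsCompl P₂ Q₂ ∧ P₁ = GMS.perpLeft ι P₂ ∧ Q₁ = GMS.perpLeft ι Q₂) ∧
        GMS.IsGMSDecomposition (GMS.algA ι) (GMS.traceA L₁ L₂)
          (GMS.stdB ι P₁ P₂) (GMS.stdLambda ι Q₁ Q₂) ∧
        GMS.IsInvariantPair (GMS.beta L₁ L₂) (GMS.stdB ι P₁ P₂) (GMS.stdLambda ι Q₁ Q₂)) ∧
    (∀ (B : VonNeumannAlgebra (GMS.L2 (PontryaginDual (Fin 3 → L₂)) (Fin 3 → L₁)))
      (Λ : Subgroup (unitary (GMS.L2 (PontryaginDual (Fin 3 → L₂)) (Fin 3 → L₁) →L[ℂ]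
        GMS.L2 (PontryaginDual (Fin 3 → L₂)) (Fin 3 → L₁)))),
      GMS.IsGMSDecomposition (GMS.algA ι) (GMS.traceA L₁ L₂) B Λ →
      GMS.IsInvariantPair (GMS.beta L₁ L₂) B Λ →
      ∃ P₁ Q₁ : Subgroup L₁, GMS.Admissible ι P₁ Q₁ ∧
        B = GMS.stdB ι P₁ (GMS.perpRight ι P₁) ∧
        Λ = GMS.stdLambda ι Q₁ (GMS.perpRight ι Q₁) ∧
        ∀ P₁' Q₁' : Subgroup L₁, GMS.Admissible ι P₁' Q₁' →
          GMS.Identical B Λ (GMS.stdB ι P₁' (GMS.perpRight ι P₁'))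
            (GMS.stdLambda ι Q₁' (GMS.perpRight ι Q₁')) →
          P₁' = P₁ ∧ Q₁' = Q₁) := by
  refine ⟨?_, fun B Λ hG hI => ?_⟩
  · rintro P Q hPQ _ _ rfl rfl
    have h := hPQ.isCompl_perpRight hdense
    exact ⟨⟨h, GMS.eq_perpLeft hinj hPQ.1 h le_rfl le_rfl,
      GMS.eq_perpLeft hinj hPQ.1.symm h.symm le_rfl le_rfl⟩,
      (GMS.isGMSDecomposition_iff ι).2 (GMS.isGMS_std hinj hdense hPQ.1 h le_rfl le_rfl),
      GMS.isInvariantPair_std P Q _ _ le_rfl⟩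
  · obtain ⟨P, Q, hPQ, rfl, rfl⟩ :=
      GMS.exists_admissible hinj hdense ((GMS.isGMSDecomposition_iff ι).1 hG) hI
    refine ⟨P, Q, hPQ, rfl, rfl, fun P' Q' _ h => ⟨?_, ?_⟩⟩
    · exact le_antisymm (GMS.le_of_stdB_eq h.1.symm) (GMS.le_of_stdB_eq h.1)
    · exact le_antisymm (GMS.le_of_circleMultiples_stdLambda le_rfl h.2.ge)
        (GMS.le_of_circleMultiples_stdLambda le_rfl h.2.le)
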